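/- A \emph{bipartite hypergraph} $H=(A,B,E)$ has finite disjoint vertex sets $A,B$ and a set $E$ of edges $e\subseteq A\cup B$ with $|e\cap A|=1$ and $B(e):=e\cap B\neq\emptyset$; put $n:=|A|+|B|$. It is \emph{$r$-bounded} if $|B(e)|\le r$ for all $e\in E$. A (partial) \emph{matching} is a set of pairwise disjoint edges; it is \emph{perfect} if it covers every vertex of $A$. $H$ satisfies the \emph{$\varphi$-strong Haxell condition} if for every $S\subseteq A$ every set of vertices of $B$ that meets all edges $e\in E$ with $e\cap S\ne\emptyset$ has at least $\varphi|S|$ elements. A \emph{state} $(A',B',M)$ consists of sets $A'\subseteq A$, $B'\subseteq B$ and a partial matching $M$. A \emph{half layer} with respect to the state and a degree parameter $\Delta$ is a set $Z\subseteq E\setminus M$ such that (1) the $A$-vertex of every $e\in Z$ lies in $A'$, and every $a\in A'$ is in at most $\Delta$ edges of $Z$; (2) the edges of $Z$ are disjoint from $B'$, and the sets $B(e)$, $e\in Z$, are pairwise disjoint; (3) for each $e'\in M$ there is at most one $e\in Z$ with $B(e)\cap B(e')\neq\emptyset$. It is \emph{maximal} if $Z\cup\{e\}$ is not a half layer for any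 $e\in E\setminus Z$. \textbf{Lemma 3.3.} There are a program $P$ for the word RAM with a procedure call (on words of size $O(n+d)$, i.e. of $O(\log(n+d))$ bits) and an absolute constant $a>0$ such that for every $c>0$ there is a constant $K>0$, depending only on $c$, with the following property. Let $H=(A,B,E)$ be an $r$-bounded bipartite hypergraph with $n\ge 1$ and $r\ge 1$ that satisfies the $\varphi$-strong Haxell condition, where $\varphi\ge d\,r^2$ for a real number $d=d(n)\ge 4$. Suppose that a procedure computes, for any given state, a maximal half layer of $H$ with respect to this state and the degree parameter $\Delta=d$ in time at most $T^*$, where $T^*\ge c\,n$. Then $P$, which receives $|A|$, $|B|$ and $\lfloor d\rfloor$ as its input and accesses $E$ only by calling this procedure, computes a perfect matching of $H$ in time at most \[ K\cdot T^*\cdot n^{a/\sqrt{\log d}}, \] that is, in time $O\bigl(T^*\,n^{1/\Omega(\sqrt{\log d(n)})}\bigr)$; here the time of each call is included. -/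

import Mathlib

namespace HPM

/-! ## Bipartite hypergraphs -/

/-- A possible hyperedge with exactly one vertex `e.1` in the part `α` and the set `e.2` of its
vertices in the part `β`. -/
abbrev Edge (α β : Type) : Type := α × Finset β

/-- A finite bipartite hypergraph with parts `α` and `β`. Every edge has exactly one vertex in `α`
and at least one vertex in `β`. -/
structure BipartiteHypergraph (α β : Type) where
  edges : Finset (Edge α β)
  nonempty_right : ∀ e ∈ edges, e.2.Nonempty

section Hypergraph

variable {α β : Type} [DecidableEq α] [DecidableEq β]

namespace BipartiteHypergraph

/-- `r`-boundedness: every edge has at most `r` vertices in `β`. -/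
def IsBounded (H : BipartiteHypergraph α β) (r : ℕ) : Prop :=
  ∀ e ∈ H.edges, e.2.card ≤ r

/-- A matching (also called a partial matching): a set of pairwise vertex-disjoint edges. -/
def IsMatching (H : BipartiteHypergraph α β) (M : Finset (Edge α β)) : Prop :=
  M ⊆ H.edges ∧ ∀ e ∈ M, ∀ f ∈ M, e ≠ f → e.1 ≠ f.1 ∧ Disjoint e.2 f.2

/-- A perfect matching: a matching that contains every vertex of `α`. -/
def IsPerfectMatching (H : BipartiteHypergraph α β) (M : Finset (Edge α β)) : Prop :=
  H.IsMatching M ∧ ∀ a : α, ∃ e ∈ M, e.1 = a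

/-- The set `E_S` of edges that meet `S ⊆ α`. -/
def incident (H : BipartiteHypergraph α β) (S : Finset α) : Finset (Edge α β) :=
  H.edges.filter (fun e => e.1 ∈ S)

end BipartiteHypergraph

/-- `τ(F)`: the minimum size of a set of vertices of `β` that meets every edge in `F`. -/
noncomputable def coverNumber (F : Finset (Edge α β)) : ℕ :=
  sInf {k : ℕ | ∃ T : Finset β, T.card = k ∧ ∀ e ∈ F, (e.2 ∩ T).Nonempty}

/-- The `φ`-strong Haxell condition: `τ(E_S) ≥ φ |S|` for all `S ⊆ α`. -/
def BipartiteHypergraph.StrongHaxell (H : BipartiteHypergraph α β) (φ : ℝ) : Prop :=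
  ∀ S : Finset α, φ * (S.card : ℝ) ≤ (coverNumber (H.incident S) : ℝ)

/-! ## Half layers -/

/-- A state `(A', B', M)`: activated vertices, forbidden vertices, and a set of edges
(required to be a partial matching by `LayerState.Valid`). -/
structure LayerState (α β : Type) where
  active : Finset α
  forbidden : Finset β
  matching : Finset (Edge α β)

/-- In a state of `H`, the third component is a partial matching of `H`. -/
def LayerState.Valid (s : LayerState α β) (H : BipartiteHypergraph α β) : Prop :=
  H.IsMatching s.matching

/-- Half layers `Z ⊆ E ∖ M` of `H` with respect to a state and a degree parameter `Δ`. -/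
structure IsHalfLayer (H : BipartiteHypergraph α β) (s : LayerState α β) (Δ : ℝ)
    (Z : Finset (Edge α β)) : Prop where
  subset : Z ⊆ H.edges \ s.matching
  active : ∀ e ∈ Z, e.1 ∈ s.active
  degree_le : ∀ a ∈ s.active, ((Z.filter (fun e => e.1 = a)).card : ℝ) ≤ Δ
  disjoint_forbidden : ∀ e ∈ Z, Disjoint e.2 s.forbidden
  disjoint : ∀ e ∈ Z, ∀ f ∈ Z, e ≠ f → Disjoint e.2 f.2
  blocked_once : ∀ m ∈ s.matching, ∀ e ∈ Z, ∀ f ∈ Z,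
    (e.2 ∩ m.2).Nonempty → (f.2 ∩ m.2).Nonempty → e = f

/-- A half layer that cannot be enlarged by any further edge of `H`. -/
def IsMaximalHalfLayer (H : BipartiteHypergraph α β) (s : LayerState α β) (Δ : ℝ)
    (Z : Finset (Edge α β)) : Prop :=
  IsHalfLayer H s Δ Z ∧ ∀ e ∈ H.edges \ Z, ¬ IsHalfLayer H s Δ (insert e Z)

end Hypergraph

/-! ## A word RAM with a procedure call

A program is a fixed finite structured text over registers and arrays of words. All instructions
and tests cost one step, except for the call of the external procedure, which costs one step more
than the running time of that procedure. -/

/-- The memory: registers `reg x` and arrays `arr k`, with entries `arr k i`. -/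
structure Memory where
  reg : ℕ → ℕ
  arr : ℕ → ℕ → ℕ

/-- Write a register. -/
def Memory.setReg (m : Memory) (x v : ℕ) : Memory :=
  { m with reg := Function.update m.reg x v }

/-- Replace a whole array (only used for the answers of the external procedure). -/
def Memory.setArr (m : Memory) (k : ℕ) (v : ℕ → ℕ) : Memory :=
  { m with arr := Function.update m.arr k v }

/-- Write one entry of an array. -/
def Memory.setEntry (m : Memory) (k i v : ℕ) : Memory :=
  m.setArr k (Function.update (m.arr k) i v)

/-- Programs. -/
inductive Prog : Type
  /-- do nothing -/
  | skip : Prog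
  /-- `reg x := v` -/
  | const (x v : ℕ) : Prog
  /-- `reg x := reg y + reg z` -/
  | plus (x y z : ℕ) : Prog
  /-- `reg x := max (reg y - reg z) 0` -/
  | minus (x y z : ℕ) : Prog
  /-- `reg x := arr k (reg i)` -/
  | load (x k i : ℕ) : Prog
  /-- `arr k (reg i) := reg x` -/
  | store (k i x : ℕ) : Prog
  /-- sequential composition -/
  | seq (p q : Prog) : Prog
  /-- `if reg x < reg y then p else q` -/
  | ifLT (x y : ℕ) (p q : Prog) : Prog
  /-- `while reg x < reg y do p` -/
  | whileLT (x y : ℕ) (p : Prog) : Prog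
  /-- call the external procedure -/
  | call : Prog

/-- What the external procedure returns: a number of edges, numbered `0, …, count - 1`; the vertex
`owner j` in the first part of the edge with number `j`; and for each vertex `b` of the second part
the value `label b`, which is `j + 1` if `b` lies in the edge with number `j`, and `0` if `b` lies
in none of these edges. -/
structure Answer where
  count : ℕ
  owner : ℕ → ℕ
  label : ℕ → ℕ

/-- An external procedure. The answer and the running time of a call may depend on the memory at
the time of the call and on the number of calls made before, so no determinism is assumed. -/
structure Procedure where
  answer : ℕ → Memory → Answer
  cost : ℕ → Memory → ℕ

/-- A configuration: the memory and the number of procedure calls made so far. -/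
structure Config where
  mem : Memory
  calls : ℕ

/-- Effect of a call: the answer is written to register `3` and to the arrays `3` and `4`. -/
def Config.afterCall (π : Procedure) (s : Config) : Config where
  mem := ((s.mem.setReg 3 (π.answer s.calls s.mem).count).setArr 3
    (π.answer s.calls s.mem).owner).setArr 4 (π.answer s.calls s.mem).label
  calls := s.calls + 1

/-- `Exec W π p s t s'`: the program `p`, started in the configuration `s`, halts in the
configuration `s'` after time `t`. Words are at most `W`: an instruction that would
produce a larger number cannot be executed. -/
inductive Exec (W : ℕ) (π : Procedure) : Prog → Config → ℕ → Config → Prop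
  | skip (s : Config) : Exec W π .skip s 1 s
  | const (s : Config) (x v : ℕ) (h : v ≤ W) :
      Exec W π (.const x v) s 1 { s with mem := s.mem.setReg x v }
  | plus (s : Config) (x y z : ℕ) (h : s.mem.reg y + s.mem.reg z ≤ W) :
      Exec W π (.plus x y z) s 1
        { s with mem := s.mem.setReg x (s.mem.reg y + s.mem.reg z) }
  | minus (s : Config) (x y z : ℕ) :
      Exec W π (.minus x y z) s 1
        { s with mem := s.mem.setReg x (s.mem.reg y - s.mem.reg z) }
  | load (s : Config) (x k i : ℕ) :
      Exec W π (.load x k i) s 1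
        { s with mem := s.mem.setReg x (s.mem.arr k (s.mem.reg i)) }
  | store (s : Config) (k i x : ℕ) :
      Exec W π (.store k i x) s 1
        { s with mem := s.mem.setEntry k (s.mem.reg i) (s.mem.reg x) }
  | seq {p q : Prog} {s s₁ s₂ : Config} {t₁ t₂ : ℕ}
      (hp : Exec W π p s t₁ s₁) (hq : Exec W π q s₁ t₂ s₂) :
      Exec W π (.seq p q) s (t₁ + t₂) s₂
  | ifTrue {x y : ℕ} {p q : Prog} {s s' : Config} {t : ℕ}
      (h : s.mem.reg x < s.mem.reg y) (hp : Exec W π p s t s') :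
      Exec W π (.ifLT x y p q) s (t + 1) s'
  | ifFalse {x y : ℕ} {p q : Prog} {s s' : Config} {t : ℕ}
      (h : ¬ s.mem.reg x < s.mem.reg y) (hq : Exec W π q s t s') :
      Exec W π (.ifLT x y p q) s (t + 1) s'
  | whileDone {x y : ℕ} {p : Prog} {s : Config}
      (h : ¬ s.mem.reg x < s.mem.reg y) :
      Exec W π (.whileLT x y p) s 1 s
  | whileStep {x y : ℕ} {p : Prog} {s s₁ s₂ : Config} {t₁ t₂ : ℕ}
      (h : s.mem.reg x < s.mem.reg y) (hp : Exec W π p s t₁ s₁)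
      (hw : Exec W π (.whileLT x y p) s₁ t₂ s₂) :
      Exec W π (.whileLT x y p) s (t₁ + t₂ + 1) s₂
  | call (s : Config) :
      Exec W π .call s (π.cost s.calls s.mem + 1) (s.afterCall π)

/-! ## Encodings -/

/-- The array `v` encodes the matching `M`: `v b` is `a + 1` if `b` lies in an edge of `M` whose
vertex in the first part is `a`, and `v b` is `0` if `b` is unmatched. -/
def EncodesMatching {p q : ℕ} (v : ℕ → ℕ) (M : Finset (Edge (Fin p) (Fin q))) : Prop :=
  ∀ b : Fin q, v b ≤ p ∧ ∀ a : Fin p, v b = (a : ℕ) + 1 ↔ ∃ e ∈ M, e.1 = a ∧ b ∈ e.2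

/-- The arrays `0`, `1`, `2` encode the state `(A', B', M)`: indicator arrays of `A'` and of `B'`,
and the encoding of the matching `M`. -/
def EncodesState {p q : ℕ} (m : Memory) (s : LayerState (Fin p) (Fin q)) : Prop :=
  (∀ a : Fin p, m.arr 0 a = if a ∈ s.active then 1 else 0) ∧
  (∀ b : Fin q, m.arr 1 b = if b ∈ s.forbidden then 1 else 0) ∧
  EncodesMatching (m.arr 2) s.matching

/-- The answer lists each edge of `Z` exactly once, in some order. -/
def Answer.Encodes {p q : ℕ} (r : Answer) (Z : Finset (Edge (Fin p) (Fin q))) : Prop :=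
  ∃ f : Fin r.count → Edge (Fin p) (Fin q), Function.Injective f ∧
    Finset.univ.image f = Z ∧
    (∀ j : Fin r.count, r.owner j = ((f j).1 : ℕ)) ∧
    ∀ b : Fin q, r.label b ≤ r.count ∧
      ∀ j : Fin r.count, r.label b = (j : ℕ) + 1 ↔ b ∈ (f j).2

/-- The procedure computes, for any state of `H`, a maximal half layer with degree parameter `Δ`
in time at most `T`. -/
def Procedure.FindsMaximalHalfLayers {p q : ℕ} (π : Procedure)
    (H : BipartiteHypergraph (Fin p) (Fin q)) (Δ : ℝ) (T : ℕ) : Prop :=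
  ∀ (k : ℕ) (m : Memory) (s : LayerState (Fin p) (Fin q)), s.Valid H → EncodesState m s →
    (∃ Z, IsMaximalHalfLayer H s Δ Z ∧ (π.answer k m).Encodes Z) ∧ π.cost k m ≤ T

/-- The initial configuration: the registers `0`, `1`, `2` hold the sizes of the two parts and the
(rounded down) degree parameter; everything else is zero. The hypergraph itself is only accessible
through the external procedure. -/
def initialConfig (p q D : ℕ) : Config where
  mem :=
    { reg := fun x => if x = 0 then p else if x = 1 then q else if x = 2 then D else 0
      arr := fun _ _ => 0 }
  calls := 0

end HPM

/-!
A perfect matching is built by layered augmentation. Let `D = ⌊d⌋`. Level `0` of the structure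
(`Layout`) consists of all unmatched vertices of the first part. As long as there are any, layers
are appended: layer `k + 1` is the maximal half layer that the external procedure returns when all
vertices activated so far are active and the vertices of the edges in the layers and of the matching
edges touched by them are forbidden, and the vertices whose matching edges it touches are activated
at level `k + 1`.

*Growth.* Consider the active vertices with fewer than `D` edges in a maximal half layer `Z`. By
maximality each of their edges meets the forbidden set, an edge of `Z`, or a matching edge touched
by `Z`, so the strong Haxell condition bounds the number of these vertices by `(x + |Z|) / D`, where
`x` is the number of earlier layer edges, while the other active vertices have `D` edges of `Z` each
(`floor_mul_card_active_le`). Hence `D` times the number of active vertices is at most `3 |Z|`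
(`Layout.Inv.growth_of_isMaximalHalfLayer`).

*Progress.* A layer is stable if at most one sixteenth of its edges touch no matching edge. On top
of a stable layer a new one is appended (`Layout.Inv.append`), and a stable level is larger than the
previous one by a factor of at least `g = 5 D / 16`. If the last layer is not stable, its edges
without a conflict belong to at least `1 / 48` of the vertices of some lower level `j`
(`Layout.Inv.exists_level`). One such edge at each of these vertices is swapped into the matching,
so that they leave level `j`, and the layers after `j` are deleted (`Layout.Inv.collapse`).

*The number of iterations.* Let `x j` be the size of level `j`, let `N = p + q`, let `α` be of order
`1 / √(log d)`, and let `κ = 1 - (47 / 48) ^ α`. A collapse to level `j` increases `(N / x j) ^ α`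
by a factor of at least `1 / (1 - κ)`, whereas the growth of the levels makes this quantity smaller
at a level than at the one before it by a factor of at least `g ^ α ≥ 2 / κ` (`rpow_neg_le_half`).
Therefore the `potential`, in which each level essentially contributes `4 / κ` times the distance of
`(N / x j) ^ α` to its largest possible value, decreases by at least `1` in every iteration
(`potential_append`, `potential_collapse`). Its initial value is at most `7 * N ^ (2 * α)`
(`pot_initial_le`).

*The program.* The structure is stored in arrays indexed by vertices, and every iteration consists
of a bounded number of loops that are not nested, each over at most `p + q + 2` indices, and at most
one call of the procedure. So an iteration takes time `O(p + q + T)` (`reach_body`). The proofs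
about the program rest on a weakest precondition for loop-free code (`Prog.wp`) and on two rules for
loops that overwrite or increase entries of one array (`reach_scatter`, `reach_accumulate`).
-/

namespace HPM

/-! ### Growth of a maximal half layer -/

section Growth

variable {α β : Type} [DecidableEq β]

/-- The set consisting of `b` and of the vertices of the edges of `M` that contain `b`. -/
def matchedGroup (M : Finset (Edge α β)) (b : β) : Finset β :=
  {b} ∪ (M.filter fun f => b ∈ f.2).biUnion Prod.snd

lemma self_mem_matchedGroup (M : Finset (Edge α β)) (b : β) : b ∈ matchedGroup M b := by
  simp [matchedGroup]

lemma mem_matchedGroup_of_mem {M : Finset (Edge α β)} {f : Edge α β} (hf : f ∈ M) {b c : β}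
    (hb : b ∈ f.2) (hc : c ∈ f.2) : c ∈ matchedGroup M b := by
  simp only [matchedGroup, Finset.mem_union, Finset.mem_biUnion, Finset.mem_filter]
  exact Or.inr ⟨f, ⟨hf, hb⟩, hc⟩

variable [DecidableEq α]

lemma card_matchedGroup_le {H : BipartiteHypergraph α β} {r : ℕ} (hr : 1 ≤ r) (hH : H.IsBounded r)
    {M : Finset (Edge α β)} (hM : H.IsMatching M) (b : β) : (matchedGroup M b).card ≤ r := by
  by_cases h : ∃ f ∈ M, b ∈ f.2
  · obtain ⟨f, hf, hb⟩ := h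
    refine (Finset.card_le_card ?_).trans (hH f (hM.1 hf))
    intro c hc
    simp only [matchedGroup, Finset.mem_union, Finset.mem_singleton, Finset.mem_biUnion,
      Finset.mem_filter] at hc
    rcases hc with rfl | ⟨g, ⟨hg, hbg⟩, hcg⟩
    · exact hb
    · by_cases hfg : f = g
      · exact hfg ▸ hcg
      · exact absurd hbg (Finset.disjoint_left.1 (hM.2 f hf g hg hfg).2 hb)
  · refine (Finset.card_le_card (t := {b}) ?_).trans (by simpa using hr)
    intro c hc
    simp only [matchedGroup, Finset.mem_union, Finset.mem_biUnion, Finset.mem_filter] at hc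
    rcases hc with hc | ⟨g, ⟨hg, hbg⟩, -⟩
    · exact hc
    · exact absurd ⟨g, hg, hbg⟩ h

/-- Each edge of `F` contributes at most `r` groups, and each group has at most `r` elements. -/
lemma card_biUnion_matchedGroup_le {H : BipartiteHypergraph α β} {r : ℕ} (hr : 1 ≤ r)
    (hH : H.IsBounded r) {M : Finset (Edge α β)} (hM : H.IsMatching M) {F : Finset (Edge α β)}
    (hF : F ⊆ H.edges) :
    ((F.biUnion Prod.snd).biUnion (matchedGroup M)).card ≤ r ^ 2 * F.card := by
  have h1 : (F.biUnion Prod.snd).card ≤ F.card * r :=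
    Finset.card_biUnion_le_card_mul _ _ _ fun e he => hH e (hF he)
  have h2 : ((F.biUnion Prod.snd).biUnion (matchedGroup M)).card ≤ (F.biUnion Prod.snd).card * r :=
    Finset.card_biUnion_le_card_mul _ _ _ fun b _ => card_matchedGroup_le hr hH hM b
  calc _ ≤ _ := h2
    _ ≤ F.card * r * r := Nat.mul_le_mul_right _ h1
    _ = _ := by ring

/-- If `Z` is a maximal half layer, then every edge at an active vertex whose degree in `Z` is not
yet saturated meets the forbidden set, an edge of `Z`, or an edge of the matching touched by `Z`;
hence the strong Haxell condition bounds the number of unsaturated active vertices, while the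
saturated ones contribute `⌊d⌋` edges of `Z` each. -/
lemma floor_mul_card_active_le {H : BipartiteHypergraph α β} {r : ℕ} {φ d : ℝ} (hr : 1 ≤ r)
    (hH : H.IsBounded r) (hφ : H.StrongHaxell φ) (hd : 0 ≤ d) (hdφ : d * (r : ℝ) ^ 2 ≤ φ)
    {s : LayerState α β} (hs : s.Valid H) {Z : Finset (Edge α β)}
    (hZ : IsMaximalHalfLayer H s d Z) {x : ℕ} (hx : s.forbidden.card ≤ r ^ 2 * x)
    (hact : ∀ m ∈ s.matching, m.1 ∈ s.active → (m.2 ∩ s.forbidden).Nonempty) :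
    ⌊d⌋₊ * s.active.card ≤ x + 2 * Z.card := by
  obtain ⟨hZ1, hZ2⟩ := hZ
  have hZH : Z ⊆ H.edges := fun e he => (Finset.mem_sdiff.1 (hZ1.subset he)).1
  set deg : α → ℕ := fun a => (Z.filter fun e => e.1 = a).card with hdeg
  set S := s.active.filter fun a => deg a < ⌊d⌋₊ with hS
  set G := (Z.biUnion Prod.snd).biUnion (matchedGroup s.matching) with hG
  have hGZ : ∀ f ∈ Z, ∀ b ∈ f.2, b ∈ G := fun f hf b hb =>
    Finset.mem_biUnion.2 ⟨b, Finset.mem_biUnion.2 ⟨f, hf, hb⟩, self_mem_matchedGroup _ _⟩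
  have hcover : ∀ e ∈ H.incident S, (e.2 ∩ (s.forbidden ∪ G)).Nonempty := by
    intro e he
    obtain ⟨heH, heS⟩ := Finset.mem_filter.1 he
    obtain ⟨heA, hedeg⟩ := Finset.mem_filter.1 heS
    by_contra hne
    have hno : ∀ b ∈ e.2, b ∉ s.forbidden ∧ b ∉ G := by
      intro b hb
      constructor <;> intro hb' <;> exact hne ⟨b, by simp [hb, hb']⟩
    obtain ⟨b₀, hb₀⟩ := H.nonempty_right e heH
    have heZ : e ∉ Z := fun h => (hno b₀ hb₀).2 (hGZ e h b₀ hb₀)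
    have heM : e ∉ s.matching := by
      intro h
      obtain ⟨b, hb⟩ := hact e h heA
      exact (hno b (Finset.mem_inter.1 hb).1).1 (Finset.mem_inter.1 hb).2
    have hblock : ∀ m ∈ s.matching, ∀ f ∈ Z, (e.2 ∩ m.2).Nonempty → (f.2 ∩ m.2).Nonempty →
        False := by
      rintro m hm f hf ⟨b, hb⟩ ⟨c, hc⟩
      rw [Finset.mem_inter] at hb hc
      exact (hno b hb.1).2 (Finset.mem_biUnion.2 ⟨c, Finset.mem_biUnion.2 ⟨f, hf, hc.1⟩,
        mem_matchedGroup_of_mem hm hc.2 hb.2⟩)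
    have hdisj : ∀ f ∈ Z, Disjoint e.2 f.2 := fun f hf =>
      Finset.disjoint_left.2 fun b hb hb' => (hno b hb).2 (hGZ f hf b hb')
    refine hZ2 e (Finset.mem_sdiff.2 ⟨heH, heZ⟩) ⟨?_, ?_, ?_, ?_, ?_, ?_⟩
    · exact Finset.insert_subset (Finset.mem_sdiff.2 ⟨heH, heM⟩) hZ1.subset
    · intro f hf
      rcases Finset.mem_insert.1 hf with rfl | hf
      · exact heA
      · exact hZ1.active f hf
    · intro a ha
      rw [Finset.filter_insert]
      split_ifs with hea
      · have h1 : ((insert e (Z.filter fun f => f.1 = a)).card) ≤ ⌊d⌋₊ := by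
          refine (Finset.card_insert_le _ _).trans ?_
          subst hea
          exact hedeg
        exact (Nat.cast_le.2 h1).trans (Nat.floor_le hd)
      · exact hZ1.degree_le a ha
    · intro f hf
      rcases Finset.mem_insert.1 hf with rfl | hf
      · exact Finset.disjoint_left.2 fun b hb => (hno b hb).1
      · exact hZ1.disjoint_forbidden f hf
    · intro f hf g hg hfg
      rcases Finset.mem_insert.1 hf with rfl | hf' <;>
        rcases Finset.mem_insert.1 hg with rfl | hg'
      · exact absurd rfl hfg
      · exact hdisj g hg'
      · exact (hdisj f hf').symm
      · exact hZ1.disjoint f hf' g hg' hfg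
    · intro m hm f hf g hg hfm hgm
      rcases Finset.mem_insert.1 hf with rfl | hf' <;>
        rcases Finset.mem_insert.1 hg with rfl | hg'
      · rfl
      · exact (hblock m hm g hg' hfm hgm).elim
      · exact (hblock m hm f hf' hgm hfm).elim
      · exact hZ1.blocked_once m hm f hf' g hg' hfm hgm
  have hSbound : ⌊d⌋₊ * S.card ≤ x + Z.card := by
    have h1 : coverNumber (H.incident S) ≤ (s.forbidden ∪ G).card :=
      Nat.sInf_le ⟨_, rfl, hcover⟩
    have h2 : (s.forbidden ∪ G).card ≤ r ^ 2 * (x + Z.card) := by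
      refine (Finset.card_union_le _ _).trans ?_
      rw [mul_add]
      exact add_le_add hx (card_biUnion_matchedGroup_le hr hH hs hZH)
    have h3 : φ * (S.card : ℝ) ≤ (r : ℝ) ^ 2 * ((x : ℝ) + Z.card) :=
      (hφ S).trans (by exact_mod_cast h1.trans h2)
    have hr2 : (0 : ℝ) < (r : ℝ) ^ 2 := by positivity
    have h4 : (r : ℝ) ^ 2 * (d * S.card) ≤ (r : ℝ) ^ 2 * ((x : ℝ) + Z.card) := by
      refine le_trans ?_ h3
      calc (r : ℝ) ^ 2 * (d * S.card) = d * (r : ℝ) ^ 2 * S.card := by ring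
        _ ≤ φ * S.card := mul_le_mul_of_nonneg_right hdφ (by positivity)
    have h5 := le_of_mul_le_mul_left h4 hr2
    have h6 : ((⌊d⌋₊ * S.card : ℕ) : ℝ) ≤ ((x + Z.card : ℕ) : ℝ) := by
      push_cast
      exact (mul_le_mul_of_nonneg_right (Nat.floor_le hd) (by positivity)).trans h5
    exact_mod_cast h6
  have hTbound : ⌊d⌋₊ * (s.active.filter fun a => ¬ deg a < ⌊d⌋₊).card ≤ Z.card := by
    rw [mul_comm]
    calc _ ≤ ∑ a ∈ s.active.filter (fun a => ¬ deg a < ⌊d⌋₊), deg a := by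
          rw [← smul_eq_mul]
          exact Finset.card_nsmul_le_sum _ _ _ fun a ha => not_lt.1 (Finset.mem_filter.1 ha).2
      _ ≤ ∑ a ∈ s.active, deg a :=
          Finset.sum_le_sum_of_subset (Finset.filter_subset _ _)
      _ = Z.card := (Finset.card_eq_sum_card_fiberwise fun e he => hZ1.active e he).symm
  have hsplit : s.active.card = S.card + (s.active.filter fun a => ¬ deg a < ⌊d⌋₊).card :=
    (Finset.card_filter_add_card_filter_not _).symm
  rw [hsplit, mul_add]
  omega

end Growth

/-! ### Layered structures -/

/-- The matching and the layers, stored as arrays. `mat b` is `a + 1` if `b` lies in the edge of the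
matching at `a`, and `0` if `b` is unmatched. `lay b` is the number of the layer (`1, …, depth`)
with an edge that contains `b`, and `0` if there is none; in the former case that edge is
represented by one of its vertices, which is `rep b`, and its vertex in the first part is `a`
where `own b = a + 1`. -/
structure Layout where
  mat : ℕ → ℕ
  lay : ℕ → ℕ
  rep : ℕ → ℕ
  own : ℕ → ℕ
  depth : ℕ

namespace Layout

variable {p q : ℕ}

/-- The set of vertices of the matching edge at `a` (empty if `a` is unmatched). -/
def matchedSet (q : ℕ) (L : Layout) (a : Fin p) : Finset (Fin q) :=
  Finset.univ.filter fun b => L.mat b = a + 1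

/-- The vertices in the second part of the layer edge represented by `e`. -/
def layerSet (q : ℕ) (L : Layout) (e : ℕ) : Finset (Fin q) :=
  Finset.univ.filter fun b => L.lay b ≠ 0 ∧ L.rep b = e

/-- The vertices of the first part that are activated at level `j`: the unmatched ones for `j = 0`,
and those whose matching edge touches an edge of layer `j` for `j ≥ 1`. -/
def part (p q : ℕ) (L : Layout) (j : ℕ) : Finset (Fin p) :=
  if j = 0 then Finset.univ.filter fun a => ∀ b : Fin q, L.mat b ≠ a + 1
  else Finset.univ.filter fun a => ∃ b : Fin q, L.mat b = a + 1 ∧ L.lay b = j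

/-- The representatives of the edges of layer `j ≥ 1`. -/
def edgesAt (q : ℕ) (L : Layout) (j : ℕ) : Finset (Fin q) :=
  Finset.univ.filter fun e => L.lay e = j ∧ L.rep e = e

/-- The representatives of the edges of layer `j ≥ 1` that touch no edge of the matching. -/
def addable (q : ℕ) (L : Layout) (j : ℕ) : Finset (Fin q) :=
  (L.edgesAt q j).filter fun e => ∀ b : Fin q, L.lay b ≠ 0 → L.rep b = e → L.mat b = 0

/-- The properties of the arrays that hold throughout the algorithm. In particular every layer is
large compared with the number of activated vertices below it, and in every layer except
for the last one only few edges touch no edge of the matching. -/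
structure Inv (H : BipartiteHypergraph (Fin p) (Fin q)) (D : ℕ) (L : Layout) : Prop where
  mat_le : ∀ b : Fin q, L.mat b ≤ p
  mat_mem : ∀ (a : Fin p) (b : Fin q), L.mat b = a + 1 → (a, L.matchedSet q a) ∈ H.edges
  lay_le : ∀ b : Fin q, L.lay b ≤ L.depth
  rep_spec : ∀ b : Fin q, L.lay b ≠ 0 →
    ∃ e : Fin q, L.rep b = e ∧ L.rep e = e ∧ L.lay e = L.lay b ∧ L.own e = L.own b
  lay_mem : ∀ e : Fin q, L.lay e ≠ 0 → L.rep e = e →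
    ∃ a : Fin p, L.own e = a + 1 ∧ (a, L.layerSet q e) ∈ H.edges ∧ ∃ j < L.lay e, a ∈ L.part p q j
  uniq : ∀ b c : Fin q, L.mat b = L.mat c → L.mat b ≠ 0 → L.lay b ≠ 0 → L.lay c ≠ 0 →
    L.rep b = L.rep c
  deg : ∀ (a : Fin p) (j : ℕ), 1 ≤ j →
    ((L.edgesAt q j).filter fun e : Fin q => L.own e = a + 1).card ≤ D
  growth : ∀ j, 1 ≤ j → j ≤ L.depth →
    D * ∑ i ∈ Finset.range j, (L.part p q i).card ≤ 3 * (L.edgesAt q j).card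
  stable : ∀ j, 1 ≤ j → j < L.depth → 16 * (L.addable q j).card ≤ (L.edgesAt q j).card

lemma mem_part_zero {L : Layout} {a : Fin p} :
    a ∈ L.part p q 0 ↔ ∀ b : Fin q, L.mat b ≠ a + 1 := by
  simp [part]

lemma mem_part {L : Layout} {j : ℕ} (hj : j ≠ 0) {a : Fin p} :
    a ∈ L.part p q j ↔ ∃ b : Fin q, L.mat b = a + 1 ∧ L.lay b = j := by
  simp [part, hj]

lemma mem_edgesAt {L : Layout} {j : ℕ} {e : Fin q} :
    e ∈ L.edgesAt q j ↔ L.lay e = j ∧ L.rep e = e := by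
  simp [edgesAt]

lemma mem_addable {L : Layout} {j : ℕ} {e : Fin q} :
    e ∈ L.addable q j ↔ (L.lay e = j ∧ L.rep e = e) ∧
      ∀ b : Fin q, L.lay b ≠ 0 → L.rep b = e → L.mat b = 0 := by
  simp [addable, mem_edgesAt]

lemma mem_matchedSet {L : Layout} {a : Fin p} {b : Fin q} :
    b ∈ L.matchedSet q a ↔ L.mat b = a + 1 := by
  simp [matchedSet]

lemma mem_layerSet {L : Layout} {e : ℕ} {b : Fin q} :
    b ∈ L.layerSet q e ↔ L.lay b ≠ 0 ∧ L.rep b = e := by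
  simp [layerSet]

/-- The matching stored in `mat`. -/
def matching (p q : ℕ) (L : Layout) : Finset (Edge (Fin p) (Fin q)) :=
  (Finset.univ.filter fun a : Fin p => ∃ b : Fin q, L.mat b = a + 1).image
    fun a => (a, L.matchedSet q a)

lemma mem_matching {L : Layout} {m : Edge (Fin p) (Fin q)} :
    m ∈ L.matching p q ↔ (∃ b : Fin q, L.mat b = m.1 + 1) ∧ m.2 = L.matchedSet q m.1 := by
  simp only [matching, Finset.mem_image, Finset.mem_filter, Finset.mem_univ, true_and]
  constructor
  · rintro ⟨a, h, rfl⟩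
    exact ⟨h, rfl⟩
  · rintro ⟨h1, h2⟩
    exact ⟨m.1, h1, by rw [← h2]⟩

namespace Inv

variable {H : BipartiteHypergraph (Fin p) (Fin q)} {D : ℕ} {L : Layout}

lemma isMatching (h : L.Inv H D) : H.IsMatching (L.matching p q) := by
  constructor
  · intro m hm
    obtain ⟨⟨b, hb⟩, h2⟩ := mem_matching.1 hm
    have := h.mat_mem m.1 b hb
    rwa [← h2] at this
  · intro m hm m' hm' hne
    obtain ⟨-, h2⟩ := mem_matching.1 hm
    obtain ⟨-, h2'⟩ := mem_matching.1 hm'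
    have h1 : m.1 ≠ m'.1 := by
      intro h1
      exact hne (Prod.ext h1 (by rw [h2, h2', h1]))
    refine ⟨h1, Finset.disjoint_left.2 fun b hb hb' => h1 ?_⟩
    rw [h2, mem_matchedSet] at hb
    rw [h2', mem_matchedSet] at hb'
    exact Fin.ext (by omega)

lemma encodes (h : L.Inv H D) : EncodesMatching L.mat (L.matching p q) := by
  intro b
  refine ⟨h.mat_le b, fun a => ⟨fun hb => ?_, ?_⟩⟩
  · exact ⟨(a, L.matchedSet q a), mem_matching.2 ⟨⟨b, hb⟩, rfl⟩, rfl, mem_matchedSet.2 hb⟩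
  · rintro ⟨e, he, rfl, hb⟩
    rw [(mem_matching.1 he).2, mem_matchedSet] at hb
    exact hb

lemma isPerfectMatching (h : L.Inv H D) (h0 : L.part p q 0 = ∅) :
    H.IsPerfectMatching (L.matching p q) := by
  refine ⟨h.isMatching, fun a => ?_⟩
  have ha : a ∉ L.part p q 0 := by simp [h0]
  rw [mem_part_zero] at ha
  push Not at ha
  exact ⟨(a, L.matchedSet q a), mem_matching.2 ⟨ha, rfl⟩, rfl⟩

lemma exists_mat (h : L.Inv H D) (b : Fin q) (hb : L.mat b ≠ 0) :
    ∃ a : Fin p, L.mat b = a + 1 := by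
  have := h.mat_le b
  exact ⟨⟨L.mat b - 1, by omega⟩, by simp only; omega⟩

lemma lay_eq (h : L.Inv H D) {b c : Fin q} (hm : L.mat b = L.mat c) (h0 : L.mat b ≠ 0)
    (hb : L.lay b ≠ 0) (hc : L.lay c ≠ 0) : L.lay b = L.lay c := by
  obtain ⟨e, he, -, he2, -⟩ := h.rep_spec b hb
  obtain ⟨e', he', -, he2', -⟩ := h.rep_spec c hc
  have : e = e' := Fin.ext (by rw [← he, ← he', h.uniq b c hm h0 hb hc])
  subst this
  exact he2.symm.trans he2'

lemma disjoint_part (h : L.Inv H D) {i j : ℕ} (hij : i ≠ j) :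
    Disjoint (L.part p q i) (L.part p q j) := by
  rw [Finset.disjoint_left]
  intro a hi hj
  rcases Nat.eq_zero_or_pos i with rfl | hi0
  · rw [mem_part_zero] at hi
    rw [mem_part hij.symm] at hj
    obtain ⟨b, hb, -⟩ := hj
    exact hi b hb
  · rw [mem_part hi0.ne'] at hi
    obtain ⟨b, hb, hbi⟩ := hi
    rcases Nat.eq_zero_or_pos j with rfl | hj0
    · exact mem_part_zero.1 hj b hb
    · rw [mem_part hj0.ne'] at hj
      obtain ⟨c, hc, hcj⟩ := hj
      have := h.lay_eq (hb.trans hc.symm) (by omega) (by omega) (by omega)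
      omega

/-- Every edge of a layer that touches the matching does so in a matching edge of its own. -/
lemma card_edgesAt_le (h : L.Inv H D) {j : ℕ} (hj : 1 ≤ j) :
    (L.edgesAt q j).card ≤ (L.addable q j).card + (L.part p q j).card := by
  have hsplit : (L.edgesAt q j).card = (L.addable q j).card +
      ((L.edgesAt q j).filter fun e : Fin q =>
        ¬ ∀ b : Fin q, L.lay b ≠ 0 → L.rep b = e → L.mat b = 0).card :=
    (Finset.card_filter_add_card_filter_not _).symm
  rw [hsplit]
  refine Nat.add_le_add_left ?_ _
  have key : ∀ e ∈ (L.edgesAt q j).filter fun e : Fin q =>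
      ¬ ∀ b : Fin q, L.lay b ≠ 0 → L.rep b = e → L.mat b = 0,
      ∃ a ∈ L.part p q j, ∃ b : Fin q, L.lay b ≠ 0 ∧ L.rep b = e ∧ L.mat b = a + 1 := by
    intro e he
    rw [Finset.mem_filter, mem_edgesAt] at he
    obtain ⟨⟨hlay, hrep⟩, hb⟩ := he
    push Not at hb
    obtain ⟨b, hb1, hb2, hb3⟩ := hb
    obtain ⟨a, ha⟩ := h.exists_mat b hb3
    obtain ⟨e', he', -, he2, -⟩ := h.rep_spec b hb1
    have : e' = e := Fin.ext (by omega)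
    subst this
    exact ⟨a, (mem_part (by omega)).2 ⟨b, ha, by omega⟩, b, hb1, hb2, ha⟩
  refine Finset.card_le_card_of_forall_subsingleton
    (fun (e : Fin q) (a : Fin p) => ∃ b : Fin q, L.lay b ≠ 0 ∧ L.rep b = e ∧ L.mat b = a + 1) key ?_
  rintro a - e ⟨-, b, hb1, hb2, hb3⟩ e' ⟨-, c, hc1, hc2, hc3⟩
  have := h.uniq b c (by omega) (by omega) hb1 hc1
  exact Fin.ext (by omega)

lemma card_part_ge (h : L.Inv H D) {j : ℕ} (hj : 1 ≤ j) (hjk : j ≤ L.depth)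
    (hst : 16 * (L.addable q j).card ≤ (L.edgesAt q j).card) :
    5 * (D * ∑ i ∈ Finset.range j, (L.part p q i).card) ≤ 16 * (L.part p q j).card := by
  have h1 := h.growth j hj hjk
  have h2 := h.card_edgesAt_le hj
  omega

lemma card_part_ge_pred (h : L.Inv H D) {j : ℕ} (hjk : j + 1 ≤ L.depth)
    (hst : 16 * (L.addable q (j + 1)).card ≤ (L.edgesAt q (j + 1)).card) :
    5 * D * (L.part p q j).card ≤ 16 * (L.part p q (j + 1)).card := by
  refine le_trans ?_ (h.card_part_ge (by omega) hjk hst)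
  rw [mul_assoc]
  gcongr
  exact Finset.single_le_sum (f := fun i => (L.part p q i).card) (fun _ _ => Nat.zero_le _)
    (by simp)

lemma depth_le (h : L.Inv H D) (hD : 1 ≤ D) (h0 : (L.part p q 0).Nonempty) : L.depth ≤ q := by
  have hne : ∀ j ∈ Finset.Icc 1 L.depth, (L.edgesAt q j).Nonempty := by
    intro j hj
    rw [Finset.mem_Icc] at hj
    have h1 := h.growth j hj.1 hj.2
    have h2 : (L.part p q 0).card ≤ ∑ i ∈ Finset.range j, (L.part p q i).card :=
      Finset.single_le_sum (f := fun i => (L.part p q i).card) (fun _ _ => Nat.zero_le _)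
        (Finset.mem_range.2 hj.1)
    have h3 := h0.card_pos
    have h4 : 1 * 1 ≤ D * ∑ i ∈ Finset.range j, (L.part p q i).card :=
      Nat.mul_le_mul hD (by omega)
    exact Finset.card_pos.1 (by omega)
  have h1 : Finset.Icc 1 L.depth ⊆
      (Finset.univ : Finset (Fin q)).image fun e : Fin q => L.lay e := by
    intro j hj
    obtain ⟨e, he⟩ := hne j hj
    exact Finset.mem_image.2 ⟨e, Finset.mem_univ _, (mem_edgesAt.1 he).1⟩
  simpa using (Finset.card_le_card h1).trans Finset.card_image_le

/-- If many edges of the last layer touch no matching edge, then they belong to a positive fraction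
of the activated vertices of some level, since each vertex has at most `D` of them. -/
lemma exists_level (h : L.Inv H D) (hk : 1 ≤ L.depth)
    (hun : (L.edgesAt q L.depth).card < 16 * (L.addable q L.depth).card)
    {P : Finset (Fin p)} (hP : ∀ a, a ∈ P ↔ ∃ e ∈ L.addable q L.depth, L.own e = a + 1) :
    ∃ j < L.depth, (L.part p q j).card < 48 * (L.part p q j ∩ P).card := by
  have hcard : (L.addable q L.depth).card ≤ D * P.card := by
    have hsub : L.addable q L.depth ⊆
        P.biUnion fun a => (L.edgesAt q L.depth).filter fun e : Fin q => L.own e = a + 1 := by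
      intro e he
      have h1 := (mem_addable.1 he).1
      obtain ⟨a, ha, -⟩ := h.lay_mem e (by omega) h1.2
      exact Finset.mem_biUnion.2 ⟨a, (hP a).2 ⟨e, he, ha⟩,
        Finset.mem_filter.2 ⟨(Finset.mem_filter.1 he).1, ha⟩⟩
    rw [mul_comm]
    exact (Finset.card_le_card hsub).trans
      (Finset.card_biUnion_le_card_mul _ _ _ fun a _ => h.deg a L.depth hk)
  have hPsub : P ⊆ (Finset.range L.depth).biUnion fun j => L.part p q j ∩ P := by
    intro a ha
    obtain ⟨e, he, hea⟩ := (hP a).1 ha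
    have h1 := (mem_addable.1 he).1
    obtain ⟨a', ha', -, j, hj, haj⟩ := h.lay_mem e (by omega) h1.2
    have : a' = a := Fin.ext (by omega)
    subst this
    exact Finset.mem_biUnion.2 ⟨j, Finset.mem_range.2 (by omega), Finset.mem_inter.2 ⟨haj, ha⟩⟩
  have hPcard : P.card ≤ ∑ j ∈ Finset.range L.depth, (L.part p q j ∩ P).card :=
    (Finset.card_le_card hPsub).trans Finset.card_biUnion_le
  by_contra hcon
  push Not at hcon
  have h1 : 48 * ∑ j ∈ Finset.range L.depth, (L.part p q j ∩ P).card ≤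
      ∑ j ∈ Finset.range L.depth, (L.part p q j).card := by
    rw [Finset.mul_sum]
    exact Finset.sum_le_sum fun j hj => hcon j (Finset.mem_range.1 hj)
  have h2 := h.growth L.depth hk le_rfl
  have h3 : D * (48 * P.card) ≤ D * ∑ j ∈ Finset.range L.depth, (L.part p q j).card :=
    Nat.mul_le_mul_left D (by omega)
  have h4 : D * (48 * P.card) = 48 * (D * P.card) := by ring
  omega

end Inv

end Layout

namespace Layout

variable {p q : ℕ}

/-! ### Adding a layer -/

/-- The activated vertices. -/
def active (p q : ℕ) (L : Layout) : Finset (Fin p) :=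
  (Finset.range (L.depth + 1)).biUnion fun j => L.part p q j

/-- The vertices of the edges in the layers and of the matching edges that these touch. -/
def forbidden (q : ℕ) (L : Layout) : Finset (Fin q) :=
  Finset.univ.filter fun b =>
    L.lay b ≠ 0 ∨ (L.mat b ≠ 0 ∧ ∃ c : Fin q, L.mat c = L.mat b ∧ L.lay c ≠ 0)

/-- The state with respect to which the next layer is computed. -/
def state (p q : ℕ) (L : Layout) : LayerState (Fin p) (Fin q) :=
  ⟨L.active p q, L.forbidden q, L.matching p q⟩

lemma mem_active {L : Layout} {a : Fin p} :
    a ∈ L.active p q ↔ ∃ j ≤ L.depth, a ∈ L.part p q j := by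
  simp [active]

lemma mem_forbidden {L : Layout} {b : Fin q} :
    b ∈ L.forbidden q ↔
      L.lay b ≠ 0 ∨ (L.mat b ≠ 0 ∧ ∃ c : Fin q, L.mat c = L.mat b ∧ L.lay c ≠ 0) := by
  simp [forbidden]

namespace Inv

variable {H : BipartiteHypergraph (Fin p) (Fin q)} {D : ℕ} {L : Layout}

lemma card_active (h : L.Inv H D) :
    (L.active p q).card = ∑ j ∈ Finset.range (L.depth + 1), (L.part p q j).card :=
  Finset.card_biUnion fun _ _ _ _ hij => h.disjoint_part hij

lemma card_forbidden_le (h : L.Inv H D) {r : ℕ} (hr : 1 ≤ r) (hH : H.IsBounded r) :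
    (L.forbidden q).card ≤ r ^ 2 * ∑ j ∈ Finset.Icc 1 L.depth, (L.edgesAt q j).card := by
  classical
  set R : Finset (Fin q) := Finset.univ.filter fun e => L.lay e ≠ 0 ∧ L.rep e = e with hR
  set F : Finset (Edge (Fin p) (Fin q)) := H.edges.filter fun e =>
    ∃ x ∈ R, L.own x = e.1 + 1 ∧ e.2 = L.layerSet q x with hF
  have hFR : F.card ≤ R.card := by
    refine Finset.card_le_card_of_forall_subsingleton
      (fun (e : Edge (Fin p) (Fin q)) (x : Fin q) => L.own x = e.1 + 1 ∧ e.2 = L.layerSet q x)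
      (fun e he => (Finset.mem_filter.1 he).2) ?_
    rintro x - e ⟨-, he1, he2⟩ e' ⟨-, he1', he2'⟩
    exact Prod.ext (Fin.ext (by omega)) (he2.trans he2'.symm)
  have hRcard : R.card ≤ ∑ j ∈ Finset.Icc 1 L.depth, (L.edgesAt q j).card := by
    refine (Finset.card_le_card ?_).trans Finset.card_biUnion_le
    intro e he
    have he' := (Finset.mem_filter.1 he).2
    refine Finset.mem_biUnion.2 ⟨L.lay e, ?_, mem_edgesAt.2 ⟨rfl, he'.2⟩⟩
    exact Finset.mem_Icc.2 ⟨by omega, h.lay_le e⟩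
  have hlay : ∀ b : Fin q, L.lay b ≠ 0 → b ∈ F.biUnion Prod.snd := by
    intro b hb
    obtain ⟨e, he1, he2, he3, he4⟩ := h.rep_spec b hb
    obtain ⟨a, ha1, ha2, -⟩ := h.lay_mem e (by omega) he2
    refine Finset.mem_biUnion.2 ⟨(a, L.layerSet q e), Finset.mem_filter.2 ⟨ha2, e, ?_, ha1, rfl⟩,
      mem_layerSet.2 ⟨hb, he1⟩⟩
    exact Finset.mem_filter.2 ⟨Finset.mem_univ _, by omega, he2⟩
  have hsub : L.forbidden q ⊆ (F.biUnion Prod.snd).biUnion (matchedGroup (L.matching p q)) := by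
    intro b hb
    rcases mem_forbidden.1 hb with hb | ⟨hb, c, hc1, hc2⟩
    · exact Finset.mem_biUnion.2 ⟨b, hlay b hb, self_mem_matchedGroup _ _⟩
    · obtain ⟨a, ha⟩ := h.exists_mat b hb
      refine Finset.mem_biUnion.2 ⟨c, hlay c hc2,
        mem_matchedGroup_of_mem (f := (a, L.matchedSet q a)) (mem_matching.2 ⟨⟨b, ha⟩, rfl⟩)
          (mem_matchedSet.2 (hc1.trans ha)) (mem_matchedSet.2 ha)⟩
  refine (Finset.card_le_card hsub).trans
    ((card_biUnion_matchedGroup_le hr hH h.isMatching (Finset.filter_subset _ _)).trans ?_)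
  exact Nat.mul_le_mul_left _ (hFR.trans hRcard)

/-- Each layer has at most `16 / 15` times as many edges as there are vertices activated by it, so
the forbidden set is small enough for the strong Haxell condition to apply. -/
lemma growth_of_isMaximalHalfLayer (h : L.Inv H D) {r : ℕ} {φ d : ℝ} (hr : 1 ≤ r)
    (hH : H.IsBounded r) (hφ : H.StrongHaxell φ) (hd : 4 ≤ d) (hdφ : d * (r : ℝ) ^ 2 ≤ φ)
    (hD : D = ⌊d⌋₊)
    (hst : 1 ≤ L.depth → 16 * (L.addable q L.depth).card ≤ (L.edgesAt q L.depth).card)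
    {Z : Finset (Edge (Fin p) (Fin q))} (hZ : IsMaximalHalfLayer H (L.state p q) d Z) :
    D * ∑ j ∈ Finset.range (L.depth + 1), (L.part p q j).card ≤ 3 * Z.card := by
  have hD4 : 4 ≤ D := hD ▸ Nat.le_floor (by exact_mod_cast hd)
  have h1 := floor_mul_card_active_le (s := L.state p q) hr hH hφ (by linarith) hdφ h.isMatching hZ
    (h.card_forbidden_le hr hH) ?_
  · have h2 : 15 * ∑ j ∈ Finset.Icc 1 L.depth, (L.edgesAt q j).card ≤
        16 * ∑ j ∈ Finset.Icc 1 L.depth, (L.part p q j).card := by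
      rw [Finset.mul_sum, Finset.mul_sum]
      refine Finset.sum_le_sum fun j hj => ?_
      rw [Finset.mem_Icc] at hj
      have h3 := h.card_edgesAt_le hj.1
      have h4 : 16 * (L.addable q j).card ≤ (L.edgesAt q j).card := by
        rcases hj.2.lt_or_eq with h5 | h5
        · exact h.stable j hj.1 h5
        · subst h5
          exact hst hj.1
      omega
    have h3 : ∑ j ∈ Finset.Icc 1 L.depth, (L.part p q j).card ≤
        ∑ j ∈ Finset.range (L.depth + 1), (L.part p q j).card := by
      refine Finset.sum_le_sum_of_subset fun j hj => ?_
      rw [Finset.mem_Icc] at hj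
      exact Finset.mem_range.2 (by omega)
    have h4 : (L.state p q).active.card = _ := h.card_active
    rw [h4, ← hD] at h1
    set S := ∑ j ∈ Finset.range (L.depth + 1), (L.part p q j).card
    have h5 : 4 * S ≤ D * S := Nat.mul_le_mul_right _ hD4
    omega
  · intro m hm hma
    obtain ⟨⟨b, hb⟩, hm2⟩ := mem_matching.1 hm
    obtain ⟨j, hj, hmj⟩ := mem_active.1 hma
    rcases Nat.eq_zero_or_pos j with rfl | hj0
    · exact absurd hb (mem_part_zero.1 hmj b)
    · obtain ⟨c, hc1, hc2⟩ := (mem_part hj0.ne').1 hmj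
      refine ⟨c, Finset.mem_inter.2 ⟨?_, mem_forbidden.2 (Or.inl (by omega))⟩⟩
      rw [hm2]
      exact mem_matchedSet.2 hc1

/-- Adding the answer of the external procedure as a new last layer preserves the invariant. Here
`t` chooses a representative for each of the new edges. -/
theorem append (h : L.Inv H D) {r : ℕ} {φ d : ℝ} (hr : 1 ≤ r)
    (hH : H.IsBounded r) (hφ : H.StrongHaxell φ) (hd : 4 ≤ d) (hdφ : d * (r : ℝ) ^ 2 ≤ φ)
    (hD : D = ⌊d⌋₊)
    (hst : 1 ≤ L.depth → 16 * (L.addable q L.depth).card ≤ (L.edgesAt q L.depth).card)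
    {Z : Finset (Edge (Fin p) (Fin q))} (hZ : IsMaximalHalfLayer H (L.state p q) d Z)
    {R : Answer} (hR : R.Encodes Z) {t : ℕ → ℕ}
    (ht : ∀ b : Fin q, R.label b ≠ 0 → ∃ c : Fin q, t (R.label b) = c ∧ R.label c = R.label b)
    {L' : Layout} (hdepth : L'.depth = L.depth + 1) (hmat : ∀ b : Fin q, L'.mat b = L.mat b)
    (hlay : ∀ b : Fin q, L'.lay b = if R.label b = 0 then L.lay b else L.depth + 1)
    (hrep : ∀ b : Fin q, L'.rep b = if R.label b = 0 then L.rep b else t (R.label b))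
    (hown : ∀ b : Fin q, L'.own b = if R.label b = 0 then L.own b else
      R.owner (R.label b - 1) + 1) :
    L'.Inv H D ∧ ∀ j ≤ L.depth, L'.part p q j = L.part p q j := by
  have hgrow := h.growth_of_isMaximalHalfLayer hr hH hφ hd hdφ hD hst hZ
  obtain ⟨f, hfinj, hfim, hfown, hflab⟩ := hR
  obtain ⟨hZ1, -⟩ := hZ
  have hfZ : ∀ j, f j ∈ Z := fun j => hfim ▸ Finset.mem_image_of_mem f (Finset.mem_univ j)
  have hfH : ∀ j, f j ∈ H.edges := fun j => (Finset.mem_sdiff.1 (hZ1.subset (hfZ j))).1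
  have hlab : ∀ b : Fin q, R.label b ≠ 0 →
      ∃ j : Fin R.count, R.label b = j + 1 ∧ b ∈ (f j).2 := by
    intro b hb
    have h1 := (hflab b).1
    have h2 : R.label b = ((⟨R.label b - 1, by omega⟩ : Fin R.count) : ℕ) + 1 := by
      simp only
      omega
    exact ⟨_, h2, ((hflab b).2 _).1 h2⟩
  have hforb : ∀ b : Fin q, R.label b ≠ 0 → b ∉ L.forbidden q := by
    intro b hb
    obtain ⟨j, -, hj⟩ := hlab b hb
    exact Finset.disjoint_left.1 (hZ1.disjoint_forbidden (f j) (hfZ j)) hj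
  have hlay0 : ∀ b : Fin q, R.label b ≠ 0 → L.lay b = 0 := by
    intro b hb
    by_contra hne
    exact hforb b hb (mem_forbidden.2 (Or.inl hne))
  have hpart : ∀ j ≤ L.depth, L'.part p q j = L.part p q j := by
    intro j hj
    ext a
    rcases Nat.eq_zero_or_pos j with rfl | hj0
    · simp only [mem_part_zero, hmat]
    · rw [mem_part hj0.ne', mem_part hj0.ne']
      refine exists_congr fun b => ?_
      rw [hmat, hlay]
      refine and_congr_right fun _ => ?_
      split_ifs with hb
      · rfl
      · have := hlay0 b hb
        omega
  have hedges : ∀ j, 1 ≤ j → j ≤ L.depth → L'.edgesAt q j = L.edgesAt q j := by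
    intro j hj1 hj2
    ext e
    rw [mem_edgesAt, mem_edgesAt, hlay, hrep]
    split_ifs with hb
    · rfl
    · have := hlay0 e hb
      omega
  have hset_old : ∀ e : Fin q, L.lay e ≠ 0 → ∀ b : Fin q,
      (L'.lay b ≠ 0 ∧ L'.rep b = e) ↔ (L.lay b ≠ 0 ∧ L.rep b = e) := by
    intro e he b
    rw [hlay, hrep]
    split_ifs with hb
    · rfl
    · have h1 := hlay0 b hb
      obtain ⟨c, hc1, hc2⟩ := ht b hb
      have h2 : t (R.label b) ≠ e := by
        intro h2
        have : c = e := Fin.ext (by omega)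
        subst this
        exact he (hlay0 c (by omega))
      simp [h1, h2]
  have hnew : ∀ e : Fin q, L'.lay e = L.depth + 1 → L'.rep e = e →
      ∃ j : Fin R.count, R.label e = j + 1 ∧ L'.own e = (f j).1 + 1 ∧
        L'.layerSet q e = (f j).2 := by
    intro e he1 he2
    have hb : R.label e ≠ 0 := by
      intro hb
      rw [hlay, if_pos hb] at he1
      have := h.lay_le e
      omega
    obtain ⟨j, hj1, hj2⟩ := hlab e hb
    rw [hrep, if_neg hb] at he2
    refine ⟨j, hj1, ?_, ?_⟩
    · rw [hown, if_neg hb, hj1, Nat.add_sub_cancel, hfown]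
    · ext b
      rw [mem_layerSet, hlay, hrep, ← (hflab b).2 j, ← hj1]
      split_ifs with hb'
      · rw [hb']
        constructor
        · rintro ⟨h1, h2⟩
          obtain ⟨e', he', -, he3, -⟩ := h.rep_spec b h1
          have : e' = e := Fin.ext (by omega)
          subst this
          have := hlay0 e' hb
          omega
        · intro h1
          exact absurd h1.symm hb
      · obtain ⟨c, hc1, hc2⟩ := ht b hb'
        constructor
        · rintro ⟨-, h2⟩
          have : c = e := Fin.ext (by omega)
          subst this
          exact hc2.symm
        · intro h1
          exact ⟨by omega, by rw [h1]; exact he2⟩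
  have hcard : Z.card ≤ (L'.edgesAt q (L.depth + 1)).card := by
    rw [← hfim]
    refine Finset.card_image_le.trans ?_
    refine Finset.card_le_card_of_forall_subsingleton
      (fun (j : Fin R.count) (e : Fin q) => R.label e = j + 1) ?_ ?_
    · intro j _
      obtain ⟨b, hb⟩ := H.nonempty_right (f j) (hfH j)
      have hbl := ((hflab b).2 j).2 hb
      obtain ⟨c, hc1, hc2⟩ := ht b (by omega)
      refine ⟨c, mem_edgesAt.2 ⟨?_, ?_⟩, by omega⟩
      · rw [hlay, if_neg (by omega)]
      · rw [hrep, if_neg (by omega), hc2, hc1]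
    · rintro e - i ⟨-, hi⟩ j ⟨-, hj⟩
      exact Fin.ext (by omega)
  refine ⟨⟨?_, ?_, ?_, ?_, ?_, ?_, ?_, ?_, ?_⟩, hpart⟩
  · intro b
    rw [hmat]
    exact h.mat_le b
  · intro a b hb
    rw [hmat] at hb
    have : L'.matchedSet q a = L.matchedSet q a := by
      ext c
      rw [mem_matchedSet, mem_matchedSet, hmat]
    rw [this]
    exact h.mat_mem a b hb
  · intro b
    have := h.lay_le b
    rw [hlay, hdepth]
    split_ifs <;> omega
  · intro b hb
    by_cases hb' : R.label b = 0
    · rw [hlay, if_pos hb'] at hb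
      obtain ⟨e, he1, he2, he3, he4⟩ := h.rep_spec b hb
      have he' : R.label e = 0 := by
        by_contra hne
        have := hlay0 e hne
        omega
      refine ⟨e, ?_, ?_, ?_, ?_⟩
      · rw [hrep, if_pos hb', he1]
      · rw [hrep, if_pos he', he2]
      · rw [hlay, hlay, if_pos hb', if_pos he', he3]
      · rw [hown, hown, if_pos hb', if_pos he', he4]
    · obtain ⟨c, hc1, hc2⟩ := ht b hb'
      refine ⟨c, ?_, ?_, ?_, ?_⟩
      · rw [hrep, if_neg hb', hc1]
      · rw [hrep, if_neg (by omega), hc2, hc1]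
      · rw [hlay, hlay, if_neg hb', if_neg (by omega)]
      · rw [hown, hown, if_neg hb', if_neg (by omega), hc2]
  · intro e he1 he2
    by_cases he' : R.label e = 0
    · rw [hlay, if_pos he'] at he1 ⊢
      rw [hrep, if_pos he'] at he2
      obtain ⟨a, ha1, ha2, j, hj, haj⟩ := h.lay_mem e he1 he2
      refine ⟨a, ?_, ?_, j, hj, ?_⟩
      · rw [hown, if_pos he', ha1]
      · have : L'.layerSet q e = L.layerSet q e := by
          ext b
          rw [mem_layerSet, mem_layerSet]
          exact hset_old e he1 b
        rwa [this]
      · have := h.lay_le e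
        rwa [hpart j (by omega)]
    · have hl : L'.lay e = L.depth + 1 := by rw [hlay, if_neg he']
      obtain ⟨j, hj1, hj2, hj3⟩ := hnew e hl he2
      obtain ⟨i, hi, hai⟩ := mem_active.1 (hZ1.active (f j) (hfZ j))
      refine ⟨(f j).1, hj2, ?_, i, by omega, ?_⟩
      · rw [hj3]
        exact hfH j
      · rwa [hpart i hi]
  · intro b c hbc hb0 hb hc
    rw [hmat] at hb0
    rw [hmat, hmat] at hbc
    have hold : ∀ b c : Fin q, L.mat b = L.mat c → L.mat b ≠ 0 → R.label b = 0 →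
        L'.lay b ≠ 0 → R.label c = 0 := by
      intro b c hbc hb0 hb hb'
      rw [hlay, if_pos hb] at hb'
      by_contra hne
      exact hforb c hne (mem_forbidden.2 (Or.inr ⟨by omega, b, hbc, hb'⟩))
    by_cases hb' : R.label b = 0
    · have hc' := hold b c hbc hb0 hb' hb
      rw [hlay, if_pos hb'] at hb
      rw [hlay, if_pos hc'] at hc
      rw [hrep, hrep, if_pos hb', if_pos hc']
      exact h.uniq b c hbc hb0 hb hc
    · have hc' : R.label c ≠ 0 := fun hc' => hb' (hold c b hbc.symm (by omega) hc' hc)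
      obtain ⟨i, hi1, hi2⟩ := hlab b hb'
      obtain ⟨j, hj1, hj2⟩ := hlab c hc'
      obtain ⟨a, ha⟩ := h.exists_mat b hb0
      have hij : f i = f j := hZ1.blocked_once (a, L.matchedSet q a)
        (mem_matching.2 ⟨⟨b, ha⟩, rfl⟩) (f i) (hfZ i) (f j) (hfZ j)
        ⟨b, Finset.mem_inter.2 ⟨hi2, mem_matchedSet.2 ha⟩⟩
        ⟨c, Finset.mem_inter.2 ⟨hj2, mem_matchedSet.2 (hbc ▸ ha)⟩⟩
      have := hfinj hij
      subst this
      rw [hrep, hrep, if_neg hb', if_neg hc', hi1, hj1]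
  · intro a j hj
    by_cases hjk : j ≤ L.depth
    · rw [hedges j hj hjk]
      refine le_trans (Finset.card_le_card ?_) (h.deg a j hj)
      intro e he
      rw [Finset.mem_filter, mem_edgesAt] at he ⊢
      refine ⟨he.1, ?_⟩
      have he2 := he.2
      rw [hown, if_pos] at he2
      · exact he2
      · by_contra hne
        have := hlay0 e hne
        omega
    · by_cases hjk' : j = L.depth + 1
      · subst hjk'
        by_cases ha : a ∈ L.active p q
        · have h1 : (Z.filter fun e => e.1 = a).card ≤ D := by
            rw [hD]
            exact Nat.le_floor (hZ1.degree_le a ha)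
          refine le_trans (Finset.card_le_card_of_forall_subsingleton
            (fun (e : Fin q) (z : Edge (Fin p) (Fin q)) => e ∈ z.2) ?_ ?_) h1
          · intro e he
            rw [Finset.mem_filter, mem_edgesAt] at he
            obtain ⟨i, hi1, hi2, hi3⟩ := hnew e he.1.1 he.1.2
            refine ⟨f i, Finset.mem_filter.2 ⟨hfZ i, Fin.ext (by omega)⟩, ?_⟩
            exact ((hflab e).2 i).1 hi1
          · intro z hz e ⟨he, hez⟩ e' ⟨he', hez'⟩
            have hz' := (Finset.mem_filter.1 hz).1
            rw [← hfim] at hz'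
            obtain ⟨i, -, rfl⟩ := Finset.mem_image.1 hz'
            have h2 := ((hflab e).2 i).2 hez
            have h3 := ((hflab e').2 i).2 hez'
            rw [Finset.mem_filter, mem_edgesAt, hrep, if_neg (by omega), h2] at he
            rw [Finset.mem_filter, mem_edgesAt, hrep, if_neg (by omega), h3] at he'
            exact Fin.ext (he.1.2.symm.trans he'.1.2)
        · refine le_trans (le_of_eq (Finset.card_eq_zero.2 ?_)) (Nat.zero_le D)
          refine Finset.filter_eq_empty_iff.2 fun e he hea => ha ?_
          rw [mem_edgesAt] at he
          obtain ⟨i, hi1, hi2, hi3⟩ := hnew e he.1 he.2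
          have : (f i).1 = a := Fin.ext (by omega)
          exact this ▸ hZ1.active (f i) (hfZ i)
      · refine le_trans (le_of_eq (Finset.card_eq_zero.2 ?_)) (Nat.zero_le D)
        refine Finset.filter_eq_empty_iff.2 fun e he _ => ?_
        rw [mem_edgesAt, hlay] at he
        have := h.lay_le e
        have he1 := he.1
        split_ifs at he1 <;> omega
  · intro j hj1 hj2
    rw [hdepth] at hj2
    have hsum : ∑ i ∈ Finset.range j, (L'.part p q i).card =
        ∑ i ∈ Finset.range j, (L.part p q i).card := by
      refine Finset.sum_congr rfl fun i hi => ?_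
      rw [Finset.mem_range] at hi
      rw [hpart i (by omega)]
    rw [hsum]
    rcases hj2.lt_or_eq with hj | rfl
    · rw [hedges j hj1 (by omega)]
      exact h.growth j hj1 (by omega)
    · exact hgrow.trans (Nat.mul_le_mul_left 3 hcard)
  · intro j hj1 hj2
    rw [hdepth] at hj2
    have hadd : L'.addable q j = L.addable q j := by
      ext e
      have h1 : e ∈ L'.edgesAt q j ↔ e ∈ L.edgesAt q j := by rw [hedges j hj1 (by omega)]
      rw [mem_edgesAt, mem_edgesAt] at h1
      rw [mem_addable, mem_addable, h1]
      refine and_congr_right fun he => forall_congr' fun b => ?_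
      have h2 := hset_old e (by omega) b
      rw [hmat]
      tauto
    rw [hadd, hedges j hj1 (by omega)]
    rcases Nat.lt_succ_iff_lt_or_eq.1 hj2 with hj | rfl
    · exact h.stable j hj1 hj
    · exact hst hj1

end Inv

end Layout

namespace Layout

variable {p q : ℕ}

/-! ### Swapping edges of the last layer into the matching -/

namespace Inv

variable {H : BipartiteHypergraph (Fin p) (Fin q)} {D : ℕ} {L : Layout}

/-- Swapping the edges of the last layer represented by `sel a`, `a ∈ P`, into the matching, where
`P` is a set of vertices activated at level `j`, and deleting all layers after `j`, preserves the
invariant, and the vertices of `P` are no longer activated. -/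
theorem collapse (h : L.Inv H D) {j : ℕ} (hj : j < L.depth) {P : Finset (Fin p)}
    (hP : P ⊆ L.part p q j) {sel : Fin p → Fin q}
    (hsel : ∀ a ∈ P, sel a ∈ L.addable q L.depth ∧ L.own (sel a) = a + 1)
    {L' : Layout} (hdepth : L'.depth = j)
    (hlay : ∀ b : Fin q, L'.lay b = if L.lay b ≤ j then L.lay b else 0)
    (hrep : ∀ b : Fin q, L'.rep b = L.rep b) (hown : ∀ b : Fin q, L'.own b = L.own b)
    (hmat_sel : ∀ (b : Fin q), ∀ a ∈ P, L.lay b ≠ 0 → L.rep b = sel a → L'.mat b = a + 1)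
    (hmat_old : ∀ (b : Fin q), ∀ a ∈ P, L.mat b = a + 1 → L'.mat b = 0)
    (hmat : ∀ b : Fin q, (∀ a ∈ P, L.lay b ≠ 0 → L.rep b ≠ sel a) →
      (∀ a ∈ P, L.mat b ≠ a + 1) → L'.mat b = L.mat b) :
    L'.Inv H D ∧ (∀ i < j, L'.part p q i = L.part p q i) ∧
      L'.part p q j = L.part p q j \ P := by
  -- The three cases for the new value of `mat`, read backwards.
  have hcases : ∀ b : Fin q,
      (∃ a ∈ P, L.lay b ≠ 0 ∧ L.rep b = sel a ∧ L'.mat b = a + 1 ∧ L.lay b = L.depth) ∨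
      (L'.mat b = 0 ∧ ∃ a ∈ P, L.mat b = a + 1) ∨
      (L'.mat b = L.mat b ∧ (∀ a ∈ P, L.lay b ≠ 0 → L.rep b ≠ sel a) ∧
        ∀ a ∈ P, L.mat b ≠ a + 1) := by
    intro b
    by_cases h1 : ∃ a ∈ P, L.lay b ≠ 0 ∧ L.rep b = sel a
    · obtain ⟨a, ha, hb1, hb2⟩ := h1
      refine Or.inl ⟨a, ha, hb1, hb2, hmat_sel b a ha hb1 hb2, ?_⟩
      obtain ⟨e, he1, -, he3, -⟩ := h.rep_spec b hb1
      have : e = sel a := Fin.ext (by omega)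
      subst this
      have := (mem_addable.1 (hsel a ha).1).1.1
      omega
    · by_cases h2 : ∃ a ∈ P, L.mat b = a + 1
      · obtain ⟨a, ha, hb⟩ := h2
        exact Or.inr (Or.inl ⟨hmat_old b a ha hb, a, ha, hb⟩)
      · push Not at h1 h2
        exact Or.inr (Or.inr ⟨hmat b h1 h2, h1, h2⟩)
  have hlow : ∀ b : Fin q, L'.lay b ≠ 0 → L'.lay b = L.lay b ∧ L.lay b ≠ 0 ∧ L.lay b ≤ j := by
    intro b hb
    rw [hlay] at hb ⊢
    split_ifs at hb ⊢ with h1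
    · exact ⟨rfl, hb, h1⟩
    · exact absurd rfl hb
  have hlowmat : ∀ b : Fin q, L'.lay b ≠ 0 → L'.mat b ≠ 0 → L'.mat b = L.mat b := by
    intro b hb hb'
    have h1 := hlow b hb
    rcases hcases b with ⟨a, -, -, -, -, h2⟩ | ⟨h2, -⟩ | ⟨h2, -⟩
    · omega
    · exact absurd h2 hb'
    · exact h2
  have hfree : ∀ a, a ∉ P → ∀ b : Fin q, L'.mat b = a + 1 ↔ L.mat b = a + 1 := by
    intro a ha b
    rcases hcases b with ⟨a', ha', h1, h2, h3, -⟩ | ⟨h2, a', ha', h3⟩ | ⟨h2, -⟩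
    · have h4 := (mem_addable.1 (hsel a' ha').1).2 b h1 h2
      rw [h3, h4]
      constructor
      · intro h5
        have h6 : a' = a := Fin.ext (by omega)
        exact absurd (h6 ▸ ha') ha
      · intro h5
        omega
    · rw [h2, h3]
      constructor
      · intro h5
        omega
      · intro h5
        have h6 : a' = a := Fin.ext (by omega)
        exact absurd (h6 ▸ ha') ha
    · rw [h2]
  have hpick : ∀ a ∈ P, ∀ b : Fin q, L'.mat b = a + 1 ↔ L.lay b ≠ 0 ∧ L.rep b = sel a := by
    intro a ha b
    refine ⟨fun hb => ?_, fun hb => hmat_sel b a ha hb.1 hb.2⟩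
    rcases hcases b with ⟨a', ha', h1, h2, h3, -⟩ | ⟨h2, -⟩ | ⟨h2, -, h3⟩
    · have : a' = a := Fin.ext (by omega)
      exact this ▸ ⟨h1, h2⟩
    · omega
    · exact absurd (h2 ▸ hb) (h3 a ha)
  have hselmat : ∀ a ∈ P, L'.mat (sel a) = a + 1 := by
    intro a ha
    have h1 := (mem_addable.1 (hsel a ha).1).1
    exact (hpick a ha _).2 ⟨by omega, h1.2⟩
  have hpart_pos : ∀ i, 1 ≤ i → i ≤ j → ∀ a,
      a ∈ L'.part p q i ↔ a ∈ L.part p q i ∧ a ∉ P := by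
    intro i hi hij a
    rw [mem_part (by omega), mem_part (by omega)]
    constructor
    · rintro ⟨b, hb1, hb2⟩
      have h1 := hlow b (by omega)
      have ha : a ∉ P := by
        intro ha
        have h2 := (hpick a ha b).1 hb1
        obtain ⟨e, he1, -, he3, -⟩ := h.rep_spec b h2.1
        have : e = sel a := Fin.ext (by omega)
        subst this
        have := (mem_addable.1 (hsel a ha).1).1.1
        omega
      exact ⟨⟨b, (hfree a ha b).1 hb1, by omega⟩, ha⟩
    · rintro ⟨⟨b, hb1, hb2⟩, ha⟩
      refine ⟨b, (hfree a ha b).2 hb1, ?_⟩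
      rw [hlay, if_pos (by omega), hb2]
  have hpart_zero : ∀ a, a ∈ L'.part p q 0 ↔ a ∈ L.part p q 0 ∧ a ∉ P := by
    intro a
    rw [mem_part_zero, mem_part_zero]
    constructor
    · intro h1
      have ha : a ∉ P := fun ha => h1 _ (hselmat a ha)
      exact ⟨fun b hb => h1 b ((hfree a ha b).2 hb), ha⟩
    · rintro ⟨h1, ha⟩ b hb
      exact h1 b ((hfree a ha b).1 hb)
  have hpart : ∀ i ≤ j, ∀ a, a ∈ L'.part p q i ↔ a ∈ L.part p q i ∧ a ∉ P := by
    intro i hij a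
    rcases Nat.eq_zero_or_pos i with rfl | hi
    · exact hpart_zero a
    · exact hpart_pos i hi hij a
  have hpart_lt : ∀ i < j, L'.part p q i = L.part p q i := by
    intro i hij
    ext a
    rw [hpart i hij.le, and_iff_left_iff_imp]
    exact fun ha haP => Finset.disjoint_left.1 (h.disjoint_part hij.ne) ha (hP haP)
  have hedges : ∀ i, 1 ≤ i → i ≤ j → L'.edgesAt q i = L.edgesAt q i := by
    intro i hi hij
    ext e
    rw [mem_edgesAt, mem_edgesAt, hlay, hrep]
    split_ifs <;> omega
  have hset : ∀ e : Fin q, L.lay e ≤ j → ∀ b : Fin q,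
      (L'.lay b ≠ 0 ∧ L'.rep b = e) ↔ (L.lay b ≠ 0 ∧ L.rep b = e) := by
    intro e he b
    rw [hrep]
    constructor
    · rintro ⟨h1, h2⟩
      exact ⟨(hlow b h1).2.1, h2⟩
    · rintro ⟨h1, h2⟩
      refine ⟨?_, h2⟩
      obtain ⟨e', he1, -, he3, -⟩ := h.rep_spec b h1
      have : e' = e := Fin.ext (by omega)
      subst this
      rwa [hlay, if_pos (by omega)]
  refine ⟨⟨?_, ?_, ?_, ?_, ?_, ?_, ?_, ?_, ?_⟩, hpart_lt, ?_⟩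
  · intro b
    rcases hcases b with ⟨a, -, -, -, h3, -⟩ | ⟨h2, -⟩ | ⟨h2, -⟩
    · have := a.isLt
      omega
    · omega
    · rw [h2]
      exact h.mat_le b
  · intro a b hb
    by_cases ha : a ∈ P
    · have h1 := (mem_addable.1 (hsel a ha).1).1
      obtain ⟨a', ha1, ha2, -⟩ := h.lay_mem (sel a) (by omega) h1.2
      have : a' = a := Fin.ext (by have := (hsel a ha).2; omega)
      subst this
      have hset : L'.matchedSet q a' = L.layerSet q (sel a') := by
        ext c
        rw [mem_matchedSet, mem_layerSet, hpick a' ha]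
      rwa [hset]
    · have hset : L'.matchedSet q a = L.matchedSet q a := by
        ext c
        rw [mem_matchedSet, mem_matchedSet, hfree a ha]
      rw [hset]
      exact h.mat_mem a b ((hfree a ha b).1 hb)
  · intro b
    rw [hlay, hdepth]
    split_ifs <;> omega
  · intro b hb
    have h1 := hlow b hb
    obtain ⟨e, he1, he2, he3, he4⟩ := h.rep_spec b h1.2.1
    refine ⟨e, ?_, ?_, ?_, ?_⟩
    · rw [hrep, he1]
    · rw [hrep, he2]
    · rw [h1.1, hlay, if_pos (by omega), he3]
    · rw [hown, hown, he4]
  · intro e he1 he2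
    have h1 := hlow e he1
    rw [hrep] at he2
    obtain ⟨a, ha1, ha2, i, hi, hai⟩ := h.lay_mem e h1.2.1 he2
    refine ⟨a, by rw [hown, ha1], ?_, i, by omega, ?_⟩
    · have : L'.layerSet q e = L.layerSet q e := by
        ext b
        rw [mem_layerSet, mem_layerSet]
        exact hset e h1.2.2 b
      rwa [this]
    · rwa [hpart_lt i (by omega)]
  · intro b c hbc hb0 hb hc
    rw [hrep, hrep]
    have h1 := hlowmat b hb hb0
    have h2 := hlowmat c hc (by omega)
    exact h.uniq b c (by omega) (by omega) (hlow b hb).2.1 (hlow c hc).2.1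
  · intro a i hi
    refine le_trans (Finset.card_le_card ?_) (h.deg a i hi)
    intro e he
    rw [Finset.mem_filter, mem_edgesAt, hrep, hown] at he
    have h1 := hlow e (by omega)
    rw [Finset.mem_filter, mem_edgesAt]
    exact ⟨⟨by omega, he.1.2⟩, he.2⟩
  · intro i hi1 hi2
    rw [hdepth] at hi2
    have hsum : ∑ l ∈ Finset.range i, (L'.part p q l).card =
        ∑ l ∈ Finset.range i, (L.part p q l).card := by
      refine Finset.sum_congr rfl fun l hl => ?_
      rw [Finset.mem_range] at hl
      rw [hpart_lt l (by omega)]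
    rw [hsum, hedges i hi1 hi2]
    exact h.growth i hi1 (by omega)
  · intro i hi1 hi2
    rw [hdepth] at hi2
    have hadd : L'.addable q i = L.addable q i := by
      ext e
      have h1 : e ∈ L'.edgesAt q i ↔ e ∈ L.edgesAt q i := by rw [hedges i hi1 (by omega)]
      rw [mem_edgesAt, mem_edgesAt] at h1
      rw [mem_addable, mem_addable, h1]
      refine and_congr_right fun he => ?_
      constructor
      · intro h3 b hb1 hb2
        have h4 := (hset e (by omega) b).2 ⟨hb1, hb2⟩
        have h5 := h3 b h4.1 h4.2
        rcases hcases b with ⟨a, -, -, -, -, h6⟩ | ⟨-, a, ha, h6⟩ | ⟨h6, -⟩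
        · have := (hlow b h4.1).2
          omega
        · -- A vertex of `P` is activated at level `j`, but `b` lies in an edge of layer `i < j`.
          have h7 : a ∈ L.part p q i := by
            refine (mem_part (by omega)).2 ⟨b, h6, ?_⟩
            obtain ⟨e', he1, -, he3, -⟩ := h.rep_spec b hb1
            have : e' = e := Fin.ext (by omega)
            subst this
            omega
          exact (Finset.disjoint_left.1 (h.disjoint_part hi2.ne) h7 (hP ha)).elim
        · rw [← h6, h5]
      · intro h3 b hb1 hb2
        have h4 := (hset e (by omega) b).1 ⟨hb1, hb2⟩
        by_contra h5
        have h6 := hlowmat b hb1 h5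
        rw [h3 b h4.1 h4.2] at h6
        exact h5 h6
    rw [hadd, hedges i hi1 (by omega)]
    exact h.stable i hi1 (by omega)
  · ext a
    rw [hpart j le_rfl, Finset.mem_sdiff]

end Inv

end Layout

/-! ### The potential -/

/-- The summand of the potential that belongs to a level with `x` vertices: it bounds the number of
iterations which may still take place before the level has shrunk to its least possible size, where
`F` is the value of `(N / y) ^ α` at the least size `y`. -/
noncomputable def levelPotential (N α κ F x : ℝ) : ℝ :=
  1 + 4 / κ * (F - (N / x) ^ α)

/-- The bound `F` in `levelPotential` for level `j`. -/
noncomputable def levelBound (N α g : ℝ) (x : ℕ → ℝ) : ℕ → ℝ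
  | 0 => N ^ α
  | j + 1 => (N / (g * x j)) ^ α

/-- The potential of the levels below `k`. -/
noncomputable def sumPotential (N α κ g : ℝ) (x : ℕ → ℝ) (k : ℕ) : ℝ :=
  ∑ j ∈ Finset.range k, levelPotential N α κ (levelBound N α g x j) (x j)

/-- The potential of a structure with last level `k`; `st` says whether this level is stable. -/
noncomputable def potential (N α κ g : ℝ) (x : ℕ → ℝ) (k : ℕ) (st : Prop) [Decidable st] : ℝ :=
  if st then sumPotential N α κ g x (k + 1) + 4 * (N / x k) ^ α
  else sumPotential N α κ g x k + 2

section Potential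

variable {N α κ g : ℝ} {x y : ℕ → ℝ} {k : ℕ}

lemma levelBound_congr {j : ℕ} (h : ∀ i < j, x i = y i) :
    levelBound N α g x j = levelBound N α g y j := by
  cases j with
  | zero => rfl
  | succ j => simp [levelBound, h j (Nat.lt_succ_self j)]

lemma sumPotential_congr (h : ∀ i < k, x i = y i) :
    sumPotential N α κ g x k = sumPotential N α κ g y k := by
  refine Finset.sum_congr rfl fun j hj => ?_
  rw [Finset.mem_range] at hj
  rw [levelBound_congr fun i hi => h i (hi.trans hj), h j hj]

/-- A stable level has at least its least possible size. -/
lemma one_le_levelPotential (hN : 0 ≤ N) (hα : 0 ≤ α) (hκ : 0 < κ) (hg : 0 < g) {j : ℕ}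
    (hpos : ∀ i ≤ j, 1 ≤ x i) (hgrow : ∀ i, i + 1 = j → g * x i ≤ x j) :
    1 ≤ levelPotential N α κ (levelBound N α g x j) (x j) := by
  have h1 := hpos j le_rfl
  have h2 : (N / x j) ^ α ≤ levelBound N α g x j := by
    cases j with
    | zero => exact Real.rpow_le_rpow (by positivity) (div_le_self hN h1) hα
    | succ i =>
      have h3 := hpos i (Nat.le_succ i)
      have h4 : 0 < g * x i := by positivity
      exact Real.rpow_le_rpow (by positivity) (div_le_div_of_nonneg_left hN h4 (hgrow i rfl)) hα
  unfold levelPotential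
  have : 0 ≤ 4 / κ * (levelBound N α g x j - (N / x j) ^ α) :=
    mul_nonneg (by positivity) (by linarith)
  linarith

lemma sumPotential_le (hN : 0 ≤ N) (hα : 0 ≤ α) (hκ : 0 < κ) (hg : 0 < g) {j : ℕ} (hjk : j ≤ k)
    (hpos : ∀ i < k, 1 ≤ x i) (hgrow : ∀ i, i + 1 < k → g * x i ≤ x (i + 1)) :
    sumPotential N α κ g x j ≤ sumPotential N α κ g x k := by
  refine Finset.sum_le_sum_of_subset_of_nonneg (by simpa using hjk) fun i hi _ => ?_
  rw [Finset.mem_range] at hi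
  refine zero_le_one.trans (one_le_levelPotential hN hα hκ hg (fun l hl => hpos l (by omega)) ?_)
  rintro l rfl
  exact hgrow l hi

lemma potential_nonneg (hN : 0 ≤ N) (hα : 0 ≤ α) (hκ : 0 < κ) (hg : 0 < g) {st : Prop}
    [Decidable st] (hpos : ∀ i < k, 1 ≤ x i) (hgrow : ∀ i, i + 1 < k → g * x i ≤ x (i + 1))
    (hposk : st → 1 ≤ x k) (hgrowk : st → ∀ i, i + 1 = k → g * x i ≤ x k) :
    0 ≤ potential N α κ g x k st := by
  unfold potential
  split_ifs with h
  · have h1 : sumPotential N α κ g x 0 ≤ sumPotential N α κ g x (k + 1) := by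
      refine sumPotential_le hN hα hκ hg (Nat.zero_le _) (fun i hi => ?_) fun i hi => ?_
      · rcases Nat.lt_succ_iff_lt_or_eq.1 hi with hi | rfl
        · exact hpos i hi
        · exact hposk h
      · rcases Nat.lt_succ_iff_lt_or_eq.1 hi with hi | rfl
        · exact hgrow i hi
        · exact hgrowk h i rfl
    have h2 : (0 : ℝ) ≤ (N / x k) ^ α :=
      Real.rpow_nonneg (div_nonneg hN (zero_le_one.trans (hposk h))) _
    simp only [sumPotential, Finset.range_zero, Finset.sum_empty] at h1
    unfold sumPotential
    linarith
  · have h1 := sumPotential_le (x := x) hN hα hκ hg (Nat.zero_le k) hpos hgrow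
    simp only [sumPotential, Finset.range_zero, Finset.sum_empty] at h1
    unfold sumPotential
    linarith

/-- Adding a level decreases the potential. -/
lemma potential_append (hN : 0 ≤ N) (hα : 0 < α) (hκ : 0 < κ) (hκ1 : κ ≤ 1) (hg : 0 < g)
    (hgκ : g ^ (-α) ≤ κ / 2) {st : Prop} [Decidable st] (hx1 : 1 ≤ x k) (hxN : x k ≤ N)
    (hxy : ∀ i ≤ k, y i = x i) (hyk : st → 0 ≤ y (k + 1)) :
    potential N α κ g y (k + 1) st + 1 ≤ potential N α κ g x k True := by
  have hx0 : 0 < x k := by linarith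
  set f := (N / x k) ^ α with hf
  have hf1 : 1 ≤ f := Real.one_le_rpow ((one_le_div hx0).2 hxN) hα.le
  have hsum : sumPotential N α κ g y (k + 1) = sumPotential N α κ g x (k + 1) :=
    sumPotential_congr fun i hi => hxy i (by omega)
  have hbound : levelBound N α g y (k + 1) ≤ κ / 2 * f := by
    have h1 : levelBound N α g y (k + 1) = g ^ (-α) * f := by
      rw [levelBound, hxy k le_rfl, Real.rpow_neg hg.le, hf, mul_comm g, ← div_div,
        Real.div_rpow (by positivity) hg.le, div_eq_inv_mul]
    rw [h1]
    exact mul_le_mul_of_nonneg_right hgκ (by linarith)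
  unfold potential
  rw [if_pos trivial]
  split_ifs with h
  · have h1 : sumPotential N α κ g y (k + 1 + 1) = sumPotential N α κ g y (k + 1) +
        levelPotential N α κ (levelBound N α g y (k + 1)) (y (k + 1)) :=
      Finset.sum_range_succ _ _
    rw [h1, hsum, levelPotential]
    have h2 : (0 : ℝ) ≤ (N / y (k + 1)) ^ α := Real.rpow_nonneg (div_nonneg hN (hyk h)) _
    have h3 : 4 / κ * (levelBound N α g y (k + 1) - (N / y (k + 1)) ^ α) ≤
        4 / κ * (κ / 2 * f - (N / y (k + 1)) ^ α) :=
      mul_le_mul_of_nonneg_left (by linarith) (by positivity)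
    have h4 : 4 / κ * (κ / 2 * f - (N / y (k + 1)) ^ α) =
        2 * f - 4 / κ * (N / y (k + 1)) ^ α := by
      field_simp
      ring
    have h5 : 4 * (N / y (k + 1)) ^ α ≤ 4 / κ * (N / y (k + 1)) ^ α :=
      mul_le_mul_of_nonneg_right (by rw [le_div_iff₀ hκ]; linarith) h2
    linarith
  · rw [hsum]
    linarith

/-- Shrinking a level below an unstable one by a constant factor decreases the potential. -/
lemma potential_collapse (hN : 0 ≤ N) (hα : 0 < α) (hg : 0 < g)
    {η : ℝ} (hη : 0 < η) (hη1 : η < 1) (hκ : κ = 1 - η ^ α)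
    {st : Prop} [Decidable st] {j : ℕ} (hj : j < k)
    (hpos : ∀ i < k, 1 ≤ x i) (hgrow : ∀ i, i + 1 < k → g * x i ≤ x (i + 1))
    (hxy : ∀ i < j, y i = x i) (hyj : y j ≤ η * x j) (hy0 : st → 0 < y j) :
    potential N α κ g y j st + 1 ≤ potential N α κ g x k False := by
  have hηα : η ^ α < 1 := Real.rpow_lt_one hη.le hη1 hα
  have hκ0 : 0 < κ := by rw [hκ]; linarith
  have hsum : sumPotential N α κ g y j = sumPotential N α κ g x j :=
    sumPotential_congr hxy
  have hsucc : ∀ z : ℕ → ℝ, sumPotential N α κ g z (j + 1) = sumPotential N α κ g z j +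
      levelPotential N α κ (levelBound N α g z j) (z j) := fun z => Finset.sum_range_succ _ _
  have hle := sumPotential_le hN hα.le hκ0 hg (Nat.succ_le_of_lt hj) hpos hgrow
  have hlev : 1 ≤ levelPotential N α κ (levelBound N α g x j) (x j) := by
    refine one_le_levelPotential hN hα.le hκ0 hg (fun i hi => hpos i (by omega)) ?_
    rintro i rfl
    exact hgrow i hj
  rw [Nat.succ_eq_add_one, hsucc] at hle
  unfold potential
  rw [if_neg not_false]
  split_ifs with h
  · rw [hsucc, hsum, levelBound_congr hxy]
    have hyj0 := hy0 h
    have hxj0 : 0 < x j := zero_lt_one.trans_le (hpos j hj)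
    have h1 : (N / x j) ^ α ≤ η ^ α * (N / y j) ^ α := by
      rw [← Real.mul_rpow hη.le (by positivity)]
      refine Real.rpow_le_rpow (by positivity) ?_ hα.le
      rw [div_le_iff₀ hxj0, mul_div_assoc', div_mul_eq_mul_div, le_div_iff₀ hyj0]
      nlinarith
    unfold levelPotential at hle ⊢
    have h2 : 4 / κ * (levelBound N α g x j - (N / y j) ^ α) + 4 * (N / y j) ^ α ≤
        4 / κ * (levelBound N α g x j - (N / x j) ^ α) := by
      have h3 : 4 * (N / y j) ^ α = 4 / κ * (κ * (N / y j) ^ α) := by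
        field_simp
      rw [h3, ← mul_add]
      refine mul_le_mul_of_nonneg_left ?_ (by positivity)
      rw [hκ]
      linarith
    linarith
  · rw [hsum]
    linarith

end Potential

/-! ### The choice of the exponent -/

/-- For `α` of order `1 / √(log d)` the growth of the levels by a factor of order `d` outweighs
the slow decrease of a level by a constant factor. -/
lemma rpow_neg_le_half {d α : ℝ} (hd : 4 ≤ d) (hα : α = 160 / √(Real.log d)) :
    (5 * (⌊d⌋₊ : ℝ) / 16) ^ (-α) ≤ (1 - (47 / 48 : ℝ) ^ α) / 2 := by
  have hD4 : (4 : ℝ) ≤ ⌊d⌋₊ := by exact_mod_cast Nat.le_floor (by exact_mod_cast hd)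
  have hdD : d < ⌊d⌋₊ + 1 := Nat.lt_floor_add_one d
  set D : ℝ := (⌊d⌋₊ : ℝ)
  set s := √(Real.log d) with hs
  have hlog4 : 1 ≤ Real.log 4 := by
    rw [Real.le_log_iff_exp_le (by norm_num)]
    linarith [Real.exp_one_lt_d9]
  have hlogd : Real.log 4 ≤ Real.log d := Real.log_le_log (by norm_num) hd
  have hs1 : 1 ≤ s := Real.one_le_sqrt.2 (by linarith)
  have hs2 : s * s = Real.log d := Real.mul_self_sqrt (by linarith)
  have hα0 : 0 < α := by rw [hα]; positivity
  have hαs : α * s = 160 := by rw [hα]; field_simp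
  -- `d ≤ (5 D / 16) ^ 10`, because `D + 1 ≤ 5 D / 4` and `5 D / 16 ≥ 5 / 4`.
  have hg : Real.log d / 10 ≤ Real.log (5 * D / 16) := by
    have h1 : d ≤ (5 * D / 16) ^ 10 := by
      have h2 : (5 / 4 : ℝ) ≤ 5 * D / 16 := by linarith
      have h3 : (5 / 4 : ℝ) ^ 9 ≤ (5 * D / 16) ^ 9 := pow_le_pow_left₀ (by norm_num) h2 9
      have h4 : (4 : ℝ) ≤ (5 / 4 : ℝ) ^ 9 := by norm_num
      calc d ≤ 4 * (5 * D / 16) := by linarith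
        _ ≤ (5 * D / 16) ^ 9 * (5 * D / 16) :=
            mul_le_mul_of_nonneg_right (h4.trans h3) (by positivity)
        _ = _ := by ring
    have h5 := Real.log_le_log (by linarith) h1
    rw [Real.log_pow] at h5
    push_cast at h5
    linarith
  have hleft : (5 * D / 16) ^ (-α) ≤ Real.exp (-(16 * s)) := by
    rw [Real.rpow_def_of_pos (by positivity)]
    refine Real.exp_le_exp.2 ?_
    have h1 : α * (Real.log d / 10) ≤ α * Real.log (5 * D / 16) :=
      mul_le_mul_of_nonneg_left hg hα0.le
    have h2 : α * (Real.log d / 10) = 16 * s := by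
      rw [← hs2]
      calc α * (s * s / 10) = (α * s) * s / 10 := by ring
        _ = _ := by rw [hαs]; ring
    linarith
  have hright : (47 / 48 : ℝ) ^ α ≤ 1 - 1 / (96 * s) := by
    have h1 : (47 / 48 : ℝ) ^ α ≤ (47 / 48 : ℝ) ^ (1 / s) := by
      refine Real.rpow_le_rpow_of_exponent_ge (by norm_num) (by norm_num) ?_
      rw [hα]
      gcongr
      norm_num
    have h2 : (1 + (-(1 / 48) : ℝ)) ^ (1 / s) ≤ 1 + 1 / s * (-(1 / 48)) :=
      rpow_one_add_le_one_add_mul_self (by norm_num) (by positivity)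
        (by rw [div_le_one (by positivity)]; exact hs1)
    have h3 : 1 + 1 / s * (-(1 / 48)) ≤ 1 - 1 / (96 * s) := by
      have h4 : 1 / (96 * s) = 1 / s * (1 / 96) := by field_simp
      have h5 : 0 < 1 / s := by positivity
      rw [h4]
      linarith
    have h4 : (47 / 48 : ℝ) = 1 + (-(1 / 48)) := by norm_num
    rw [← h4] at h2
    exact h1.trans (h2.trans h3)
  have hexp : Real.exp (-(16 * s)) ≤ 1 / (96 * s) / 2 := by
    have h1 : 192 * s ≤ Real.exp (16 * s) := by
      have h2 : Real.exp (16 * s) = Real.exp (2 * s) ^ 8 := by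
        rw [← Real.exp_nat_mul]
        congr 1
        push_cast
        ring
      have h3 : 1 + 2 * s ≤ Real.exp (2 * s) := by
        have := Real.add_one_le_exp (2 * s)
        linarith
      have h4 : 1 + 8 * (2 * s) ≤ (1 + 2 * s) ^ 8 := by
        have := one_add_mul_le_pow (a := 2 * s) (by linarith) 8
        push_cast at this
        linarith
      have h5 : (3 : ℝ) ^ 7 ≤ (1 + 2 * s) ^ 7 := pow_le_pow_left₀ (by norm_num) (by linarith) 7
      have h6 : (3 : ℝ) ^ 7 * (1 + 2 * s) ≤ (1 + 2 * s) ^ 8 := by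
        rw [pow_succ (1 + 2 * s) 7]
        exact mul_le_mul_of_nonneg_right h5 (by linarith)
      have h7 : (1 + 2 * s) ^ 8 ≤ Real.exp (2 * s) ^ 8 :=
        pow_le_pow_left₀ (by linarith) h3 8
      rw [h2]
      linarith
    rw [Real.exp_neg, div_div, inv_eq_one_div]
    exact one_div_le_one_div_of_le (by positivity) (by linarith)
  calc _ ≤ Real.exp (-(16 * s)) := hleft
    _ ≤ 1 / (96 * s) / 2 := hexp
    _ ≤ _ := by linarith

/-! ### Reasoning about programs -/

@[simp]
lemma Memory.setReg_reg (m : Memory) (x v y : ℕ) :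
    (m.setReg x v).reg y = if y = x then v else m.reg y := by
  simp [Memory.setReg, Function.update_apply]

@[simp]
lemma Memory.setReg_arr (m : Memory) (x v : ℕ) : (m.setReg x v).arr = m.arr := rfl

@[simp]
lemma Memory.setArr_reg (m : Memory) (k : ℕ) (v : ℕ → ℕ) : (m.setArr k v).reg = m.reg := rfl

@[simp]
lemma Memory.setArr_arr (m : Memory) (k : ℕ) (v : ℕ → ℕ) (l : ℕ) :
    (m.setArr k v).arr l = if l = k then v else m.arr l := by
  simp [Memory.setArr, Function.update_apply]

@[simp]
lemma Memory.setEntry_reg (m : Memory) (k i v : ℕ) : (m.setEntry k i v).reg = m.reg := rfl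

@[simp]
lemma Memory.setEntry_arr (m : Memory) (k i v l : ℕ) :
    (m.setEntry k i v).arr l = if l = k then Function.update (m.arr k) i v else m.arr l := by
  simp [Memory.setEntry]

/-- A bound for the running time of a program whose loops are not nested, in units of the maximal
number of iterations of a loop (and of the cost of a call). -/
def Prog.cst : Prog → ℕ
  | .seq p q => p.cst + q.cst
  | .ifLT _ _ p q => p.cst + q.cst + 1
  | .whileLT _ _ p => p.cst + 2
  | _ => 1

/-- The weakest precondition of a program without loops and calls (`False` for other programs). -/
def Prog.wp (W : ℕ) : Prog → (Memory → Prop) → Memory → Prop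
  | .skip, Q, m => Q m
  | .const x v, Q, m => v ≤ W ∧ Q (m.setReg x v)
  | .plus x y z, Q, m => m.reg y + m.reg z ≤ W ∧ Q (m.setReg x (m.reg y + m.reg z))
  | .minus x y z, Q, m => Q (m.setReg x (m.reg y - m.reg z))
  | .load x k i, Q, m => Q (m.setReg x (m.arr k (m.reg i)))
  | .store k i x, Q, m => Q (m.setEntry k (m.reg i) (m.reg x))
  | .seq p q, Q, m => p.wp W (q.wp W Q) m
  | .ifLT x y p q, Q, m => if m.reg x < m.reg y then p.wp W Q m else q.wp W Q m
  | .whileLT _ _ _, _, _ => False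
  | .call, _, _ => False

lemma Prog.wp_mono {W : ℕ} (p : Prog) {Q Q' : Memory → Prop} (hQ : ∀ m, Q m → Q' m) {m : Memory}
    (h : p.wp W Q m) : p.wp W Q' m := by
  induction p generalizing m Q Q' with
  | seq p q hp hq => exact hp (fun m' h' => hq hQ h') h
  | ifLT x y p q hp hq =>
    rw [Prog.wp] at h ⊢
    split_ifs at h ⊢
    · exact hp hQ h
    · exact hq hQ h
  | whileLT x y p _ => exact h.elim
  | call => exact h.elim
  | const x v => exact ⟨h.1, hQ _ h.2⟩
  | plus x y z => exact ⟨h.1, hQ _ h.2⟩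
  | _ => exact hQ _ h

/-- Started with the memory `m`, the program halts after time at most `p.cst * U`, with a memory
that satisfies `Q`. -/
def Reach (W : ℕ) (π : Procedure) (U : ℕ) (p : Prog) (m : Memory) (Q : Memory → Prop) : Prop :=
  ∀ c : ℕ, ∃ (t : ℕ) (s : Config), Exec W π p ⟨m, c⟩ t s ∧ t ≤ p.cst * U ∧ Q s.mem

section Reach

variable {W : ℕ} {π : Procedure} {U : ℕ} {p₁ p₂ : Prog} {m : Memory} {Q Q' : Memory → Prop}

lemma Reach.mono (h : Reach W π U p₁ m Q) (hQ : ∀ m', Q m' → Q' m') : Reach W π U p₁ m Q' := by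
  intro c
  obtain ⟨t, s, h1, h2, h3⟩ := h c
  exact ⟨t, s, h1, h2, hQ _ h3⟩

lemma Reach.mono_unit {U' : ℕ} (h : Reach W π U p₁ m Q) (hU : U ≤ U') :
    Reach W π U' p₁ m Q := by
  intro c
  obtain ⟨t, s, h1, h2, h3⟩ := h c
  exact ⟨t, s, h1, h2.trans (Nat.mul_le_mul_left _ hU), h3⟩

lemma Reach.seq (h : Reach W π U p₁ m fun m' => Reach W π U p₂ m' Q) :
    Reach W π U (.seq p₁ p₂) m Q := by
  intro c
  obtain ⟨t, s, h1, h2, h3⟩ := h c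
  obtain ⟨t', s', h1', h2', h3'⟩ := h3 s.calls
  exact ⟨t + t', s', .seq h1 h1', by rw [Prog.cst, add_mul]; omega, h3'⟩

lemma Reach.then (h : Reach W π U p₁ m Q') (h' : ∀ m', Q' m' → Reach W π U p₂ m' Q) :
    Reach W π U (.seq p₁ p₂) m Q :=
  (h.mono h').seq

lemma Reach.ifLT (hU : 1 ≤ U) {x y : ℕ} (h1 : m.reg x < m.reg y → Reach W π U p₁ m Q)
    (h2 : ¬ m.reg x < m.reg y → Reach W π U p₂ m Q) : Reach W π U (.ifLT x y p₁ p₂) m Q := by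
  intro c
  by_cases h : m.reg x < m.reg y
  · obtain ⟨t, s, h3, h4, h5⟩ := h1 h c
    refine ⟨t + 1, s, .ifTrue h h3, ?_, h5⟩
    rw [Prog.cst, add_mul, add_mul]
    omega
  · obtain ⟨t, s, h3, h4, h5⟩ := h2 h c
    refine ⟨t + 1, s, .ifFalse h h3, ?_, h5⟩
    rw [Prog.cst, add_mul, add_mul]
    omega

lemma reach_of_wp (p : Prog) {m : Memory} {Q : Memory → Prop} (h : p.wp W Q m) :
    Reach W π 1 p m Q := by
  induction p generalizing m Q with
  | skip => exact fun c => ⟨1, _, .skip _, by simp [Prog.cst], h⟩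
  | const x v => exact fun c => ⟨1, _, .const _ x v h.1, by simp [Prog.cst], h.2⟩
  | plus x y z => exact fun c => ⟨1, _, .plus _ x y z h.1, by simp [Prog.cst], h.2⟩
  | minus x y z => exact fun c => ⟨1, _, .minus _ x y z, by simp [Prog.cst], h⟩
  | load x k i => exact fun c => ⟨1, _, .load _ x k i, by simp [Prog.cst], h⟩
  | store k i x => exact fun c => ⟨1, _, .store _ k i x, by simp [Prog.cst], h⟩
  | seq p q hp hq => exact Reach.then (hp h) fun m' h' => hq h'
  | ifLT x y p q hp hq =>
    rw [Prog.wp] at h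
    refine Reach.ifLT le_rfl (fun hxy => hp ?_) fun hxy => hq ?_
    · rwa [if_pos hxy] at h
    · rwa [if_neg hxy] at h
  | whileLT x y p _ => exact h.elim
  | call => exact h.elim

lemma Reach.of_wp (hU : 1 ≤ U) (h : p₁.wp W Q m) : Reach W π U p₁ m Q :=
  (reach_of_wp p₁ h).mono_unit hU

lemma Reach.call {T : ℕ} (hU : T + 1 ≤ U) (hc : ∀ c, π.cost c m ≤ T)
    (h : ∀ c, Q (Config.afterCall π ⟨m, c⟩).mem) : Reach W π U .call m Q := by
  intro c
  refine ⟨_, _, .call _, ?_, h c⟩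
  have := hc c
  simp only [Prog.cst]
  omega

/-- `for reg i := 0 to reg n - 1 do p`, where `reg 5` contains `1`. -/
def forLoop (i n : ℕ) (p : Prog) : Prog :=
  .seq (.const i 0) (.whileLT i n (.seq p (.plus i i 5)))

lemma reach_forLoop {i n N : ℕ} {p : Prog} (I : ℕ → Memory → Prop) (hU : N + 1 ≤ U) (hW : N ≤ W)
    (h0 : I 0 (m.setReg i 0))
    (hI : ∀ j m', I j m' → m'.reg i = j ∧ m'.reg n = N)
    (hstep : ∀ j < N, ∀ m', I j m' →
      p.wp W (fun m' => m'.reg i = j ∧ m'.reg 5 = 1 ∧ I (j + 1) (m'.setReg i (j + 1))) m') :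
    Reach W π U (forLoop i n p) m (I N) := by
  have key : ∀ l j : ℕ, l + j = N → ∀ m', I j m' → ∀ c : ℕ, ∃ (t : ℕ) (s : Config),
      Exec W π (.whileLT i n (.seq p (.plus i i 5))) ⟨m', c⟩ t s ∧
        t ≤ l * (p.cst + 2) + 1 ∧ I N s.mem := by
    intro l
    induction l with
    | zero =>
      intro j hj m' hm' c
      have hj' : j = N := by omega
      subst hj'
      obtain ⟨h1, h2⟩ := hI _ m' hm'
      exact ⟨1, _, .whileDone (by simp [h1, h2]), by omega, hm'⟩
    | succ l ih =>
      intro j hj m' hm' c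
      obtain ⟨h1, h2⟩ := hI j m' hm'
      obtain ⟨t, s, h3, h4, h5, h6, h7⟩ :=
        (reach_of_wp p (hstep j (by omega) m' hm') : Reach W π 1 p m' _) c
      have h8 : s.mem.reg i + s.mem.reg 5 = j + 1 := by omega
      obtain ⟨t', s', h9, h10, h11⟩ := ih (j + 1) (by omega) _ h7 s.calls
      refine ⟨t + 1 + t' + 1, s', .whileStep (by simp only; omega)
        (.seq h3 (.plus s i i 5 (by omega))) ?_, ?_, h11⟩
      · rw [h8]
        exact h9
      · rw [add_mul]
        omega
  intro c
  obtain ⟨t, s, h1, h2, h3⟩ := key N 0 (by omega) _ h0 c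
  refine ⟨1 + t, s, .seq (.const _ i 0 (Nat.zero_le _)) h1, ?_, h3⟩
  have h4 : N * (p.cst + 2) ≤ U * (p.cst + 2) := Nat.mul_le_mul_right _ (by omega)
  have h5 : (forLoop i n p).cst * U = U * (p.cst + 2) + 2 * U := by
    simp only [forLoop, Prog.cst]
    ring
  omega

end Reach

/-- The memories agree except for the array `k` and the registers `20, 21, …`, which are used for
intermediate results. -/
def SameBut (k : ℕ) (m m₀ : Memory) : Prop :=
  (∀ x < 20, m.reg x = m₀.reg x) ∧ ∀ l ≠ k, m.arr l = m₀.arr l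

lemma SameBut.refl (k : ℕ) (m : Memory) : SameBut k m m :=
  ⟨fun _ _ => rfl, fun _ _ => rfl⟩

@[simp]
lemma sameBut_setReg {k x v : ℕ} {m m₀ : Memory} (hx : 20 ≤ x) :
    SameBut k (m.setReg x v) m₀ ↔ SameBut k m m₀ := by
  refine and_congr (forall₂_congr fun y hy => ?_) Iff.rfl
  rw [Memory.setReg_reg, if_neg (by omega)]

@[simp]
lemma sameBut_setEntry {k i v : ℕ} {m m₀ : Memory} :
    SameBut k (m.setEntry k i v) m₀ ↔ SameBut k m m₀ := by
  refine and_congr Iff.rfl (forall₂_congr fun l hl => ?_)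
  rw [Memory.setEntry_arr, if_neg hl]

/-- The array `g` results from `init` by setting the entry `ix i` to `val i` for `i = 0, …, N - 1`
with `C i`, in this order. -/
def Scattered (N : ℕ) (C : ℕ → Prop) (ix val init g : ℕ → ℕ) : Prop :=
  ∀ x, (∃ i < N, C i ∧ ix i = x ∧ g x = val i) ∨ ((∀ i < N, C i → ix i ≠ x) ∧ g x = init x)

lemma Scattered.eq_of_id {N : ℕ} {C : ℕ → Prop} {val init g : ℕ → ℕ}
    (h : Scattered N C (fun i => i) val init g) (x : ℕ) :
    (x < N → C x → g x = val x) ∧ ((N ≤ x ∨ ¬ C x) → g x = init x) := by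
  rcases h x with ⟨i, hi, hC, rfl, hg⟩ | ⟨hi, hg⟩
  · refine ⟨fun _ _ => hg, fun h => ?_⟩
    rcases h with h | h
    · exact absurd hi (not_lt.2 h)
    · exact absurd hC h
  · exact ⟨fun hx hC => absurd rfl (hi x hx hC), fun _ => hg⟩

section Loops

variable {W : ℕ} {π : Procedure} {U : ℕ} {m₀ : Memory} {n N : ℕ} {p : Prog}

/-- A loop that writes at most one entry of the array `k` in each iteration. -/
lemma reach_scatter (k : ℕ) (C : ℕ → Prop) (ix val : ℕ → ℕ) (hU : N + 1 ≤ U) (hW : N ≤ W)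
    (hn : n < 20) (hN : m₀.reg n = N) (h5 : m₀.reg 5 = 1)
    (hp : ∀ i < N, ∀ m, SameBut k m m₀ → m.reg 20 = i →
      Scattered i C ix val (m₀.arr k) (m.arr k) →
      p.wp W (fun m' => SameBut k m' m₀ ∧ m'.reg 20 = i ∧
        (C i → m'.arr k = Function.update (m.arr k) (ix i) (val i)) ∧
        (¬ C i → m'.arr k = m.arr k)) m) :
    Reach W π U (forLoop 20 n p) m₀ fun m =>
      SameBut k m m₀ ∧ Scattered N C ix val (m₀.arr k) (m.arr k) := by
  refine (reach_forLoop (fun j m => SameBut k m m₀ ∧ m.reg 20 = j ∧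
    Scattered j C ix val (m₀.arr k) (m.arr k)) hU hW ?_ ?_ ?_).mono fun m h => ⟨h.1, h.2.2⟩
  · refine ⟨(sameBut_setReg le_rfl).2 (SameBut.refl k m₀), by simp, fun x => Or.inr ⟨?_, rfl⟩⟩
    intro i hi
    omega
  · rintro j m ⟨h1, h2, -⟩
    exact ⟨h2, by rw [h1.1 n hn, hN]⟩
  · rintro j hj m ⟨h1, h2, h3⟩
    have key : ∀ m', (SameBut k m' m₀ ∧ m'.reg 20 = j ∧
        (C j → m'.arr k = Function.update (m.arr k) (ix j) (val j)) ∧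
        (¬ C j → m'.arr k = m.arr k)) → m'.reg 20 = j ∧ m'.reg 5 = 1 ∧
        (SameBut k (m'.setReg 20 (j + 1)) m₀ ∧ (m'.setReg 20 (j + 1)).reg 20 = j + 1 ∧
          Scattered (j + 1) C ix val (m₀.arr k) ((m'.setReg 20 (j + 1)).arr k)) := by
      rintro m' ⟨h4, h5', h6, h7⟩
      refine ⟨h5', by rw [h4.1 5 (by norm_num), h5], (sameBut_setReg le_rfl).2 h4,
        by simp, fun x => ?_⟩
      rw [Memory.setReg_arr]
      by_cases hC : C j
      · rw [h6 hC]
        by_cases hx : ix j = x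
        · exact Or.inl ⟨j, by omega, hC, hx, by rw [← hx, Function.update_self]⟩
        · rw [Function.update_of_ne (Ne.symm hx)]
          rcases h3 x with ⟨i, hi, h8⟩ | ⟨h8, h9⟩
          · exact Or.inl ⟨i, by omega, h8⟩
          · refine Or.inr ⟨fun i hi hCi => ?_, h9⟩
            rcases Nat.lt_succ_iff_lt_or_eq.1 hi with hi | rfl
            · exact h8 i hi hCi
            · exact hx
      · rw [h7 hC]
        rcases h3 x with ⟨i, hi, h8⟩ | ⟨h8, h9⟩
        · exact Or.inl ⟨i, by omega, h8⟩
        · refine Or.inr ⟨fun i hi hCi => ?_, h9⟩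
          rcases Nat.lt_succ_iff_lt_or_eq.1 hi with hi | rfl
          · exact h8 i hi hCi
          · exact absurd hCi hC
    exact Prog.wp_mono p key (hp j hj m h1 h2 h3)

/-- A loop that increases at most one entry of the array `k` in each iteration. -/
lemma reach_accumulate (k : ℕ) (ix w : ℕ → ℕ) (B : ℕ) (hU : N + 1 ≤ U) (hW : N ≤ W)
    (hn : n < 20) (hN : m₀.reg n = N) (h5 : m₀.reg 5 = 1) (hB : ∀ i < N, w i ≤ B)
    (hBW : N * B ≤ W) (hinit : ∀ i < N, m₀.arr k (ix i) = 0)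
    (hp : ∀ i < N, ∀ m, SameBut k m m₀ → m.reg 20 = i → m.arr k (ix i) + w i ≤ W →
      p.wp W (fun m' => SameBut k m' m₀ ∧ m'.reg 20 = i ∧
        m'.arr k = Function.update (m.arr k) (ix i) (m.arr k (ix i) + w i)) m) :
    Reach W π U (forLoop 20 n p) m₀ fun m => SameBut k m m₀ ∧
      ∀ x, m.arr k x = m₀.arr k x + ∑ i ∈ Finset.range N, if ix i = x then w i else 0 := by
  refine (reach_forLoop (fun j m => SameBut k m m₀ ∧ m.reg 20 = j ∧ j ≤ N ∧
    ∀ x, m.arr k x = m₀.arr k x + ∑ i ∈ Finset.range j, if ix i = x then w i else 0)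
    hU hW ?_ ?_ ?_).mono fun m h => ⟨h.1, h.2.2.2⟩
  · exact ⟨(sameBut_setReg le_rfl).2 (SameBut.refl k m₀), by simp, Nat.zero_le _, by simp⟩
  · rintro j m ⟨h1, h2, -⟩
    exact ⟨h2, by rw [h1.1 n hn, hN]⟩
  · rintro j hj m ⟨h1, h2, -, h3⟩
    have hsum : ∑ i ∈ Finset.range j, (if ix i = ix j then w i else 0) ≤ j * B := by
      have h4 : ∀ i ∈ Finset.range j, (if ix i = ix j then w i else 0) ≤ B := by
        intro i hi
        rw [Finset.mem_range] at hi
        split_ifs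
        · exact hB i (by omega)
        · exact Nat.zero_le _
      simpa using Finset.sum_le_card_nsmul _ _ _ h4
    have hle : m.arr k (ix j) + w j ≤ W := by
      rw [h3, hinit j hj]
      have h4 := hB j hj
      have h5 : (j + 1) * B ≤ N * B := Nat.mul_le_mul_right B hj
      rw [add_mul] at h5
      omega
    refine Prog.wp_mono p ?_ (hp j hj m h1 h2 hle)
    rintro m' ⟨h4, h5', h6⟩
    refine ⟨h5', by rw [h4.1 5 (by norm_num), h5], (sameBut_setReg le_rfl).2 h4,
      by simp, hj, fun x => ?_⟩
    rw [Memory.setReg_arr, h6, Finset.sum_range_succ]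
    by_cases hx : ix j = x
    · rw [← hx, Function.update_self, if_pos rfl, h3]
      omega
    · rw [Function.update_of_ne (Ne.symm hx), if_neg hx, h3]
      omega

end Loops

/-! ### The single loops of the program

The registers `0` and `1` hold `p` and `q`, the registers `5`, `6`, `7`, `8`, `10` hold the
constants `1`, `0`, `16`, `48`, `p + q + 2`, register `9` holds the number of layers, register `12`
the chosen level plus one, and register `11` is nonzero as long as the main loop has to continue;
the registers from `20` on are used for intermediate results. The arrays `0` to `4` belong to the
interface of the external procedure, and array `2` always holds the matching. The arrays `5`, `6`,
`7` hold the layers (see `Layout`), the arrays `8` to `12` what is computed from them in each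
iteration (see `Derived`), and the arrays `13` to `16` are used for the changes of the layers. -/

infixr:60 " ;; " => Prog.seq

/-- `if reg x = reg y then p` -/
def ifEq (x y : ℕ) (p : Prog) : Prog :=
  .ifLT x y .skip (.ifLT y x .skip p)

@[simp]
lemma wp_ifEq {W x y : ℕ} {p : Prog} {Q : Memory → Prop} {m : Memory} :
    (ifEq x y p).wp W Q m ↔ if m.reg x = m.reg y then p.wp W Q m else Q m := by
  rcases lt_trichotomy (m.reg x) (m.reg y) with h | h | h
  · simp [ifEq, Prog.wp, h, h.ne]
  · simp [ifEq, Prog.wp, h]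
  · simp [ifEq, Prog.wp, h, h.ne', not_lt.2 h.le]

/-- The registers with fixed contents. -/
structure Env (p q : ℕ) (m : Memory) : Prop where
  r0 : m.reg 0 = p
  r1 : m.reg 1 = q
  r5 : m.reg 5 = 1
  r6 : m.reg 6 = 0
  r7 : m.reg 7 = 16
  r8 : m.reg 8 = 48
  r10 : m.reg 10 = p + q + 2

lemma SameBut.env {k p q : ℕ} {m m₀ : Memory} (h : SameBut k m m₀) (e : Env p q m₀) :
    Env p q m where
  r0 := by rw [h.1 0 (by norm_num), e.r0]
  r1 := by rw [h.1 1 (by norm_num), e.r1]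
  r5 := by rw [h.1 5 (by norm_num), e.r5]
  r6 := by rw [h.1 6 (by norm_num), e.r6]
  r7 := by rw [h.1 7 (by norm_num), e.r7]
  r8 := by rw [h.1 8 (by norm_num), e.r8]
  r10 := by rw [h.1 10 (by norm_num), e.r10]

section Loops

variable {p q W U : ℕ} {π : Procedure} {m₀ : Memory}

/-- Set the entries `0, …, p + q + 1` of the array `k` to `0`. -/
def clearLoop (k : ℕ) : Prog := forLoop 20 10 (.store k 20 6)

lemma reach_clear (e : Env p q m₀) (hU : p + q + 3 ≤ U) (hW : p + q + 2 ≤ W) (k : ℕ) :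
    Reach W π U (clearLoop k) m₀ fun m =>
      SameBut k m m₀ ∧ ∀ x < p + q + 2, m.arr k x = 0 := by
  refine (reach_scatter k (fun _ => True) (fun i => i) (fun _ => 0) (N := p + q + 2)
    (by omega) hW (by norm_num) e.r10 e.r5 ?_).mono
    fun m h => ⟨h.1, fun x hx => (h.2.eq_of_id x).1 hx trivial⟩
  intro i hi m hm h20 _
  simp [Prog.wp, h20, hm.1, e.r6, hm]

/-- Mark all vertices of the first part as activated at level `0`. -/
def markLoop : Prog := forLoop 20 0 (.plus 21 20 5 ;; .store 8 21 5)

lemma reach_mark (e : Env p q m₀) (hU : p + q + 3 ≤ U) (hW : p + q + 2 ≤ W) :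
    Reach W π U markLoop m₀ fun m => SameBut 8 m m₀ ∧
      Scattered p (fun _ => True) (fun i => i + 1) (fun _ => 1) (m₀.arr 8) (m.arr 8) := by
  refine reach_scatter 8 _ _ _ (by omega) (by omega) (by norm_num) e.r0 e.r5 ?_
  intro i hi m hm h20 _
  simp [Prog.wp, h20, hm.1, e.r5, hm]
  omega

/-- Unmark the matched vertices of the first part. -/
def unmarkLoop : Prog := forLoop 20 1 (.load 21 2 20 ;; .store 8 21 6)

lemma reach_unmark (e : Env p q m₀) (hU : p + q + 3 ≤ U) (hW : p + q + 2 ≤ W) :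
    Reach W π U unmarkLoop m₀ fun m => SameBut 8 m m₀ ∧
      Scattered q (fun _ => True) (m₀.arr 2) (fun _ => 0) (m₀.arr 8) (m.arr 8) := by
  refine reach_scatter 8 _ _ _ (by omega) (by omega) (by norm_num) e.r1 e.r5 ?_
  intro i hi m hm h20 _
  simp [Prog.wp, h20, hm.1, hm.2, e.r6, hm]

/-- Mark the vertices activated at the levels `1, 2, …`. -/
def levelLoop : Prog := forLoop 20 1
  (.load 21 5 20 ;;
    .ifLT 6 21 (.load 22 2 20 ;; .plus 21 21 5 ;; .store 8 22 21) .skip)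

lemma reach_level (e : Env p q m₀) (hU : p + q + 3 ≤ U) (hW : p + q + 2 ≤ W)
    (hlay : ∀ b < q, m₀.arr 5 b ≤ q) :
    Reach W π U levelLoop m₀ fun m => SameBut 8 m m₀ ∧
      Scattered q (fun b => m₀.arr 5 b ≠ 0) (m₀.arr 2) (fun b => m₀.arr 5 b + 1)
        (m₀.arr 8) (m.arr 8) := by
  refine reach_scatter 8 _ _ _ (by omega) (by omega) (by norm_num) e.r1 e.r5 ?_
  intro i hi m hm h20 _
  have := hlay i hi
  by_cases h : m₀.arr 5 i = 0
  · simp [Prog.wp, h20, hm.1, hm.2, e.r6, hm, h]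
  · simp [Prog.wp, h20, hm.1, hm.2, e.r5, e.r6, hm, h, Nat.pos_of_ne_zero h]
    omega

/-- Mark the edges of the layers that touch an edge of the matching. -/
def touchLoop : Prog := forLoop 20 1
  (.load 21 5 20 ;;
    .ifLT 6 21 (.load 21 2 20 ;; .ifLT 6 21 (.load 21 6 20 ;; .store 9 21 5) .skip) .skip)

lemma reach_touch (e : Env p q m₀) (hU : p + q + 3 ≤ U) (hW : p + q + 2 ≤ W) :
    Reach W π U touchLoop m₀ fun m => SameBut 9 m m₀ ∧
      Scattered q (fun b => m₀.arr 5 b ≠ 0 ∧ m₀.arr 2 b ≠ 0) (m₀.arr 6) (fun _ => 1)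
        (m₀.arr 9) (m.arr 9) := by
  refine reach_scatter 9 _ _ _ (by omega) (by omega) (by norm_num) e.r1 e.r5 ?_
  intro i hi m hm h20 _
  by_cases h : m₀.arr 5 i = 0
  · simp [Prog.wp, h20, hm.1, hm.2, e.r6, hm, h]
  · by_cases h' : m₀.arr 2 i = 0
    · simp [Prog.wp, h20, hm.1, hm.2, e.r6, hm, h, h', Nat.pos_of_ne_zero h]
    · simp [Prog.wp, h20, hm.1, hm.2, e.r5, e.r6, hm, h, h', Nat.pos_of_ne_zero h,
        Nat.pos_of_ne_zero h']

/-- Count the vertices activated at each level. -/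
def countLoop : Prog := forLoop 20 0
  (.plus 21 20 5 ;; .load 21 8 21 ;; .load 22 10 21 ;; .plus 22 22 5 ;; .store 10 21 22)

lemma reach_count (e : Env p q m₀) (hU : p + q + 3 ≤ U) (hW : p + q + 2 ≤ W)
    (hinit : ∀ a < p, m₀.arr 10 (m₀.arr 8 (a + 1)) = 0) :
    Reach W π U countLoop m₀ fun m => SameBut 10 m m₀ ∧ ∀ x, m.arr 10 x = m₀.arr 10 x +
      ∑ a ∈ Finset.range p, if m₀.arr 8 (a + 1) = x then 1 else 0 := by
  refine reach_accumulate 10 _ _ 1 (by omega) (by omega) (by norm_num) e.r0 e.r5 (fun _ _ => le_rfl)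
    (by omega) hinit ?_
  intro i hi m hm h20 hle
  simp [Prog.wp, h20, hm.1, hm.2, e.r5, hm]
  omega

/-- Add up `16` for each edge of a layer that touches no edge of the matching. -/
def addableLoop : Prog := forLoop 20 1
  (.load 21 5 20 ;; .ifLT 6 21 (.load 22 6 20 ;; ifEq 22 20 (.load 22 9 20 ;; ifEq 22 6
    (.load 22 11 21 ;; .plus 22 22 7 ;; .store 11 21 22))) .skip)

lemma reach_addable (e : Env p q m₀) (hU : p + q + 3 ≤ U) (hW : 16 * (p + q) + 2 ≤ W)
    (hinit : ∀ b < q, m₀.arr 11 (m₀.arr 5 b) = 0) :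
    Reach W π U addableLoop m₀ fun m => SameBut 11 m m₀ ∧ ∀ x, m.arr 11 x = m₀.arr 11 x +
      ∑ b ∈ Finset.range q, if m₀.arr 5 b = x then
        (if m₀.arr 5 b ≠ 0 ∧ m₀.arr 6 b = b ∧ m₀.arr 9 b = 0 then 16 else 0) else 0 := by
  refine reach_accumulate 11 _
    (fun b => if m₀.arr 5 b ≠ 0 ∧ m₀.arr 6 b = b ∧ m₀.arr 9 b = 0 then 16 else 0)
    16 (by omega) (by omega) (by norm_num) e.r1 e.r5 (fun _ _ => by split_ifs <;> omega)
    (by omega) hinit ?_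
  intro i hi m hm h20 hle
  by_cases h : m₀.arr 5 i = 0
  · simp [Prog.wp, h20, hm.1, hm.2, e.r6, hm, h]
  · by_cases h' : m₀.arr 6 i = i
    · by_cases h'' : m₀.arr 9 i = 0
      · simp [h, h', h''] at hle
        simp [Prog.wp, h20, hm.1, hm.2, e.r6, e.r7, hm, h, h', h'', Nat.pos_of_ne_zero h]
        omega
      · simp [Prog.wp, h20, hm.1, hm.2, e.r6, hm, h, h', h'', Nat.pos_of_ne_zero h]
    · simp [Prog.wp, h20, hm.1, hm.2, e.r6, hm, h, h', Nat.pos_of_ne_zero h]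

/-- Count the edges of each layer. -/
def edgesLoop : Prog := forLoop 20 1
  (.load 21 5 20 ;; .load 22 6 20 ;; ifEq 22 20
    (.load 22 12 21 ;; .plus 22 22 5 ;; .store 12 21 22))

lemma reach_edges (e : Env p q m₀) (hU : p + q + 3 ≤ U) (hW : p + q + 2 ≤ W)
    (hinit : ∀ b < q, m₀.arr 12 (m₀.arr 5 b) = 0) :
    Reach W π U edgesLoop m₀ fun m => SameBut 12 m m₀ ∧ ∀ x, m.arr 12 x = m₀.arr 12 x +
      ∑ b ∈ Finset.range q, if m₀.arr 5 b = x then (if m₀.arr 6 b = b then 1 else 0) else 0 := by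
  refine reach_accumulate 12 _ (fun b => if m₀.arr 6 b = b then 1 else 0)
    1 (by omega) (by omega) (by norm_num) e.r1 e.r5 (fun _ _ => by split_ifs <;> omega)
    (by omega) hinit ?_
  intro i hi m hm h20 hle
  by_cases h' : m₀.arr 6 i = i
  · simp [h'] at hle
    simp [Prog.wp, h20, hm.1, hm.2, e.r5, hm, h']
    omega
  · simp [Prog.wp, h20, hm.2, hm, h']

/-- Write the indicator array of the activated vertices. -/
def activeLoop : Prog := forLoop 20 0
  (.plus 21 20 5 ;; .load 21 8 21 ;; .ifLT 6 21 (.store 0 20 5) (.store 0 20 6))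

lemma reach_active (e : Env p q m₀) (hU : p + q + 3 ≤ U) (hW : p + q + 2 ≤ W) :
    Reach W π U activeLoop m₀ fun m => SameBut 0 m m₀ ∧
      Scattered p (fun _ => True) (fun i => i) (fun a => if m₀.arr 8 (a + 1) = 0 then 0 else 1)
        (m₀.arr 0) (m.arr 0) := by
  refine reach_scatter 0 _ _ _ (by omega) (by omega) (by norm_num) e.r0 e.r5 ?_
  intro i hi m hm h20 _
  by_cases h : m₀.arr 8 (i + 1) = 0
  · simp [Prog.wp, h20, hm.1, hm.2, e.r5, e.r6, hm, h]
    omega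
  · simp [Prog.wp, h20, hm.1, hm.2, e.r5, e.r6, hm, h, Nat.pos_of_ne_zero h]
    omega

/-- Write the indicator array of the forbidden vertices. -/
def forbiddenLoop : Prog := forLoop 20 1
  (.load 21 5 20 ;; .ifLT 6 21 (.store 1 20 5)
    (.load 21 2 20 ;; .load 21 8 21 ;; .ifLT 6 21 (.store 1 20 5) (.store 1 20 6)))

lemma reach_forbidden (e : Env p q m₀) (hU : p + q + 3 ≤ U) (hW : p + q + 2 ≤ W) :
    Reach W π U forbiddenLoop m₀ fun m => SameBut 1 m m₀ ∧
      Scattered q (fun _ => True) (fun i => i)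
        (fun b => if m₀.arr 5 b = 0 ∧ m₀.arr 8 (m₀.arr 2 b) = 0 then 0 else 1)
        (m₀.arr 1) (m.arr 1) := by
  refine reach_scatter 1 _ _ _ (by omega) (by omega) (by norm_num) e.r1 e.r5 ?_
  intro i hi m hm h20 _
  by_cases h : m₀.arr 5 i = 0
  · by_cases h' : m₀.arr 8 (m₀.arr 2 i) = 0
    · simp [Prog.wp, h20, hm.1, hm.2, e.r6, hm, h, h']
    · simp [Prog.wp, h20, hm.1, hm.2, e.r5, e.r6, hm, h, h', Nat.pos_of_ne_zero h']
  · simp [Prog.wp, h20, hm.1, hm.2, e.r5, e.r6, hm, h, Nat.pos_of_ne_zero h]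

/-- Choose a representative for each edge of the new layer. -/
def representLoop : Prog := forLoop 20 1 (.load 21 4 20 ;; .store 15 21 20)

lemma reach_represent (e : Env p q m₀) (hU : p + q + 3 ≤ U) (hW : p + q + 2 ≤ W) :
    Reach W π U representLoop m₀ fun m => SameBut 15 m m₀ ∧
      Scattered q (fun _ => True) (m₀.arr 4) (fun b => b) (m₀.arr 15) (m.arr 15) := by
  refine reach_scatter 15 _ _ _ (by omega) (by omega) (by norm_num) e.r1 e.r5 ?_
  intro i hi m hm h20 _
  simp [Prog.wp, h20, hm.2, hm]

/-- Store the representatives of the edges of the new layer. -/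
def newRepLoop : Prog := forLoop 20 1
  (.load 21 4 20 ;; .ifLT 6 21 (.load 21 15 21 ;; .store 6 20 21) .skip)

lemma reach_newRep (e : Env p q m₀) (hU : p + q + 3 ≤ U) (hW : p + q + 2 ≤ W) :
    Reach W π U newRepLoop m₀ fun m => SameBut 6 m m₀ ∧
      Scattered q (fun b => m₀.arr 4 b ≠ 0) (fun b => b) (fun b => m₀.arr 15 (m₀.arr 4 b))
        (m₀.arr 6) (m.arr 6) := by
  refine reach_scatter 6 _ _ _ (by omega) (by omega) (by norm_num) e.r1 e.r5 ?_
  intro i hi m hm h20 _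
  by_cases h : m₀.arr 4 i = 0
  · simp [Prog.wp, h20, hm.1, hm.2, e.r6, hm, h]
  · simp [Prog.wp, h20, hm.1, hm.2, e.r6, hm, h, Nat.pos_of_ne_zero h]

/-- Store the vertices in the first part of the edges of the new layer. -/
def newOwnLoop : Prog := forLoop 20 1
  (.load 21 4 20 ;; .ifLT 6 21
    (.minus 21 21 5 ;; .load 21 3 21 ;; .plus 21 21 5 ;; .store 7 20 21) .skip)

lemma reach_newOwn (e : Env p q m₀) (hU : p + q + 3 ≤ U) (hW : p + q + 2 ≤ W)
    (hown : ∀ b < q, m₀.arr 4 b ≠ 0 → m₀.arr 3 (m₀.arr 4 b - 1) < p) :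
    Reach W π U newOwnLoop m₀ fun m => SameBut 7 m m₀ ∧
      Scattered q (fun b => m₀.arr 4 b ≠ 0) (fun b => b)
        (fun b => m₀.arr 3 (m₀.arr 4 b - 1) + 1) (m₀.arr 7) (m.arr 7) := by
  refine reach_scatter 7 _ _ _ (by omega) (by omega) (by norm_num) e.r1 e.r5 ?_
  intro i hi m hm h20 _
  by_cases h : m₀.arr 4 i = 0
  · simp [Prog.wp, h20, hm.1, hm.2, e.r6, hm, h]
  · have := hown i hi h
    simp [Prog.wp, h20, hm.1, hm.2, e.r5, e.r6, hm, h, Nat.pos_of_ne_zero h]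
    omega

/-- Store the number of the new layer. -/
def newLayLoop : Prog := forLoop 20 1
  (.load 21 4 20 ;; .ifLT 6 21 (.store 5 20 9) .skip)

lemma reach_newLay (e : Env p q m₀) (hU : p + q + 3 ≤ U) (hW : p + q + 2 ≤ W) :
    Reach W π U newLayLoop m₀ fun m => SameBut 5 m m₀ ∧
      Scattered q (fun b => m₀.arr 4 b ≠ 0) (fun b => b) (fun _ => m₀.reg 9)
        (m₀.arr 5) (m.arr 5) := by
  refine reach_scatter 5 _ _ _ (by omega) (by omega) (by norm_num) e.r1 e.r5 ?_
  intro i hi m hm h20 _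
  by_cases h : m₀.arr 4 i = 0
  · simp [Prog.wp, h20, hm.1, hm.2, e.r6, hm, h]
  · simp [Prog.wp, h20, hm.1, hm.2, e.r6, hm, h, Nat.pos_of_ne_zero h]

/-- Choose, for each vertex that has one, an edge of the last layer that touches no edge of the
matching. -/
def pickLoop : Prog := forLoop 20 1
  (.load 21 5 20 ;; ifEq 21 9 (.load 22 6 20 ;; ifEq 22 20 (.load 22 9 20 ;; ifEq 22 6
    (.load 22 7 20 ;; .plus 21 20 5 ;; .store 13 22 21))))

lemma reach_pick (e : Env p q m₀) (hU : p + q + 3 ≤ U) (hW : p + q + 2 ≤ W) :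
    Reach W π U pickLoop m₀ fun m => SameBut 13 m m₀ ∧
      Scattered q (fun b => m₀.arr 5 b = m₀.reg 9 ∧ m₀.arr 6 b = b ∧ m₀.arr 9 b = 0)
        (m₀.arr 7) (fun b => b + 1) (m₀.arr 13) (m.arr 13) := by
  refine reach_scatter 13 _ _ _ (by omega) (by omega) (by norm_num) e.r1 e.r5 ?_
  intro i hi m hm h20 _
  by_cases h : m₀.arr 5 i = m₀.reg 9
  · by_cases h' : m₀.arr 6 i = i
    · by_cases h'' : m₀.arr 9 i = 0
      · simp [Prog.wp, h20, hm.1, hm.2, e.r5, e.r6, hm, h, h', h'']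
        omega
      · simp [Prog.wp, h20, hm.1, hm.2, e.r6, hm, h, h', h'']
    · simp [Prog.wp, h20, hm.1, hm.2, hm, h, h']
  · simp [Prog.wp, h20, hm.1, hm.2, hm, h]

/-- Add up `48` for each vertex of a level for which an edge has been chosen. -/
def pickedLoop : Prog := forLoop 20 0
  (.plus 21 20 5 ;; .load 22 13 21 ;; .ifLT 6 22
    (.load 21 8 21 ;; .load 22 14 21 ;; .plus 22 22 8 ;; .store 14 21 22) .skip)

lemma reach_picked (e : Env p q m₀) (hU : p + q + 3 ≤ U) (hW : 48 * (p + q) + 2 ≤ W)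
    (hinit : ∀ a < p, m₀.arr 14 (m₀.arr 8 (a + 1)) = 0) :
    Reach W π U pickedLoop m₀ fun m => SameBut 14 m m₀ ∧ ∀ x, m.arr 14 x = m₀.arr 14 x +
      ∑ a ∈ Finset.range p, if m₀.arr 8 (a + 1) = x then
        (if m₀.arr 13 (a + 1) = 0 then 0 else 48) else 0 := by
  refine reach_accumulate 14 _ (fun a => if m₀.arr 13 (a + 1) = 0 then 0 else 48)
    48 (by omega) (by omega) (by norm_num) e.r0 e.r5 (fun _ _ => by split_ifs <;> omega)
    (by omega) hinit ?_
  intro i hi m hm h20 hle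
  by_cases h : m₀.arr 13 (i + 1) = 0
  · simp [Prog.wp, h20, hm.1, hm.2, e.r5, e.r6, hm, h]
    omega
  · simp [h] at hle
    simp [Prog.wp, h20, hm.1, hm.2, e.r5, e.r6, e.r8, hm, h, Nat.pos_of_ne_zero h]
    omega

/-- Search for a level in which edges have been chosen for a positive fraction of the vertices. -/
def searchLoop : Prog := forLoop 20 10
  (.load 21 10 20 ;; .load 22 14 20 ;; .ifLT 21 22 (.store 16 6 20) .skip)

lemma reach_search (e : Env p q m₀) (hU : p + q + 3 ≤ U) (hW : p + q + 2 ≤ W) :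
    Reach W π U searchLoop m₀ fun m => SameBut 16 m m₀ ∧
      Scattered (p + q + 2) (fun x => m₀.arr 10 x < m₀.arr 14 x) (fun _ => 0) (fun x => x)
        (m₀.arr 16) (m.arr 16) := by
  refine reach_scatter 16 _ _ _ (by omega) (by omega) (by norm_num) e.r10 e.r5 ?_
  intro i hi m hm h20 _
  by_cases h : m₀.arr 10 i < m₀.arr 14 i
  · simp [Prog.wp, h20, hm.1, hm.2, e.r6, hm, h]
  · simp [Prog.wp, h20, hm.2, hm, h]

/-- Remove the edges of the matching at the vertices of the chosen level for which another edge has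
been chosen. -/
def removeLoop : Prog := forLoop 20 1
  (.load 21 2 20 ;; .load 22 13 21 ;; .ifLT 6 22
    (.load 22 8 21 ;; ifEq 22 12 (.store 2 20 6)) .skip)

lemma reach_remove (e : Env p q m₀) (hU : p + q + 3 ≤ U) (hW : p + q + 2 ≤ W) :
    Reach W π U removeLoop m₀ fun m => SameBut 2 m m₀ ∧
      Scattered q
        (fun b => m₀.arr 13 (m₀.arr 2 b) ≠ 0 ∧ m₀.arr 8 (m₀.arr 2 b) = m₀.reg 12)
        (fun b => b) (fun _ => 0) (m₀.arr 2) (m.arr 2) := by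
  refine reach_scatter 2 _ _ _ (by omega) (by omega) (by norm_num) e.r1 e.r5 ?_
  intro i hi m hm h20 hs
  have h2 : m.arr 2 i = m₀.arr 2 i := (hs.eq_of_id i).2 (Or.inl le_rfl)
  by_cases h : m₀.arr 13 (m₀.arr 2 i) = 0
  · simp [Prog.wp, h20, hm.1, hm.2, h2, e.r6, hm, h]
  · by_cases h' : m₀.arr 8 (m₀.arr 2 i) = m₀.reg 12
    · simp [Prog.wp, h20, hm.1, hm.2, h2, e.r6, hm, h, h', Nat.pos_of_ne_zero h]
    · simp [Prog.wp, h20, hm.1, hm.2, h2, e.r6, hm, h, h', Nat.pos_of_ne_zero h]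

/-- Insert the chosen edges at the vertices of the chosen level into the matching. -/
def insertLoop : Prog := forLoop 20 1
  (.load 21 5 20 ;; .ifLT 6 21
    (.load 21 7 20 ;; .load 22 13 21 ;; .load 23 6 20 ;; .plus 23 23 5 ;; ifEq 22 23
      (.load 22 8 21 ;; ifEq 22 12 (.store 2 20 21))) .skip)

lemma reach_insert (e : Env p q m₀) (hU : p + q + 3 ≤ U) (hW : p + q + 2 ≤ W)
    (hrep : ∀ b < q, m₀.arr 5 b ≠ 0 → m₀.arr 6 b < q) :
    Reach W π U insertLoop m₀ fun m => SameBut 2 m m₀ ∧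
      Scattered q
        (fun b => m₀.arr 5 b ≠ 0 ∧ m₀.arr 13 (m₀.arr 7 b) = m₀.arr 6 b + 1 ∧
          m₀.arr 8 (m₀.arr 7 b) = m₀.reg 12)
        (fun b => b) (m₀.arr 7) (m₀.arr 2) (m.arr 2) := by
  refine reach_scatter 2 _ _ _ (by omega) (by omega) (by norm_num) e.r1 e.r5 ?_
  intro i hi m hm h20 _
  by_cases h : m₀.arr 5 i = 0
  · simp [Prog.wp, h20, hm.1, hm.2, e.r6, hm, h]
  · have := hrep i hi h
    have hw : m₀.arr 6 i + 1 ≤ W := by omega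
    by_cases h' : m₀.arr 13 (m₀.arr 7 i) = m₀.arr 6 i + 1
    · by_cases h'' : m₀.arr 8 (m₀.arr 7 i) = m₀.reg 12
      · simp [Prog.wp, h20, hm.1, hm.2, e.r5, e.r6, hm, h, h', h'', hw, Nat.pos_of_ne_zero h]
      · simp [Prog.wp, h20, hm.1, hm.2, e.r5, e.r6, hm, h, h', h'', hw, Nat.pos_of_ne_zero h]
    · simp [Prog.wp, h20, hm.1, hm.2, e.r5, e.r6, hm, h, h', hw, Nat.pos_of_ne_zero h]

/-- Delete the layers after the chosen level. -/
def truncateLoop : Prog := forLoop 20 1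
  (.load 21 5 20 ;; .ifLT 21 12 .skip (.store 5 20 6))

lemma reach_truncate (e : Env p q m₀) (hU : p + q + 3 ≤ U) (hW : p + q + 2 ≤ W) :
    Reach W π U truncateLoop m₀ fun m => SameBut 5 m m₀ ∧
      Scattered q (fun b => ¬ m₀.arr 5 b < m₀.reg 12) (fun b => b) (fun _ => 0)
        (m₀.arr 5) (m.arr 5) := by
  refine reach_scatter 5 _ _ _ (by omega) (by omega) (by norm_num) e.r1 e.r5 ?_
  intro i hi m hm h20 hs
  have h5 : m.arr 5 i = m₀.arr 5 i := (hs.eq_of_id i).2 (Or.inl le_rfl)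
  by_cases h : m₀.arr 5 i < m₀.reg 12
  · simp [Prog.wp, h20, hm.1, h5, hm, h]
  · simp [Prog.wp, h20, hm.1, h5, e.r6, hm, h]

end Loops

/-! ### The quantities computed from the layers -/

/-- The layered structure stored in the memory. -/
def layoutOf (m : Memory) : Layout := ⟨m.arr 2, m.arr 5, m.arr 6, m.arr 7, m.reg 9⟩

lemma SameBut.layoutOf {k : ℕ} {m m₀ : Memory} (h : SameBut k m m₀) (h2 : 2 ≠ k) (h5 : 5 ≠ k)
    (h6 : 6 ≠ k) (h7 : 7 ≠ k) : layoutOf m = layoutOf m₀ := by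
  simp only [HPM.layoutOf, h.1 9 (by norm_num), h.2 2 h2, h.2 5 h5, h.2 6 h6, h.2 7 h7]

lemma SameBut.trans {k : ℕ} {m₁ m₂ m₃ : Memory} (h : SameBut k m₁ m₂) (h' : SameBut k m₂ m₃) :
    SameBut k m₁ m₃ :=
  ⟨fun x hx => (h.1 x hx).trans (h'.1 x hx), fun l hl => (h.2 l hl).trans (h'.2 l hl)⟩

/-- The entry `al (a + 1)` is `j + 1` if `a` is activated at level `j`, and `0` if `a` is not
activated. -/
structure IsLevels (p q : ℕ) (L : Layout) (al : ℕ → ℕ) : Prop where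
  iff : ∀ (a : Fin p) (j : ℕ), al (a + 1) = j + 1 ↔ a ∈ L.part p q j
  le : ∀ a : Fin p, al (a + 1) ≤ L.depth + 1
  zero : al 0 = 0

/-- The entry `bl e` is nonzero if the layer edge represented by `e` touches the matching. -/
def IsTouched (q : ℕ) (L : Layout) (bl : ℕ → ℕ) : Prop :=
  ∀ e : Fin q, bl e = 0 ↔ ∀ b : Fin q, L.lay b ≠ 0 → L.rep b = e → L.mat b = 0

/-- The auxiliary arrays and registers computed from the layered structure. -/
structure Derived (p q : ℕ) (m : Memory) : Prop where
  levels : IsLevels p q (layoutOf m) (m.arr 8)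
  touched : IsTouched q (layoutOf m) (m.arr 9)
  count : ∀ j < p + q + 1, m.arr 10 (j + 1) = ((layoutOf m).part p q j).card
  addable_zero : m.arr 11 0 = 0
  addable : ∀ j, 1 ≤ j → j ≤ (layoutOf m).depth →
    m.arr 11 j = 16 * ((layoutOf m).addable q j).card
  edges : ∀ j, 1 ≤ j → j ≤ (layoutOf m).depth → m.arr 12 j = ((layoutOf m).edgesAt q j).card
  flag : m.reg 11 = ((layoutOf m).part p q 0).card

section Derive

variable {p q W U D : ℕ} {π : Procedure} {m₀ : Memory} {H : BipartiteHypergraph (Fin p) (Fin q)}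

/-- Compute the levels of the vertices of the first part. -/
def levelsProg : Prog := markLoop ;; unmarkLoop ;; levelLoop ;; .store 8 6 6

lemma reach_levels (e : Env p q m₀) (hU : p + q + 3 ≤ U) (hW : p + q + 2 ≤ W)
    (hL : (layoutOf m₀).Inv H D) (hq : (layoutOf m₀).depth ≤ q) :
    Reach W π U levelsProg m₀ fun m =>
      SameBut 8 m m₀ ∧ IsLevels p q (layoutOf m₀) (m.arr 8) := by
  have hlay : ∀ b < q, m₀.arr 5 b ≤ q := fun b hb => (hL.lay_le ⟨b, hb⟩).trans hq
  refine (reach_mark e hU hW).then fun m₁ ⟨s₁, h₁⟩ => ?_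
  have e₁ := s₁.env e
  refine (reach_unmark e₁ hU hW).then fun m₂ ⟨s₂, h₂⟩ => ?_
  have e₂ := s₂.env e₁
  refine (reach_level e₂ hU hW ?_).then fun m₃ ⟨s₃, h₃⟩ => ?_
  · simpa [s₂.2, s₁.2] using hlay
  have e₃ := s₃.env e₂
  refine Reach.of_wp (by omega) ?_
  simp only [s₂.2, s₁.2, ne_eq, Nat.reduceEqDiff, not_false_eq_true] at h₂ h₃
  simp only [Prog.wp, e₃.r6, sameBut_setEntry]
  refine ⟨s₃.trans (s₂.trans s₁), ?_⟩
  have hal : ∀ a : Fin p, ∃ j ≤ (layoutOf m₀).depth + 1, m₃.arr 8 (a + 1) = j ∧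
      ∀ i, j = i + 1 ↔ a ∈ (layoutOf m₀).part p q i := by
    intro a
    rcases h₃ (a + 1) with ⟨b, hb, hb1, hb2, hb3⟩ | ⟨hb1, hb2⟩
    · have hb' := hL.lay_le ⟨b, hb⟩
      have hb1' : (layoutOf m₀).lay b ≠ 0 := hb1
      have hb2' : (layoutOf m₀).mat b = a + 1 := hb2
      refine ⟨(layoutOf m₀).lay b + 1, by simpa using hb', hb3, fun i => ?_⟩
      rcases Nat.eq_zero_or_pos i with rfl | hi
      · rw [Layout.mem_part_zero]
        exact ⟨fun h => absurd (Nat.succ_injective h) hb1', fun h => absurd hb2' (h ⟨b, hb⟩)⟩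
      · rw [Layout.mem_part hi.ne']
        constructor
        · intro h
          exact ⟨⟨b, hb⟩, hb2', Nat.succ_injective h⟩
        · rintro ⟨c, hc1, hc2⟩
          have := hL.lay_eq (b := ⟨b, hb⟩) (c := c) (by rw [hc1]; exact hb2')
            (by simp only; omega) hb1' (by omega)
          simp only at this
          omega
    · have hfree : ∀ i, 1 ≤ i → a ∉ (layoutOf m₀).part p q i := by
        intro i hi ha
        obtain ⟨b, hb3, hb4⟩ := (Layout.mem_part (by omega)).1 ha
        have hb5 : m₀.arr 5 b = i := hb4
        exact hb1 b b.isLt (by omega) hb3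
      rcases h₂ (a + 1) with ⟨b, hb, -, hb3, hb4⟩ | ⟨hb3, hb4⟩
      · refine ⟨0, Nat.zero_le _, hb2.trans hb4, fun i => ⟨fun h => by omega, fun ha => ?_⟩⟩
        rcases Nat.eq_zero_or_pos i with rfl | hi
        · exact absurd hb3 (Layout.mem_part_zero.1 ha ⟨b, hb⟩)
        · exact absurd ha (hfree i hi)
      · have h1 : m₁.arr 8 (a + 1) = 1 := by
          rcases h₁ (a + 1) with ⟨i, -, -, -, hi⟩ | ⟨hi, -⟩
          · exact hi
          · exact absurd rfl (hi a a.isLt trivial)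
        refine ⟨1, by omega, by rw [hb2, hb4, h1], fun i => ?_⟩
        rcases Nat.eq_zero_or_pos i with rfl | hi
        · rw [Layout.mem_part_zero]
          exact ⟨fun _ b hb => hb3 b b.isLt trivial hb, fun _ => rfl⟩
        · exact ⟨fun h => by omega, fun ha => absurd ha (hfree i hi)⟩
  refine ⟨fun a i => ?_, fun a => ?_, by simp⟩
  · obtain ⟨j, -, h1, h2⟩ := hal a
    simp only [Memory.setEntry_arr, if_pos, Function.update_of_ne (Nat.succ_ne_zero _), h1]
    exact h2 i
  · obtain ⟨j, h0, h1, -⟩ := hal a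
    simp only [Memory.setEntry_arr, if_pos, Function.update_of_ne (Nat.succ_ne_zero _), h1]
    exact h0

lemma reach_isTouched (e : Env p q m₀) (hU : p + q + 3 ≤ U) (hW : p + q + 2 ≤ W) :
    Reach W π U (clearLoop 9 ;; touchLoop) m₀ fun m =>
      SameBut 9 m m₀ ∧ IsTouched q (layoutOf m₀) (m.arr 9) := by
  refine (reach_clear e hU hW 9).then fun m₁ ⟨s₁, h₁⟩ => ?_
  refine (reach_touch (s₁.env e) hU hW).mono fun m₂ ⟨s₂, h₂⟩ => ⟨s₂.trans s₁, fun x => ?_⟩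
  simp only [s₁.2, ne_eq, Nat.reduceEqDiff, not_false_eq_true] at h₂
  rcases h₂ x with ⟨b, hb, ⟨hb1, hb2⟩, hb3, hb4⟩ | ⟨hb, hb'⟩
  · rw [hb4]
    exact ⟨fun h => absurd h one_ne_zero, fun h => absurd (h ⟨b, hb⟩ hb1 hb3) hb2⟩
  · rw [hb', h₁ x (by omega)]
    refine ⟨fun _ b hb1 hb2 => ?_, fun _ => rfl⟩
    by_contra hb3
    exact hb b b.isLt ⟨hb1, hb3⟩ hb2

/-- Compute the auxiliary arrays and registers. -/
def deriveProg : Prog :=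
  levelsProg ;; (clearLoop 9 ;; touchLoop) ;; clearLoop 10 ;; countLoop ;; clearLoop 11 ;;
    addableLoop ;; clearLoop 12 ;; edgesLoop ;; .load 11 10 5

lemma reach_derive (e : Env p q m₀) (hU : p + q + 3 ≤ U) (hW : 16 * (p + q) + 2 ≤ W)
    (hL : (layoutOf m₀).Inv H D) (hq : (layoutOf m₀).depth ≤ q) :
    Reach W π U deriveProg m₀ fun m =>
      Env p q m ∧ layoutOf m = layoutOf m₀ ∧ Derived p q m := by
  have hW' : p + q + 2 ≤ W := by omega
  have hlay : ∀ b < q, m₀.arr 5 b ≤ q := fun b hb => (hL.lay_le ⟨b, hb⟩).trans hq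
  refine (reach_levels e hU hW' hL hq).then fun m₁ ⟨s₁, h₁⟩ => ?_
  have e₁ := s₁.env e
  refine (reach_isTouched e₁ hU hW').then fun m₂ ⟨s₂, h₂⟩ => ?_
  have e₂ := s₂.env e₁
  refine (reach_clear e₂ hU hW' 10).then fun m₃ ⟨s₃, h₃⟩ => ?_
  have e₃ := s₃.env e₂
  refine (reach_count e₃ hU hW' ?_).then fun m₄ ⟨s₄, h₄⟩ => ?_
  · intro a ha
    have := h₁.le ⟨a, ha⟩
    simp only [s₃.2, s₂.2, ne_eq, Nat.reduceEqDiff, not_false_eq_true]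
    exact h₃ _ (by simp only at this; omega)
  have e₄ := s₄.env e₃
  refine (reach_clear e₄ hU hW' 11).then fun m₅ ⟨s₅, h₅⟩ => ?_
  have e₅ := s₅.env e₄
  refine (reach_addable e₅ hU hW ?_).then fun m₆ ⟨s₆, h₆⟩ => ?_
  · intro b hb
    have := hlay b hb
    simp only [s₅.2, s₄.2, s₃.2, s₂.2, s₁.2, ne_eq, Nat.reduceEqDiff,
      not_false_eq_true]
    exact h₅ _ (by omega)
  have e₆ := s₆.env e₅
  refine (reach_clear e₆ hU hW' 12).then fun m₇ ⟨s₇, h₇⟩ => ?_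
  have e₇ := s₇.env e₆
  refine (reach_edges e₇ hU hW' ?_).then fun m₈ ⟨s₈, h₈⟩ => ?_
  · intro b hb
    have := hlay b hb
    simp only [s₇.2, s₆.2, s₅.2, s₄.2, s₃.2, s₂.2, s₁.2, ne_eq,
      Nat.reduceEqDiff, not_false_eq_true]
    exact h₇ _ (by omega)
  have e₈ := s₈.env e₇
  refine Reach.of_wp (by omega) ?_
  simp only [s₇.2, s₆.2, s₅.2, s₄.2, s₃.2, s₂.2, s₁.2, ne_eq,
      Nat.reduceEqDiff, not_false_eq_true] at h₂ h₄ h₆ h₈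
  have l₁ : layoutOf m₁ = layoutOf m₀ := s₁.layoutOf (by decide) (by decide) (by decide) (by decide)
  have l₈ : layoutOf m₈ = layoutOf m₀ := by
    rw [s₈.layoutOf (by decide) (by decide) (by decide) (by decide),
      s₇.layoutOf (by decide) (by decide) (by decide) (by decide),
      s₆.layoutOf (by decide) (by decide) (by decide) (by decide),
      s₅.layoutOf (by decide) (by decide) (by decide) (by decide),
      s₄.layoutOf (by decide) (by decide) (by decide) (by decide),
      s₃.layoutOf (by decide) (by decide) (by decide) (by decide),
      s₂.layoutOf (by decide) (by decide) (by decide) (by decide), l₁]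
  have hl : layoutOf (m₈.setReg 11 (m₈.arr 10 (m₈.reg 5))) = layoutOf m₀ := by
    rw [← l₈]
    simp [layoutOf]
  rw [l₁] at h₂
  have hcount : ∀ j < p + q + 1, m₈.arr 10 (j + 1) = ((layoutOf m₀).part p q j).card := by
    intro j hj
    have h9 : m₈.arr 10 (j + 1) = m₄.arr 10 (j + 1) := by
      simp only [s₈.2, s₇.2, s₆.2, s₅.2, ne_eq, Nat.reduceEqDiff,
        not_false_eq_true]
    rw [h9, h₄, h₃ _ (by omega), zero_add,
      Finset.sum_range (fun a => if m₁.arr 8 (a + 1) = j + 1 then 1 else 0), ← Finset.card_filter]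
    congr 1
    ext a
    simp only [Finset.mem_filter, Finset.mem_univ, true_and]
    exact h₁.iff a j
  have haddable : ∀ j, j < p + q + 2 → m₈.arr 11 j = ∑ b : Fin q, if m₀.arr 5 b = j then
      (if m₀.arr 5 b ≠ 0 ∧ m₀.arr 6 b = b ∧ m₂.arr 9 b = 0 then 16 else 0) else 0 := by
    intro j hj
    have h9 : m₈.arr 11 j = m₆.arr 11 j := by
      simp only [s₈.2, s₇.2, ne_eq, Nat.reduceEqDiff, not_false_eq_true]
    rw [h9, h₆, h₅ _ hj, zero_add]
    exact Finset.sum_range (fun b => if m₀.arr 5 b = j then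
      (if m₀.arr 5 b ≠ 0 ∧ m₀.arr 6 b = b ∧ m₂.arr 9 b = 0 then 16 else 0) else 0)
  refine ⟨?_, hl, ?_⟩
  · constructor <;> simp [e₈.r0, e₈.r1, e₈.r5, e₈.r6, e₈.r7, e₈.r8, e₈.r10]
  refine ⟨?_, ?_, ?_, ?_, ?_, ?_, ?_⟩ <;> (try rw [hl]) <;> (try rw [Memory.setReg_arr])
  · simpa only [s₈.2, s₇.2, s₆.2, s₅.2, s₄.2, s₃.2, s₂.2, ne_eq,
      Nat.reduceEqDiff, not_false_eq_true] using h₁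
  · simpa only [s₈.2, s₇.2, s₆.2, s₅.2, s₄.2, s₃.2, ne_eq,
      Nat.reduceEqDiff, not_false_eq_true] using h₂
  · exact hcount
  · rw [haddable 0 (by omega)]
    refine Finset.sum_eq_zero fun b _ => ?_
    split_ifs with h9 h10
    · exact absurd h9 h10.1
    · rfl
    · rfl
  · intro j hj1 hj2
    rw [haddable j (by omega)]
    have h9 : (layoutOf m₀).addable q j = Finset.univ.filter fun b : Fin q =>
        m₀.arr 5 b = j ∧ m₀.arr 6 b = b ∧ m₂.arr 9 b = 0 := by
      ext b
      rw [Layout.mem_addable, Finset.mem_filter, h₂ b, and_assoc]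
      simp only [Finset.mem_univ, true_and]
      rfl
    rw [h9, Finset.card_filter, Finset.mul_sum]
    refine Finset.sum_congr rfl fun b _ => ?_
    split_ifs <;> first | rfl | omega
  · intro j hj1 hj2
    rw [h₈, h₇ _ (by omega), zero_add, Finset.sum_range (fun b => if m₀.arr 5 b = j then
      (if m₀.arr 6 b = b then 1 else 0) else 0), Layout.edgesAt, Finset.card_filter]
    refine Finset.sum_congr rfl fun b _ => ?_
    by_cases h9 : m₀.arr 5 b = j <;> by_cases h10 : m₀.arr 6 b = b <;> simp [layoutOf, h9, h10]
  · rw [← hcount 0 (by omega), Memory.setReg_reg, if_pos rfl, e₈.r5]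

end Derive

/-! ### Changing the layers -/

section Step

variable {p q W U D T : ℕ} {π : Procedure} {m₀ : Memory} {H : BipartiteHypergraph (Fin p) (Fin q)}

/-- Call the procedure and add its answer as a new layer. -/
def appendProg : Prog :=
  activeLoop ;; forbiddenLoop ;; .call ;; representLoop ;; newRepLoop ;; newOwnLoop ;;
    .plus 9 9 5 ;; newLayLoop

lemma encodesState_of_levels {m : Memory} {L : Layout} {al : ℕ → ℕ} (hL : L.Inv H D)
    (hal : IsLevels p q L al)
    (h0 : ∀ a : Fin p, m.arr 0 a = if al (a + 1) = 0 then 0 else 1)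
    (h1 : ∀ b : Fin q, m.arr 1 b = if L.lay b = 0 ∧ al (L.mat b) = 0 then 0 else 1)
    (h2 : m.arr 2 = L.mat) : EncodesState m (L.state p q) := by
  have hact : ∀ a : Fin p, a ∈ L.active p q ↔ al (a + 1) ≠ 0 := by
    intro a
    rw [Layout.mem_active]
    constructor
    · rintro ⟨j, -, hj⟩
      have := (hal.iff a j).2 hj
      omega
    · intro h
      have h3 := hal.le a
      exact ⟨al (a + 1) - 1, by omega, (hal.iff a _).1 (by omega)⟩
  have hforb : ∀ b : Fin q, b ∈ L.forbidden q ↔ ¬ (L.lay b = 0 ∧ al (L.mat b) = 0) := by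
    intro b
    rw [Layout.mem_forbidden, not_and_or]
    refine or_congr_right ?_
    constructor
    · rintro ⟨hb, c, hc1, hc2⟩ h
      obtain ⟨a, ha⟩ := hL.exists_mat b hb
      have := (hal.iff a (L.lay c)).2 ((Layout.mem_part hc2).2 ⟨c, hc1.trans ha, rfl⟩)
      rw [ha] at h
      omega
    · intro h
      have hb : L.mat b ≠ 0 := by
        intro hb
        rw [hb] at h
        exact h hal.zero
      obtain ⟨a, ha⟩ := hL.exists_mat b hb
      rw [ha] at h
      have ha' := (hal.iff a (al (a + 1) - 1)).1 (by omega)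
      refine ⟨hb, ?_⟩
      rcases Nat.eq_zero_or_pos (al (a + 1) - 1) with h3 | h3
      · rw [h3] at ha'
        exact absurd ha (Layout.mem_part_zero.1 ha' b)
      · obtain ⟨c, hc1, hc2⟩ := (Layout.mem_part h3.ne').1 ha'
        exact ⟨c, hc1.trans ha.symm, by omega⟩
  refine ⟨fun a => ?_, fun b => ?_, ?_⟩
  · rw [h0]
    change _ = if a ∈ L.active p q then 1 else 0
    by_cases h : al (a + 1) = 0
    · rw [if_pos h, if_neg (fun h' => (hact a).1 h' h)]
    · rw [if_neg h, if_pos ((hact a).2 h)]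
  · rw [h1]
    change _ = if b ∈ L.forbidden q then 1 else 0
    by_cases h : L.lay b = 0 ∧ al (L.mat b) = 0
    · rw [if_pos h, if_neg (fun h' => (hforb b).1 h' h)]
    · rw [if_neg h, if_pos ((hforb b).2 h)]
  · rw [h2]
    exact hL.encodes

lemma reach_append {r : ℕ} {φ d : ℝ} (hr : 1 ≤ r) (hH : H.IsBounded r) (hφ : H.StrongHaxell φ)
    (hd : 4 ≤ d) (hdφ : d * (r : ℝ) ^ 2 ≤ φ) (hD : D = ⌊d⌋₊)
    (hπ : π.FindsMaximalHalfLayers H d T)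
    (e : Env p q m₀) (hU : p + q + T + 3 ≤ U) (hW : p + q + 2 ≤ W)
    (hL : (layoutOf m₀).Inv H D) (hq : (layoutOf m₀).depth ≤ q)
    (hal : IsLevels p q (layoutOf m₀) (m₀.arr 8))
    (h0 : ((layoutOf m₀).part p q 0).Nonempty)
    (hst : 1 ≤ (layoutOf m₀).depth → 16 * ((layoutOf m₀).addable q (layoutOf m₀).depth).card ≤
      ((layoutOf m₀).edgesAt q (layoutOf m₀).depth).card) :
    Reach W π U appendProg m₀ fun m => Env p q m ∧ (layoutOf m).Inv H D ∧
      (layoutOf m).depth ≤ q ∧ (layoutOf m).depth = (layoutOf m₀).depth + 1 ∧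
      ∀ j ≤ (layoutOf m₀).depth, (layoutOf m).part p q j = (layoutOf m₀).part p q j := by
  have hU' : p + q + 3 ≤ U := by omega
  refine (reach_active e hU' hW).then fun m₁ ⟨s₁, h₁⟩ => ?_
  have e₁ := s₁.env e
  refine (reach_forbidden e₁ hU' hW).then fun m₂ ⟨s₂, h₂⟩ => ?_
  have e₂ := s₂.env e₁
  simp only [s₁.2, ne_eq, Nat.reduceEqDiff, not_false_eq_true] at h₂
  have hstate : EncodesState m₂ ((layoutOf m₀).state p q) := by
    refine encodesState_of_levels hL hal (fun a => ?_) (fun b => ?_) ?_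
    · rw [s₂.2 0 (by norm_num), (h₁.eq_of_id a).1 a.isLt trivial]
    · exact (h₂.eq_of_id b).1 b.isLt trivial
    · rw [s₂.2 2 (by norm_num), s₁.2 2 (by norm_num), layoutOf]
  refine (Reach.call (T := T) (Q := fun m => ∃ (R : Answer) (Z : Finset (Edge (Fin p) (Fin q))),
      IsMaximalHalfLayer H ((layoutOf m₀).state p q) d Z ∧ R.Encodes Z ∧ m.arr 3 = R.owner ∧
      m.arr 4 = R.label ∧ (∀ x, x ≠ 3 → m.reg x = m₂.reg x) ∧
      ∀ l, l ≠ 3 → l ≠ 4 → m.arr l = m₂.arr l) (by omega)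
    (fun c => (hπ c m₂ ((layoutOf m₀).state p q) hL.isMatching hstate).2) fun c => ?_).then ?_
  · obtain ⟨Z, hZ1, hZ2⟩ := (hπ c m₂ ((layoutOf m₀).state p q) hL.isMatching hstate).1
    refine ⟨_, Z, hZ1, hZ2, ?_, ?_, fun x hx => ?_, fun l hl hl' => ?_⟩
    · simp [Config.afterCall]
    · simp [Config.afterCall]
    · simp [Config.afterCall, hx]
    · simp [Config.afterCall, hl, hl']
  rintro m₃ ⟨R, Z, hZ, hR, hR3, hR4, hreg, harr⟩
  have e₃ : Env p q m₃ := by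
    constructor <;> rw [hreg _ (by norm_num)]
    exacts [e₂.r0, e₂.r1, e₂.r5, e₂.r6, e₂.r7, e₂.r8, e₂.r10]
  have hown : ∀ b < q, R.label b ≠ 0 → R.owner (R.label b - 1) < p := by
    intro b hb hb0
    obtain ⟨f, -, -, hf, hf'⟩ := hR
    have h3 := (hf' ⟨b, hb⟩).1
    simp only at h3
    have h4 := hf ⟨R.label b - 1, by omega⟩
    simp only at h4
    rw [h4]
    exact Fin.isLt _
  refine (reach_represent e₃ hU' hW).then fun m₄ ⟨s₄, h₄⟩ => ?_
  have e₄ := s₄.env e₃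
  refine (reach_newRep e₄ hU' hW).then fun m₅ ⟨s₅, h₅⟩ => ?_
  have e₅ := s₅.env e₄
  simp only [s₄.2, ne_eq, Nat.reduceEqDiff, not_false_eq_true, hR4] at h₄ h₅
  refine (reach_newOwn e₅ hU' hW ?_).then fun m₆ ⟨s₆, h₆⟩ => ?_
  · simpa only [s₅.2, s₄.2, ne_eq, Nat.reduceEqDiff, not_false_eq_true, hR3, hR4] using hown
  have e₆ := s₆.env e₅
  simp only [s₅.2, s₄.2, ne_eq, Nat.reduceEqDiff, not_false_eq_true, hR3, hR4] at h₆
  have h9 : m₆.reg 9 = (layoutOf m₀).depth := by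
    rw [s₆.1 9 (by norm_num), s₅.1 9 (by norm_num), s₄.1 9 (by norm_num), hreg 9 (by norm_num),
      s₂.1 9 (by norm_num), s₁.1 9 (by norm_num), layoutOf]
  refine (Reach.of_wp (Q := fun m => m = m₆.setReg 9 ((layoutOf m₀).depth + 1)) (by omega)
    ?_).then ?_
  · simp only [Prog.wp, h9, e₆.r5, and_true]
    omega
  rintro _ rfl
  have e₇ : Env p q (m₆.setReg 9 ((layoutOf m₀).depth + 1)) := by
    constructor <;> simp [e₆.r0, e₆.r1, e₆.r5, e₆.r6, e₆.r7, e₆.r8, e₆.r10]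
  refine (reach_newLay e₇ hU' hW).mono fun m₈ ⟨s₈, h₈⟩ => ?_
  simp only [Memory.setReg_arr, Memory.setReg_reg, if_pos, s₆.2, s₅.2, s₄.2, s₂.2, s₁.2, harr,
    ne_eq, Nat.reduceEqDiff, not_false_eq_true, hR4, OfNat.ofNat_ne_zero, OfNat.ofNat_ne_one]
    at h₅ h₆ h₈
  have hcore := hL.append hr hH hφ hd hdφ hD hst hZ hR (t := m₄.arr 15) (fun b hb => ?_)
    (L' := layoutOf m₈) ?_ ?_ ?_ ?_ ?_
  · have hdepth : (layoutOf m₈).depth = (layoutOf m₀).depth + 1 := by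
      simp [layoutOf, s₈.1]
    have hD1 : 1 ≤ D := by
      rw [hD]
      exact Nat.le_floor (by push_cast; linarith)
    refine ⟨s₈.env e₇, hcore.1, hcore.1.depth_le hD1 ?_, hdepth, hcore.2⟩
    rw [hcore.2 0 (Nat.zero_le _)]
    exact h0
  · rcases h₄ (R.label b) with ⟨c, hc, -, hc1, hc2⟩ | ⟨hc, -⟩
    · exact ⟨⟨c, hc⟩, hc2, hc1⟩
    · exact absurd rfl (hc b b.isLt trivial)
  · simp [layoutOf, s₈.1]
  · intro b
    simp [layoutOf, s₈.2, s₆.2, s₅.2, s₄.2, harr, s₂.2, s₁.2]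
  · intro b
    have h3 : (layoutOf m₈).lay b = m₈.arr 5 b := rfl
    rw [h3]
    split_ifs with hb
    · exact (h₈.eq_of_id b).2 (Or.inr (not_not.2 hb))
    · exact (h₈.eq_of_id b).1 b.isLt hb
  · intro b
    have h3 : (layoutOf m₈).rep b = m₅.arr 6 b := by
      simp [layoutOf, s₈.2, s₆.2]
    rw [h3]
    split_ifs with hb
    · exact (h₅.eq_of_id b).2 (Or.inr (not_not.2 hb))
    · exact (h₅.eq_of_id b).1 b.isLt hb
  · intro b
    have h3 : (layoutOf m₈).own b = m₆.arr 7 b := by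
      simp [layoutOf, s₈.2]
    rw [h3]
    split_ifs with hb
    · exact (h₆.eq_of_id b).2 (Or.inr (not_not.2 hb))
    · exact (h₆.eq_of_id b).1 b.isLt hb

/-- The entry `pk (a + 1)` is `e + 1` for some edge `e` of the last layer at `a` that touches no
edge of the matching, and `0` if there is none. -/
def IsPicked (p q : ℕ) (L : Layout) (pk : ℕ → ℕ) : Prop :=
  ∀ a : Fin p, (∃ e ∈ L.addable q L.depth, L.own e = a + 1 ∧ pk (a + 1) = e + 1) ∨
    ((∀ e ∈ L.addable q L.depth, L.own e ≠ a + 1) ∧ pk (a + 1) = 0)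

/-- Choose edges of the last layer and a level. -/
def chooseProg : Prog :=
  clearLoop 13 ;; pickLoop ;; clearLoop 14 ;; pickedLoop ;; searchLoop ;; .load 12 16 6

lemma reach_choose (e : Env p q m₀) (hU : p + q + 3 ≤ U) (hW : 48 * (p + q) + 2 ≤ W)
    (hL : (layoutOf m₀).Inv H D) (hq : (layoutOf m₀).depth ≤ q)
    (hder : Derived p q m₀) (hk : 1 ≤ (layoutOf m₀).depth)
    (hun : ((layoutOf m₀).edgesAt q (layoutOf m₀).depth).card <
      16 * ((layoutOf m₀).addable q (layoutOf m₀).depth).card) :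
    Reach W π U chooseProg m₀ fun m => Env p q m ∧ layoutOf m = layoutOf m₀ ∧
      m.arr 8 = m₀.arr 8 ∧ IsPicked p q (layoutOf m₀) (m.arr 13) ∧
      ∃ j < (layoutOf m₀).depth, m.reg 12 = j + 1 ∧ ((layoutOf m₀).part p q j).card <
        48 * ((layoutOf m₀).part p q j ∩
          Finset.univ.filter fun a : Fin p => m.arr 13 (a + 1) ≠ 0).card := by
  have hW' : p + q + 2 ≤ W := by omega
  set L := layoutOf m₀ with hLdef
  refine (reach_clear e hU hW' 13).then fun m₁ ⟨s₁, h₁⟩ => ?_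
  have e₁ := s₁.env e
  refine (reach_pick e₁ hU hW').then fun m₂ ⟨s₂, h₂⟩ => ?_
  have e₂ := s₂.env e₁
  refine (reach_clear e₂ hU hW' 14).then fun m₃ ⟨s₃, h₃⟩ => ?_
  have e₃ := s₃.env e₂
  refine (reach_picked e₃ hU hW ?_).then fun m₄ ⟨s₄, h₄⟩ => ?_
  · intro a ha
    have := hder.levels.le ⟨a, ha⟩
    rw [← hLdef] at this
    simp only [s₃.2, s₂.2, s₁.2, ne_eq, Nat.reduceEqDiff, not_false_eq_true]
    exact h₃ _ (by simp only at this; omega)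
  have e₄ := s₄.env e₃
  refine (reach_search e₄ hU hW').then fun m₅ ⟨s₅, h₅⟩ => ?_
  have e₅ := s₅.env e₄
  refine Reach.of_wp (by omega) ?_
  simp only [s₁.1, s₁.2, s₂.2, s₃.2, s₄.2, ne_eq, Nat.reduceEqDiff, Nat.reduceLT,
    not_false_eq_true] at h₂ h₄ h₅
  simp only [Prog.wp, e₅.r6]
  set pk := m₂.arr 13 with hpk
  have l₅ : layoutOf m₅ = L := by
    rw [s₅.layoutOf (by decide) (by decide) (by decide) (by decide),
      s₄.layoutOf (by decide) (by decide) (by decide) (by decide),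
      s₃.layoutOf (by decide) (by decide) (by decide) (by decide),
      s₂.layoutOf (by decide) (by decide) (by decide) (by decide),
      s₁.layoutOf (by decide) (by decide) (by decide) (by decide)]
  have hmem : ∀ b : Fin q, b ∈ L.addable q L.depth ↔
      m₀.arr 5 b = m₀.reg 9 ∧ m₀.arr 6 b = b ∧ m₀.arr 9 b = 0 := by
    intro b
    rw [Layout.mem_addable, hder.touched b, and_assoc]
    rfl
  have hpick : IsPicked p q L pk := by
    intro a
    rcases h₂ (a + 1) with ⟨b, hb, hb1, hb2, hb3⟩ | ⟨hb1, hb2⟩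
    · exact Or.inl ⟨⟨b, hb⟩, (hmem ⟨b, hb⟩).2 hb1, hb2, hb3⟩
    · refine Or.inr ⟨fun b hb => hb1 b b.isLt ((hmem b).1 hb), ?_⟩
      rw [hb2]
      exact h₁ _ (by omega)
  set P : Finset (Fin p) := Finset.univ.filter fun a => pk (a + 1) ≠ 0 with hPdef
  have hP : ∀ a, a ∈ P ↔ ∃ b ∈ L.addable q L.depth, L.own b = a + 1 := by
    intro a
    rw [hPdef, Finset.mem_filter]
    rcases hpick a with ⟨b, hb1, hb2, hb3⟩ | ⟨hb1, hb2⟩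
    · exact ⟨fun _ => ⟨b, hb1, hb2⟩, fun _ => ⟨Finset.mem_univ _, by omega⟩⟩
    · refine ⟨fun h => absurd hb2 h.2, ?_⟩
      rintro ⟨b, hb3, hb4⟩
      exact absurd hb4 (hb1 b hb3)
  have hPlevel : ∀ a ∈ P, ∃ i < L.depth, a ∈ L.part p q i := by
    intro a ha
    obtain ⟨b, hb1, hb2⟩ := (hP a).1 ha
    have hb3 := (Layout.mem_addable.1 hb1).1
    obtain ⟨a', ha', -, i, hi, hai⟩ := hL.lay_mem b (by omega) hb3.2
    have : a' = a := Fin.ext (by omega)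
    subst this
    exact ⟨i, by omega, hai⟩
  have h14 : ∀ x < p + q + 2, m₄.arr 14 x =
      48 * (Finset.univ.filter fun a : Fin p => m₀.arr 8 (a + 1) = x ∧ pk (a + 1) ≠ 0).card := by
    intro x hx
    rw [h₄, h₃ x hx, zero_add, Finset.sum_range (fun a => if m₀.arr 8 (a + 1) = x then
      (if pk (a + 1) = 0 then 0 else 48) else 0), Finset.card_filter, Finset.mul_sum]
    refine Finset.sum_congr rfl fun a _ => ?_
    by_cases h6 : m₀.arr 8 (a + 1) = x <;> by_cases h7 : pk (a + 1) = 0 <;> simp [h6, h7]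
  have h14' : ∀ j < p + q + 1, m₄.arr 14 (j + 1) = 48 * (L.part p q j ∩ P).card := by
    intro j hj
    rw [h14 _ (by omega)]
    congr 2
    ext a
    simp only [Finset.mem_filter, Finset.mem_univ, true_and, Finset.mem_inter, hPdef]
    rw [hder.levels.iff a j]
  have hsearch : ∃ x < p + q + 2, m₀.arr 10 x < m₄.arr 14 x ∧ m₅.arr 16 0 = x := by
    rcases h₅ 0 with ⟨x, hx, hx1, -, hx2⟩ | ⟨hx, -⟩
    · exact ⟨x, hx, hx1, hx2⟩
    · obtain ⟨j, hj1, hj2⟩ := hL.exists_level hk hun hP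
      refine absurd rfl (hx (j + 1) (by omega) ?_)
      change m₀.arr 10 (j + 1) < m₄.arr 14 (j + 1)
      rw [hder.count j (by omega), h14' j (by omega)]
      exact hj2
  obtain ⟨x, hx, hx1, hx2⟩ := hsearch
  have hx0 : x ≠ 0 := by
    rintro rfl
    rw [h14 0 (by omega)] at hx1
    obtain ⟨a, ha⟩ := Finset.card_pos.1 (by omega :
      0 < (Finset.univ.filter fun a : Fin p => m₀.arr 8 (a + 1) = 0 ∧ pk (a + 1) ≠ 0).card)
    rw [Finset.mem_filter] at ha
    obtain ⟨i, -, hi⟩ := hPlevel a (Finset.mem_filter.2 ⟨Finset.mem_univ _, ha.2.2⟩)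
    have := (hder.levels.iff a i).2 hi
    omega
  obtain ⟨j, rfl⟩ := Nat.exists_eq_succ_of_ne_zero hx0
  rw [Nat.succ_eq_add_one] at hx hx1 hx2
  rw [hder.count j (by omega), h14' j (by omega)] at hx1
  have hj : j < L.depth := by
    obtain ⟨a, ha⟩ := Finset.card_pos.1 (by omega : 0 < (L.part p q j ∩ P).card)
    rw [Finset.mem_inter] at ha
    obtain ⟨i, hi, hai⟩ := hPlevel a ha.2
    by_contra hjd
    exact Finset.disjoint_left.1 (hL.disjoint_part (by omega : i ≠ j)) hai ha.1
  have h13 : m₅.arr 13 = pk := by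
    simp only [s₅.2, s₄.2, s₃.2, ne_eq, Nat.reduceEqDiff, not_false_eq_true, hpk]
  refine ⟨?_, ?_, ?_, ?_, j, hj, ?_, ?_⟩
  · constructor <;> simp [e₅.r0, e₅.r1, e₅.r5, e₅.r6, e₅.r7, e₅.r8, e₅.r10]
  · rw [← l₅]
    simp [layoutOf]
  · simp only [Memory.setReg_arr, s₅.2, s₄.2, s₃.2, s₂.2, s₁.2, ne_eq, Nat.reduceEqDiff,
      not_false_eq_true]
  · rwa [Memory.setReg_arr, h13]
  · rw [Memory.setReg_reg, if_pos rfl, hx2]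
  · rwa [Memory.setReg_arr, h13]

/-- Swap edges of the last layer into the matching, and delete the layers after the level where this
happens. -/
def collapseProg : Prog :=
  chooseProg ;; removeLoop ;; insertLoop ;; truncateLoop ;; .minus 9 12 5

lemma reach_collapse (e : Env p q m₀) (hU : p + q + 3 ≤ U) (hW : 48 * (p + q) + 2 ≤ W)
    (hL : (layoutOf m₀).Inv H D) (hq : (layoutOf m₀).depth ≤ q)
    (hder : Derived p q m₀) (hk : 1 ≤ (layoutOf m₀).depth)
    (hun : ((layoutOf m₀).edgesAt q (layoutOf m₀).depth).card <
      16 * ((layoutOf m₀).addable q (layoutOf m₀).depth).card) :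
    Reach W π U collapseProg m₀ fun m => Env p q m ∧ (layoutOf m).Inv H D ∧
      (layoutOf m).depth < (layoutOf m₀).depth ∧
      (∀ i < (layoutOf m).depth, (layoutOf m).part p q i = (layoutOf m₀).part p q i) ∧
      48 * ((layoutOf m).part p q (layoutOf m).depth).card ≤
        47 * ((layoutOf m₀).part p q (layoutOf m).depth).card := by
  have hW' : p + q + 2 ≤ W := by omega
  refine (reach_choose e hU hW hL hq hder hk hun).then ?_
  rintro m₁ ⟨e₁, l₁, h8, hpk, j, hj, h12, hcard⟩
  have hal := hder.levels
  rw [← h8] at hal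
  rw [← l₁] at hL hpk hcard hj hal ⊢
  refine (reach_remove e₁ hU hW').then fun m₂ ⟨s₂, h₂⟩ => ?_
  have e₂ := s₂.env e₁
  refine (reach_insert e₂ hU hW' ?_).then fun m₃ ⟨s₃, h₃⟩ => ?_
  · simp only [s₂.2, ne_eq, Nat.reduceEqDiff, not_false_eq_true]
    intro b hb hb0
    obtain ⟨c, hc, -⟩ := hL.rep_spec ⟨b, hb⟩ hb0
    exact lt_of_eq_of_lt hc c.isLt
  have e₃ := s₃.env e₂
  refine (reach_truncate e₃ hU hW').then fun m₄ ⟨s₄, h₄⟩ => ?_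
  have e₄ := s₄.env e₃
  refine Reach.of_wp (by omega) ?_
  have r12 : m₄.reg 12 = j + 1 := by
    rw [s₄.1 12 (by norm_num), s₃.1 12 (by norm_num), s₂.1 12 (by norm_num), h12]
  simp only [Prog.wp, e₄.r5, r12, Nat.add_sub_cancel]
  simp only [s₂.1, s₂.2, s₃.1, s₃.2, ne_eq, Nat.reduceEqDiff, Nat.reduceLT, not_false_eq_true,
    h12] at h₂ h₃ h₄
  set pk := m₁.arr 13 with hpkdef
  set al := m₁.arr 8 with haldef
  set L₁ := layoutOf m₁ with hL₁
  set P : Finset (Fin p) :=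
    L₁.part p q j ∩ Finset.univ.filter fun a : Fin p => pk (a + 1) ≠ 0 with hPdef
  have hmemP : ∀ a, a ∈ P ↔ al (a + 1) = j + 1 ∧ pk (a + 1) ≠ 0 := by
    intro a
    simp [hPdef, hal.iff a j]
  have hPne : P.Nonempty := Finset.card_pos.1 (by omega)
  have hsel : ∀ a ∈ P, ∃ b ∈ L₁.addable q L₁.depth, L₁.own b = a + 1 ∧ pk (a + 1) = b + 1 := by
    intro a ha
    rcases hpk a with h | ⟨-, h⟩
    · exact h
    · exact absurd h ((hmemP a).1 ha).2
  have : Nonempty (Fin q) := by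
    obtain ⟨a, ha⟩ := hPne
    obtain ⟨b, -⟩ := hsel a ha
    exact ⟨b⟩
  choose! sel hsel1 hsel2 hsel3 using hsel
  -- The condition under which the edge that contains `b` is inserted.
  have hins : ∀ b : Fin q, (L₁.lay b ≠ 0 ∧ pk (L₁.own b) = L₁.rep b + 1 ∧ al (L₁.own b) = j + 1) ↔
      ∃ a ∈ P, L₁.lay b ≠ 0 ∧ L₁.rep b = sel a ∧ L₁.own b = a + 1 := by
    intro b
    constructor
    · rintro ⟨h1, h2, h3⟩
      obtain ⟨c, hc1, hc2, hc3, hc4⟩ := hL.rep_spec b h1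
      obtain ⟨a, ha, -⟩ := hL.lay_mem c (by omega) hc2
      rw [← hc4, ha] at h2 h3
      have haP : a ∈ P := (hmemP a).2 ⟨h3, by omega⟩
      have := hsel3 a haP
      exact ⟨a, haP, h1, by omega, by omega⟩
    · rintro ⟨a, ha, h1, h2, h3⟩
      have h4 := hsel3 a ha
      rw [h3]
      exact ⟨h1, by omega, ((hmemP a).1 ha).1⟩
  have hown : ∀ b : Fin q, ∀ a ∈ P, L₁.lay b ≠ 0 → L₁.rep b = sel a → L₁.own b = a + 1 := by
    intro b a ha h1 h2
    obtain ⟨c, hc1, hc2, hc3, hc4⟩ := hL.rep_spec b h1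
    have : c = sel a := Fin.ext (by omega)
    subst this
    rw [← hc4]
    exact hsel2 a ha
  have hrem : ∀ b : Fin q, (pk (L₁.mat b) ≠ 0 ∧ al (L₁.mat b) = j + 1) ↔
      ∃ a ∈ P, L₁.mat b = a + 1 := by
    intro b
    constructor
    · rintro ⟨h1, h2⟩
      have h3 : L₁.mat b ≠ 0 := by
        intro h3
        rw [h3, hal.zero] at h2
        omega
      obtain ⟨a, ha⟩ := hL.exists_mat b h3
      rw [ha] at h1 h2
      exact ⟨a, (hmemP a).2 ⟨h2, h1⟩, ha⟩
    · rintro ⟨a, ha, h1⟩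
      rw [h1]
      exact ((hmemP a).1 ha).symm
  have hPsub : P ⊆ L₁.part p q j := Finset.inter_subset_left
  have hcore := hL.collapse hj (P := P) hPsub (sel := sel)
    (fun a ha => ⟨hsel1 a ha, hsel2 a ha⟩) (L' := layoutOf (m₄.setReg 9 j)) ?_ ?_ ?_ ?_ ?_ ?_ ?_
  · have hdepth : (layoutOf (m₄.setReg 9 j)).depth = j := by simp [layoutOf]
    rw [hdepth]
    refine ⟨?_, hcore.1, hj, hcore.2.1, ?_⟩
    · constructor <;> simp [e₄.r0, e₄.r1, e₄.r5, e₄.r6, e₄.r7, e₄.r8, e₄.r10]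
    · rw [hcore.2.2]
      have h1 := Finset.card_sdiff_add_card_eq_card hPsub
      omega
  · simp [layoutOf]
  · intro b
    have h1 : (layoutOf (m₄.setReg 9 j)).lay b = m₄.arr 5 b := rfl
    rw [h1]
    split_ifs with hb
    · exact (h₄.eq_of_id b).2 (Or.inr (not_not.2 (Nat.lt_succ_of_le hb)))
    · exact (h₄.eq_of_id b).1 b.isLt fun h => hb (Nat.le_of_lt_succ h)
  · intro b
    simp [layoutOf, s₄.2, s₃.2, s₂.2, hL₁]
  · intro b
    simp [layoutOf, s₄.2, s₃.2, s₂.2, hL₁]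
  all_goals
    have hm : (layoutOf (m₄.setReg 9 j)).mat = m₃.arr 2 := by simp [layoutOf, s₄.2]
    rw [hm]
    intro b
  · intro a ha h1 h2
    rw [← hown b a ha h1 h2]
    exact (h₃.eq_of_id b).1 b.isLt ((hins b).2 ⟨a, ha, h1, h2, hown b a ha h1 h2⟩)
  · intro a ha h1
    have h2 : m₃.arr 2 b = m₂.arr 2 b := by
      refine (h₃.eq_of_id b).2 (Or.inr fun h => ?_)
      obtain ⟨a', ha', h2, h3, -⟩ := (hins b).1 h
      have := (Layout.mem_addable.1 (hsel1 a' ha')).2 b h2 h3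
      omega
    rw [h2]
    exact (h₂.eq_of_id b).1 b.isLt ((hrem b).2 ⟨a, ha, h1⟩)
  · intro h1 h2
    have h3 : m₃.arr 2 b = m₂.arr 2 b := by
      refine (h₃.eq_of_id b).2 (Or.inr fun h => ?_)
      obtain ⟨a, ha, h3, h4, -⟩ := (hins b).1 h
      exact h1 a ha h3 h4
    rw [h3]
    refine (h₂.eq_of_id b).2 (Or.inr fun h => ?_)
    obtain ⟨a, ha, h4⟩ := (hrem b).1 h
    exact h2 a ha h4

end Step

/-! ### The number of iterations -/

/-- Whether only few edges of the last layer touch no edge of the matching. -/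
def Layout.IsStable (q : ℕ) (L : Layout) : Prop :=
  1 ≤ L.depth → 16 * (L.addable q L.depth).card ≤ (L.edgesAt q L.depth).card

open Classical in
/-- The potential of a layered structure. -/
noncomputable def Layout.pot (p q D : ℕ) (α κ : ℝ) (L : Layout) : ℝ :=
  potential ((p + q : ℕ) : ℝ) α κ (5 * (D : ℝ) / 16) (fun j => ((L.part p q j).card : ℝ)) L.depth
    (L.IsStable q)

section Iterations

variable {p q D : ℕ} {H : BipartiteHypergraph (Fin p) (Fin q)} {L L' : Layout}

/-- Sizes of the stable levels: none is empty, and each is larger than the previous one by a factor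
of at least `5 * D / 16`. -/
lemma Layout.Inv.card_growth (h : L.Inv H D) (hD : 4 ≤ D) (h0 : (L.part p q 0).Nonempty) {j : ℕ}
    (hj : j < L.depth ∨ (j = L.depth ∧ L.IsStable q)) :
    (1 : ℝ) ≤ (L.part p q j).card ∧
      ∀ i, i + 1 = j → 5 * (D : ℝ) / 16 * (L.part p q i).card ≤ (L.part p q j).card := by
  induction j with
  | zero => exact ⟨by exact_mod_cast h0.card_pos, fun i hi => by omega⟩
  | succ j ih =>
    have hle : j + 1 ≤ L.depth := by omega
    have h1 := h.card_part_ge_pred hle (by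
      rcases hj with hj | ⟨hj, hst⟩
      · exact h.stable (j + 1) (by omega) hj
      · rw [hj]
        exact hst (by omega))
    have h2 : (1 : ℝ) ≤ (L.part p q j).card := (ih (Or.inl hle)).1
    have h3 : 5 * (D : ℝ) * (L.part p q j).card ≤ 16 * (L.part p q (j + 1)).card := by
      exact_mod_cast h1
    have h4 : (4 : ℝ) ≤ D := by exact_mod_cast hD
    have h5 : 4 * 1 ≤ (D : ℝ) * (L.part p q j).card :=
      mul_le_mul h4 h2 zero_le_one (by positivity)
    refine ⟨by linarith, fun i hi => ?_⟩
    obtain rfl : i = j := by omega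
    linarith

variable {α κ : ℝ}

lemma Layout.Inv.pot_nonneg (h : L.Inv H D) (hD : 4 ≤ D) (h0 : (L.part p q 0).Nonempty)
    (hα : 0 ≤ α) (hκ : 0 < κ) : 0 ≤ L.pot p q D α κ := by
  classical
  have hD0 : 0 < D := by omega
  refine potential_nonneg (by positivity) hα hκ (by positivity) (fun i hi => ?_) (fun i hi => ?_)
    (fun hst => ?_) fun hst => ?_
  · exact (h.card_growth hD h0 (Or.inl hi)).1
  · exact (h.card_growth hD h0 (Or.inl hi)).2 i rfl
  · exact (h.card_growth hD h0 (Or.inr ⟨rfl, hst⟩)).1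
  · exact (h.card_growth hD h0 (Or.inr ⟨rfl, hst⟩)).2

lemma Layout.Inv.pot_append (h : L.Inv H D) (hD : 4 ≤ D) (h0 : (L.part p q 0).Nonempty)
    (hα : 0 < α) (hκ : 0 < κ) (hκ1 : κ ≤ 1) (hg : (5 * (D : ℝ) / 16) ^ (-α) ≤ κ / 2)
    (hst : L.IsStable q) (hdepth : L'.depth = L.depth + 1)
    (hpart : ∀ j ≤ L.depth, L'.part p q j = L.part p q j) :
    L'.pot p q D α κ + 1 ≤ L.pot p q D α κ := by
  classical
  have hD0 : 0 < D := by omega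
  have h1 : L.pot p q D α κ = potential ((p + q : ℕ) : ℝ) α κ (5 * (D : ℝ) / 16)
      (fun j => ((L.part p q j).card : ℝ)) L.depth True := by
    unfold Layout.pot
    congr 1
    exact eq_true hst
  rw [h1, Layout.pot, hdepth]
  refine potential_append (by positivity) hα hκ hκ1 (by positivity) hg
    (h.card_growth hD h0 (Or.inr ⟨rfl, hst⟩)).1 ?_ (fun i hi => by rw [hpart i hi])
    fun _ => by positivity
  have h2 : (L.part p q L.depth).card ≤ p := (Finset.card_le_univ _).trans (by simp)
  exact_mod_cast h2.trans (Nat.le_add_right p q)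

lemma Layout.Inv.pot_collapse (h : L.Inv H D) (h' : L'.Inv H D) (hD : 4 ≤ D)
    (h0 : (L.part p q 0).Nonempty) (h0' : (L'.part p q 0).Nonempty)
    (hα : 0 < α) (hκ : κ = 1 - (47 / 48 : ℝ) ^ α) (hst : ¬ L.IsStable q)
    (hdepth : L'.depth < L.depth)
    (hpart : ∀ i < L'.depth, L'.part p q i = L.part p q i)
    (hcard : 48 * (L'.part p q L'.depth).card ≤ 47 * (L.part p q L'.depth).card) :
    L'.pot p q D α κ + 1 ≤ L.pot p q D α κ := by
  classical
  have hD0 : 0 < D := by omega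
  have h1 : L.pot p q D α κ = potential ((p + q : ℕ) : ℝ) α κ (5 * (D : ℝ) / 16)
      (fun j => ((L.part p q j).card : ℝ)) L.depth False := by
    unfold Layout.pot
    congr 1
    exact eq_false hst
  rw [h1, Layout.pot]
  refine potential_collapse (η := 47 / 48) (by positivity) hα (by positivity) (by norm_num)
    (by norm_num) hκ hdepth (fun i hi => ?_) (fun i hi => ?_)
    (fun i hi => by rw [hpart i hi]) ?_ fun hst' => ?_
  · exact (h.card_growth hD h0 (Or.inl hi)).1
  · exact (h.card_growth hD h0 (Or.inl hi)).2 i rfl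
  · have h2 : 48 * ((L'.part p q L'.depth).card : ℝ) ≤ 47 * (L.part p q L'.depth).card := by
      exact_mod_cast hcard
    linarith
  · exact zero_lt_one.trans_le (h'.card_growth hD h0' (Or.inr ⟨rfl, hst'⟩)).1

end Iterations

/-! ### The program -/

/-- Add a layer if the last layer is stable, and swap edges of it into the matching otherwise. -/
def stepProg : Prog :=
  .ifLT 6 11
    ((.load 21 12 9 ;; .load 22 11 9) ;; (.ifLT 21 22 collapseProg appendProg) ;; .const 11 1) .skip

/-- One iteration; register `11` will be zero if all vertices are matched. -/
def bodyProg : Prog := deriveProg ;; stepProg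

/-- Store the constants. -/
def initProg : Prog :=
  .const 5 1 ;; .const 6 0 ;; .const 7 16 ;; .const 8 48 ;; .plus 10 0 1 ;; .plus 10 10 5 ;;
    .plus 10 10 5 ;; .const 11 1

/-- The program computing a perfect matching. -/
def mainProg : Prog := initProg ;; .whileLT 6 11 bodyProg

/-- The property of the memory that holds between the iterations. -/
structure Good {p q : ℕ} (H : BipartiteHypergraph (Fin p) (Fin q)) (D : ℕ) (m : Memory) : Prop where
  env : Env p q m
  inv : (layoutOf m).Inv H D
  depth_le : (layoutOf m).depth ≤ q

section Main

variable {p q W U D T : ℕ} {π : Procedure} {m₀ : Memory} {H : BipartiteHypergraph (Fin p) (Fin q)}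
variable {r : ℕ} {φ d α κ : ℝ}

/-- One iteration either finds that all vertices are matched or decreases the potential. -/
lemma reach_body (hr : 1 ≤ r) (hH : H.IsBounded r) (hφ : H.StrongHaxell φ)
    (hd : 4 ≤ d) (hdφ : d * (r : ℝ) ^ 2 ≤ φ) (hD : D = ⌊d⌋₊)
    (hπ : π.FindsMaximalHalfLayers H d T)
    (hα : 0 < α) (hκ : κ = 1 - (47 / 48 : ℝ) ^ α) (hg : (5 * (D : ℝ) / 16) ^ (-α) ≤ κ / 2)
    (hU : p + q + T + 3 ≤ U) (hW : 48 * (p + q) + 2 ≤ W) (h : Good H D m₀) :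
    Reach W π U bodyProg m₀ fun m => Good H D m ∧
      ((m.reg 11 = 0 ∧ (layoutOf m).part p q 0 = ∅) ∨
        (m.reg 11 = 1 ∧ ((layoutOf m₀).part p q 0).Nonempty ∧
          (((layoutOf m).part p q 0).Nonempty →
            (layoutOf m).pot p q D α κ + 1 ≤ (layoutOf m₀).pot p q D α κ))) := by
  have hD4 : 4 ≤ D := hD ▸ Nat.le_floor (by exact_mod_cast hd)
  have hW1 : 1 ≤ W := by omega
  have hκ0 : 0 < κ := by
    have := Real.rpow_lt_one (by norm_num) (by norm_num : (47 / 48 : ℝ) < 1) hα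
    linarith
  have hκ1 : κ ≤ 1 := by
    have : (0 : ℝ) ≤ (47 / 48 : ℝ) ^ α := by positivity
    linarith
  refine (reach_derive h.env (by omega) (by omega) h.inv h.depth_le).then ?_
  rintro m₁ ⟨e₁, l₁, hder⟩
  have hL := h.inv
  have hq := h.depth_le
  rw [← l₁] at hL hq ⊢
  clear h l₁
  refine Reach.ifLT (by omega) (fun hlt => ?_) (fun hlt => Reach.of_wp (by omega) ?_)
  · rw [e₁.r6, hder.flag] at hlt
    have h0 := Finset.card_pos.1 hlt
    refine (Reach.of_wp (Q := fun m => m = (m₁.setReg 21 (m₁.arr 12 (layoutOf m₁).depth)).setReg 22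
      (m₁.arr 11 (layoutOf m₁).depth)) (by omega) ?_).then ?_
    · simp [Prog.wp, layoutOf]
    rintro m₂ hm₂
    have hfin : ∀ m, Good H D m → Env p q (m.setReg 11 1) ∧
        layoutOf (m.setReg 11 1) = layoutOf m := by
      intro m hm
      have e := hm.env
      refine ⟨?_, ?_⟩
      · constructor <;> simp [e.r0, e.r1, e.r5, e.r6, e.r7, e.r8, e.r10]
      · simp [layoutOf]
    have s₂ : SameBut 0 m₂ m₁ := by
      subst hm₂
      simp [SameBut.refl]
    have e₂ := s₂.env e₁
    have l₂ : layoutOf m₂ = layoutOf m₁ :=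
      s₂.layoutOf (by decide) (by decide) (by decide) (by decide)
    have hder₂ : Derived p q m₂ := by
      have h1 : m₂.arr = m₁.arr := by
        subst hm₂
        rfl
      have h2 : m₂.reg 11 = m₁.reg 11 := s₂.1 11 (by norm_num)
      obtain ⟨a1, a2, a3, a4, a5, a6, a7⟩ := hder
      constructor <;> (try rw [l₂]) <;> (try rw [h1]) <;> (try rw [h2]) <;> assumption
    have hst : ¬ m₂.reg 21 < m₂.reg 22 ↔ (layoutOf m₂).IsStable q := by
      have h21 : m₂.reg 21 = m₁.arr 12 (layoutOf m₁).depth := by simp [hm₂]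
      have h22 : m₂.reg 22 = m₁.arr 11 (layoutOf m₁).depth := by simp [hm₂]
      rw [h21, h22, l₂, Layout.IsStable]
      rcases Nat.eq_zero_or_pos (layoutOf m₁).depth with hk | hk
      · simp [hk, hder.addable_zero]
      · rw [hder.addable _ hk le_rfl, hder.edges _ hk le_rfl, not_lt]
        exact ⟨fun h _ => h, fun h => h hk⟩
    rw [← l₂] at hL hq h0 ⊢
    refine (Reach.ifLT (Q := fun m => Good H D m ∧ (((layoutOf m).part p q 0).Nonempty →
      (layoutOf m).pot p q D α κ + 1 ≤ (layoutOf m₂).pot p q D α κ)) (by omega)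
      (fun hlt' => ?_) (fun hlt' => ?_)).then ?_
    · have hns : ¬ (layoutOf m₂).IsStable q := fun h => hst.2 h hlt'
      have hns' := hns
      rw [Layout.IsStable] at hns'
      push Not at hns'
      refine (reach_collapse e₂ (by omega) hW hL hq hder₂ hns'.1 hns'.2).mono ?_
      rintro m ⟨a1, a2, a3, a4, a5⟩
      exact ⟨⟨a1, a2, by omega⟩, fun h0' => hL.pot_collapse a2 hD4 h0 h0' hα hκ hns a3 a4 a5⟩
    · have hs := hst.1 hlt'
      refine (reach_append hr hH hφ hd hdφ hD hπ e₂ hU (by omega) hL hq hder₂.levels h0 hs).mono ?_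
      rintro m ⟨a1, a2, a3, a4, a5⟩
      exact ⟨⟨a1, a2, a3⟩, fun _ => hL.pot_append hD4 h0 hα hκ0 hκ1 hg hs a4 a5⟩
    · rintro m ⟨hm, hpot⟩
      refine Reach.of_wp (by omega) ⟨hW1, ?_⟩
      obtain ⟨h3, h4⟩ := hfin m hm
      rw [h4]
      refine ⟨⟨h3, by rw [h4]; exact hm.inv, by rw [h4]; exact hm.depth_le⟩, Or.inr ⟨by simp, h0,
        hpot⟩⟩
  · rw [e₁.r6, hder.flag] at hlt
    refine ⟨⟨e₁, hL, hq⟩, Or.inl ⟨?_, ?_⟩⟩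
    · rw [hder.flag]
      omega
    · exact Finset.card_eq_zero.1 (by omega)

/-- If the potential is at most `n - 1`, the main loop ends after at most `n + 1` iterations. -/
lemma exec_while (hr : 1 ≤ r) (hH : H.IsBounded r) (hφ : H.StrongHaxell φ)
    (hd : 4 ≤ d) (hdφ : d * (r : ℝ) ^ 2 ≤ φ) (hD : D = ⌊d⌋₊)
    (hπ : π.FindsMaximalHalfLayers H d T)
    (hα : 0 < α) (hκ : κ = 1 - (47 / 48 : ℝ) ^ α) (hg : (5 * (D : ℝ) / 16) ^ (-α) ≤ κ / 2)
    (hU : p + q + T + 3 ≤ U) (hW : 48 * (p + q) + 2 ≤ W) (n : ℕ) (h : Good H D m₀)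
    (h11 : m₀.reg 11 = 1)
    (hn : ((layoutOf m₀).part p q 0).Nonempty → (layoutOf m₀).pot p q D α κ + 1 ≤ n) (c : ℕ) :
    ∃ (t : ℕ) (s : Config), Exec W π (.whileLT 6 11 bodyProg) ⟨m₀, c⟩ t s ∧
      t ≤ (n + 1) * (bodyProg.cst * U + 1) + 1 ∧ Good H D s.mem ∧
      (layoutOf s.mem).part p q 0 = ∅ := by
  have hD4 : 4 ≤ D := hD ▸ Nat.le_floor (by exact_mod_cast hd)
  have hκ0 : 0 < κ := by
    have := Real.rpow_lt_one (by norm_num) (by norm_num : (47 / 48 : ℝ) < 1) hα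
    linarith
  induction n generalizing m₀ c with
  | zero =>
    obtain ⟨t, s, h1, h2, h3, h4⟩ :=
      reach_body (W := W) hr hH hφ hd hdφ hD hπ hα hκ hg hU hW h c
    have hlt : m₀.reg 6 < m₀.reg 11 := by rw [h.env.r6, h11]; exact Nat.zero_lt_one
    rcases h4 with ⟨h4, h5⟩ | ⟨-, h5, -⟩
    · refine ⟨t + 1 + 1, s, .whileStep hlt h1 (.whileDone (by omega)), by omega, h3, h5⟩
    · have h6 := hn h5
      have h7 := h.inv.pot_nonneg hD4 h5 hα.le hκ0
      push_cast at h6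
      linarith
  | succ n ih =>
    obtain ⟨t, s, h1, h2, h3, h4⟩ :=
      reach_body (W := W) hr hH hφ hd hdφ hD hπ hα hκ hg hU hW h c
    have hlt : m₀.reg 6 < m₀.reg 11 := by rw [h.env.r6, h11]; exact Nat.zero_lt_one
    rcases h4 with ⟨h4, h5⟩ | ⟨h4, h5, h6⟩
    · refine ⟨t + 1 + 1, s, .whileStep hlt h1 (.whileDone (by omega)), ?_, h3, h5⟩
      rw [add_mul _ 1]
      omega
    · obtain ⟨t', s', h7, h8, h9⟩ := ih h3 h4 (fun h0 => by
        have h10 := hn h5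
        have h11 := h6 h0
        push_cast at h10
        linarith) s.calls
      refine ⟨t + t' + 1, s', .whileStep hlt h1 h7, ?_, h9⟩
      rw [add_mul _ 1]
      omega

/-- Without layers the potential is of order `N ^ (2 * α)`, because `4 / κ ≤ 2 * N ^ α`. -/
lemma pot_initial_le (hp : 1 ≤ p) (hdq : d ≤ q) (hd : 4 ≤ d) (hD : D = ⌊d⌋₊) (hα : 0 < α)
    (hκ0 : 0 < κ) (hg : (5 * (D : ℝ) / 16) ^ (-α) ≤ κ / 2) {L : Layout} (hdepth : L.depth = 0)
    (h0 : (L.part p q 0).Nonempty) :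
    L.pot p q D α κ ≤ 7 * ((p + q : ℕ) : ℝ) ^ (2 * α) := by
  have hD4 : 4 ≤ D := hD ▸ Nat.le_floor (by exact_mod_cast hd)
  have hDd : (D : ℝ) ≤ d := hD ▸ Nat.floor_le (by linarith)
  have hD0 : (0 : ℝ) < D := by positivity
  have hst : L.IsStable q := fun h => by omega
  set N : ℝ := ((p + q : ℕ) : ℝ) with hN
  have hN1 : 1 ≤ N := Nat.one_le_cast.2 (by omega)
  have hNd : d ≤ N := hdq.trans (Nat.cast_le.2 (Nat.le_add_left q p))
  have hx1 : (1 : ℝ) ≤ (L.part p q 0).card := by exact_mod_cast h0.card_pos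
  have hX : N ^ (2 * α) = N ^ α * N ^ α := by
    rw [two_mul, Real.rpow_add (by linarith)]
  have hN2 : 1 ≤ N ^ α := Real.one_le_rpow hN1 hα.le
  have hκ4 : 4 / κ ≤ 2 * N ^ α := by
    have h1 : (5 * (D : ℝ) / 16) ^ α ≤ N ^ α :=
      Real.rpow_le_rpow (by positivity) (by linarith) hα.le
    rw [Real.rpow_neg (by positivity)] at hg
    have h2 : 0 < (5 * (D : ℝ) / 16) ^ α := by positivity
    rw [inv_le_iff_one_le_mul₀ h2] at hg
    rw [div_le_iff₀ hκ0]
    have h3 : κ * (5 * (D : ℝ) / 16) ^ α ≤ κ * N ^ α := mul_le_mul_of_nonneg_left h1 hκ0.le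
    nlinarith
  have hle : (N / (L.part p q 0).card) ^ α ≤ N ^ α :=
    Real.rpow_le_rpow (by positivity) (div_le_self (by linarith) hx1) hα.le
  have hpos : 0 ≤ (N / (L.part p q 0).card) ^ α := by positivity
  rw [Layout.pot, potential, if_pos hst, hdepth]
  simp only [sumPotential, Finset.sum_range_succ, Finset.range_zero, Finset.sum_empty, zero_add,
    levelPotential, levelBound]
  have h1 : 4 / κ * (N ^ α - (N / (L.part p q 0).card) ^ α) ≤ 2 * N ^ α * N ^ α :=
    mul_le_mul hκ4 (by linarith) (by linarith) (by positivity)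
  have h2 : N ^ α ≤ N ^ α * N ^ α := le_mul_of_one_le_left (by linarith) hN2
  rw [hX]
  linarith

/-- The structure without layers and with the empty matching. -/
lemma inv_initial (H : BipartiteHypergraph (Fin p) (Fin q)) (D : ℕ) :
    Layout.Inv H D ⟨fun _ => 0, fun _ => 0, fun _ => 0, fun _ => 0, 0⟩ := by
  refine ⟨?_, ?_, ?_, ?_, ?_, ?_, ?_, ?_, ?_⟩
  · simp
  · intro a b h
    simp at h
  · simp
  · intro b h
    simp at h
  · intro b h
    simp at h
  · intro b c _ h
    simp at h
  · intro a j hj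
    refine le_trans (le_of_eq (Finset.card_eq_zero.2 ?_)) (Nat.zero_le D)
    refine Finset.filter_eq_empty_iff.2 fun e he => ?_
    have := (Layout.mem_edgesAt.1 he).1
    simp only at this
    omega
  · intro j h1 h2
    simp only at h2
    omega
  · intro j h1 h2
    simp only at h2
    omega

lemma reach_init (hW : 48 * (p + q) + 2 ≤ W) (hpq : 1 ≤ p + q) (k : ℕ) :
    Reach W π 1 initProg (initialConfig p q k).mem fun m =>
      Good H D m ∧ m.reg 11 = 1 ∧ (layoutOf m).depth = 0 := by
  refine reach_of_wp _ ?_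
  simp only [initProg, Prog.wp, Memory.setReg_reg, initialConfig]
  refine ⟨by omega, by omega, by omega, by omega, ?_⟩
  norm_num
  refine ⟨by omega, by omega, by omega, by omega, ⟨?_, ?_, ?_⟩, ?_⟩
  · constructor <;> simp
  · exact inv_initial H D
  · simp [layoutOf]
  · simp [layoutOf]

/-- The strong Haxell condition for a single vertex. -/
lemma le_card_of_strongHaxell (hr : 1 ≤ r) (hφ : H.StrongHaxell φ) (hd : 4 ≤ d)
    (hdφ : d * (r : ℝ) ^ 2 ≤ φ) (hp : 1 ≤ p) : d ≤ q := by
  have h1 := hφ {⟨0, hp⟩}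
  have h2 : coverNumber (H.incident {⟨0, hp⟩}) ≤ q := by
    refine Nat.sInf_le ⟨Finset.univ, by simp, fun e he => ?_⟩
    rw [Finset.inter_univ]
    exact H.nonempty_right e (Finset.mem_filter.1 he).1
  have h3 : (coverNumber (H.incident {⟨0, hp⟩}) : ℝ) ≤ q := by exact_mod_cast h2
  have h4 : (1 : ℝ) ≤ (r : ℝ) ^ 2 := one_le_pow₀ (by exact_mod_cast hr)
  rw [Finset.card_singleton, Nat.cast_one, mul_one] at h1
  nlinarith

end Main

end HPM

theorem lemma3p3 :
    ∃ (P : HPM.Prog) (κ : ℕ) (a : ℝ), 0 < a ∧ ∀ c : ℝ, 0 < c → ∃ K : ℝ, 0 < K ∧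
      ∀ (p q : ℕ) (H : HPM.BipartiteHypergraph (Fin p) (Fin q)) (r : ℕ) (φ d : ℝ)
        (π : HPM.Procedure) (T : ℕ),
        1 ≤ p + q → 1 ≤ r → H.IsBounded r → H.StrongHaxell φ →
        4 ≤ d → d * (r : ℝ) ^ 2 ≤ φ →
        π.FindsMaximalHalfLayers H d T → c * ((p + q : ℕ) : ℝ) ≤ (T : ℝ) →
        ∃ (M : Finset (HPM.Edge (Fin p) (Fin q))) (t : ℕ) (s : HPM.Config),
          HPM.Exec (κ * (p + q + ⌊d⌋₊)) π P (HPM.initialConfig p q ⌊d⌋₊) t s ∧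
          H.IsPerfectMatching M ∧ HPM.EncodesMatching (s.mem.arr 2) M ∧
          (t : ℝ) ≤ K * (T : ℝ) * ((p + q : ℕ) : ℝ) ^ (a / √(Real.log d)) := by
  set B := HPM.bodyProg.cst with hB
  set I := HPM.initProg.cst with hI
  -- The number of iterations is of order `N ^ (2 * α)` with `α = 160 / √(log d)`.
  refine ⟨HPM.mainProg, 100, 320, by norm_num, fun c hc =>
    ⟨(10 * (B + 1) + 1 + I) * (1 + 4 / c), by positivity, ?_⟩⟩
  intro p q H r φ d π T hpq hr hH hφ hd hdφ hπ hT
  set D := ⌊d⌋₊ with hD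
  have hlog : 0 < Real.log d := Real.log_pos (by linarith)
  set α : ℝ := 160 / √(Real.log d) with hα
  have hα0 : 0 < α := by positivity
  have hκ0 : 0 < 1 - (47 / 48 : ℝ) ^ α := by
    have := Real.rpow_lt_one (by norm_num) (by norm_num : (47 / 48 : ℝ) < 1) hα0
    linarith
  have hg := HPM.rpow_neg_le_half hd hα
  have hW : 48 * (p + q) + 2 ≤ 100 * (p + q + D) := by omega
  set U := p + q + T + 3 with hU
  set N : ℝ := ((p + q : ℕ) : ℝ) with hN
  have hN1 : 1 ≤ N := Nat.one_le_cast.2 hpq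
  have hX : 1 ≤ N ^ (2 * α) := Real.one_le_rpow hN1 (by positivity)
  obtain ⟨t₁, s₁, h1, h2, hgood, h11, hdepth⟩ :=
    HPM.reach_init (π := π) (H := H) (D := D) hW hpq D 0
  set n : ℕ := ⌈7 * N ^ (2 * α) + 1⌉₊ with hn
  obtain ⟨t₂, s₂, h3, h4, hgood', hfree⟩ := HPM.exec_while (U := U) hr hH hφ hd hdφ hD hπ hα0 rfl hg
    le_rfl hW n hgood h11 (fun h0 => by
      have hp : 1 ≤ p := by
        obtain ⟨a, -⟩ := h0
        exact a.pos
      have h5 := HPM.pot_initial_le hp (HPM.le_card_of_strongHaxell hr hφ hd hdφ hp) hd hD hα0 hκ0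
        hg hdepth h0
      have h6 := Nat.le_ceil (7 * N ^ (2 * α) + 1)
      linarith) s₁.calls
  refine ⟨_, t₁ + t₂, s₂, .seq h1 h3, hgood'.inv.isPerfectMatching hfree, hgood'.inv.encodes, ?_⟩
  have hexp : 320 / √(Real.log d) = 2 * α := by
    rw [hα]
    ring
  rw [hexp]
  set X := N ^ (2 * α)
  have hnX : (n : ℝ) + 1 ≤ 10 * X := by
    have h5 := Nat.ceil_lt_add_one (by positivity : (0 : ℝ) ≤ 7 * X + 1)
    linarith
  have hUT : (U : ℝ) ≤ (1 + 4 / c) * T := by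
    have h5 : N ≤ T / c := by
      rw [le_div_iff₀ hc]
      linarith
    have h6 : (U : ℝ) = N + T + 3 := by
      rw [hU, hN]
      push_cast
      ring
    have h7 : (1 + 4 / c) * T = T + 4 * (T / c) := by ring
    linarith
  have hU1 : (1 : ℝ) ≤ U := by exact_mod_cast (by omega : 1 ≤ U)
  have hBU : (B : ℝ) * U + 1 ≤ (B + 1) * U := by linarith
  have h5 : (t₁ : ℝ) ≤ I := by exact_mod_cast (by simpa using h2 : t₁ ≤ I)
  have h6 : (t₂ : ℝ) ≤ (n + 1) * (B * U + 1) + 1 := by exact_mod_cast h4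
  have h7 : ((n : ℝ) + 1) * (B * U + 1) ≤ 10 * X * ((B + 1) * U) :=
    mul_le_mul hnX hBU (by positivity) (by positivity)
  have hXU : 1 ≤ X * U := one_le_mul_of_one_le_of_one_le hX hU1
  have h8 : (1 + I : ℝ) * 1 ≤ (1 + I) * (X * U) := mul_le_mul_of_nonneg_left hXU (by positivity)
  calc ((t₁ + t₂ : ℕ) : ℝ) = t₁ + t₂ := by push_cast; ring
    _ ≤ 10 * X * ((B + 1) * U) + (1 + I) * (X * U) := by linarith
    _ = (10 * (B + 1) + 1 + I) * X * U := by ring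
    _ ≤ (10 * (B + 1) + 1 + I) * X * ((1 + 4 / c) * T) :=
        mul_le_mul_of_nonneg_left hUT (by positivity)
    _ = _ := by ring
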